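/- **Setting.** Let $d\ge 1$ and $1\le m_0\le m$ be integers. Let $\sigma:\mathbb R\to\mathbb R$ be a *good activation*: $\sigma$ is real analytic, and in its power series $\sigma(x)=\sum_{j\ge0}c_jx^j$ at $0$ one has $c_0\ne0$, $c_j\neq 0$ for infinitely many odd $j$, and $c_j\ne0$ for infinitely many even $j$. For $\theta=(a_k,w_k)_{k=1}^m\in\mathbb R^{(d+1)m}$ (with $a_k\in\mathbb R$, $w_k\in\mathbb R^d$) put $g(\theta,x)=\sum_{k=1}^m a_k\sigma(w_k\cdot x)$. Let $\bar w_1,\dots,\bar w_m\in\mathbb R^d$ be distinct, let $\bar a_1,\dots,\bar a_{m_0}\in\mathbb R\setminus\{0\}$, and let $f^*(x)=\sum_{k=1}^{m_0}\bar a_k\sigma(\bar w_k\cdot x)$ (so $\bar w_{m_0+1},\dots,\bar w_m$ is an arbitrary completion of the target weights). Let $Q^*=\{\theta: g(\theta,\cdot)=f^*\}$. For samples $x_1,\dots,x_n\in\mathbb R^d$ let $R(\theta)=\sum_{i=1}^n|g(\theta,x_i)-f^*(x_i)|^2$. *Separating samples.* For distinct $w_1,\dots,w_s$, the samples $x_1,\dots,x_n$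 are *type-I separating for* $w_1,\dots,w_s$ if there are indices $i_1,\dots,i_s$ such that the matrix $(\sigma(w_k\cdot x_{i_j}))_{j,k=1}^s$ has full rank. They are *type-II separating* if, moreover, the $n\times(d+1)s$ matrix with rows $(\sigma(w_1\cdot x_i),\dots,\sigma(w_s\cdot x_i),\sigma'(w_1\cdot x_i)x_i^{T},\dots,\sigma'(w_s\cdot x_i)x_i^{T})$ has full rank $\min(n,(d+1)s)$. *Branches.* A partition $P=(q_0,\dots,q_r)$ of $\{1,\dots,m\}$ is a sequence of integers $0=q_0<q_1<\dots<q_r=m$; its *deficient number* is $l=\#\{t: m_0<t\le r,\ q_t-q_{t-1}=1\}$. For $m_0\le r\le m$, $Q_P^r$ is the set of $\theta\in Q^*$ for which there are distinct $u_1,\dots,u_r\in\mathbb R^d$ with $u_t=\bar w_t$ for $t\le m_0$ and $w_k=u_t$ whenever $q_{t-1}<k\le q_t$. *Morse–Bott.* A smooth function $F$ is *Morse–Bott at* $M$ if $M$ is a non-empty embedded submanifold consisting of critical points of $F$, the restriction of $\operatorname{Hess}F(p)$ to the normal space of $M$ at $p$ is non-degenerate for each $p\in M$, and $M$ has a neighbourhood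 in which $F$ has no critical points outside $M$. **Lemma (Separation of $Q^*$, overparametrized case).** Let $x_1,\dots,x_{(d+1)m}\in\mathbb R^d$ be type-II separating samples for $\bar w_1,\dots,\bar w_m$. Below, $R$ is formed with $n$ of these samples (or with other samples where this is said). (a) Let $m_0\le n\le(d+1)m_0$. One can select $n$ of the given samples that are type-II separating for $\bar w_1,\dots,\bar w_{m_0}$. For every such selection, every $\theta^*\in Q^*$ has an open neighbourhood $U$ such that $R$ is Morse–Bott at $U\cap R^{-1}\{0\}$. Now let $m_0\le r\le m$ and $r\le n\le(d+1)m$, and let $P=(q_0,\dots,q_r)$ be a partition of $\{1,\dots,m\}$ with deficient number $l$. (b) If $n\le r+(r-l)d$, one can select $n$ of the given samples that are type-II separating for $\bar w_1,\dots,\bar w_{r-l}$. For every such selection there is an open $U\subseteq\mathbb R^{(d+1)m}$ such that $\emptyset\ne U\cap Q_P^r\subseteq U\cap R^{-1}\{0\}$ and $R$ is Morse–Bott at $U\cap R^{-1}\{0\}$. If $n>r+(m+m_0-r)d$, then for every selection of $n$ of the given samples, after an arbitrarily small perturbation of the given samples, which may be chosen so that they remain type-II separating for $\bar w_1,\dots,\bar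 w_m$, there is an open $U$ with $U\cap R^{-1}\{0\}=U\cap Q_P^r\neq\emptyset$. (c) Let $n\ge r+(m+m_0-r)d$. - If $r<(m+m_0)/2$, then for all samples $y_1,\dots,y_n\in\mathbb R^d$ and every open $U$ with $U\cap R^{-1}\{0\}=U\cap Q_P^r\ne\emptyset$, where $R$ is formed with the $y_i$, $R$ is not Morse–Bott at $U\cap Q_P^r$. - If $r\ge(m+m_0)/2$ and $l=2r-m-m_0$, then one can select $n$ of the given samples and an open $U$ such that $U\cap R^{-1}\{0\}=U\cap Q_P^r\neq\emptyset$ and $R$ is Morse–Bott at $U\cap Q_P^r$. - If $r\ge(m+m_0)/2$ and $l\ne 2r-m-m_0$, then for all samples $y_1,\dots,y_n\in\mathbb R^d$ and every open $U$ with $U\cap R^{-1}\{0\}=U\cap Q_P^r\ne\emptyset$, where $R$ is formed with the $y_i$, $R$ is not Morse–Bott at $U\cap Q_P^r$. In particular, when $r\ge(m+m_0)/2$, the samples and $U$ can be chosen so that $R$ is Morse–Bott at $U\cap Q_P^r$ if and only if $l=2r-m-m_0$. -/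

import Mathlib

open scoped ContDiff

namespace TwoLayer

/-! ## Submanifolds of Euclidean space and Morse–Bott functions -/

section MorseBott

variable {E : Type*} [NormedAddCommGroup E] [InnerProductSpace ℝ E]

/-- `M` is a smooth embedded submanifold of codimension `k`: near each of its points it is the
zero set of a smooth map to `ℝᵏ` that is a submersion at that point. -/
def IsSubmanifold (M : Set E) (k : ℕ) : Prop :=
  ∀ p ∈ M, ∃ V : Set E, IsOpen V ∧ p ∈ V ∧ ∃ F : E → EuclideanSpace ℝ (Fin k),
    ContDiffOn ℝ ∞ F V ∧ Function.Surjective (fderiv ℝ F p) ∧ M ∩ V = {q ∈ V | F q = 0}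

/-- Velocities at `p` of curves in `M` through `p`. For a submanifold this is the tangent space. -/
def tangentVectors (M : Set E) (p : E) : Set E :=
  {v | ∃ γ : ℝ → E, γ 0 = p ∧ (∀ᶠ t in nhds (0 : ℝ), γ t ∈ M) ∧ HasDerivAt γ v 0}

/-- The normal space of `M` at `p`: the orthogonal complement of the tangent space. -/
noncomputable def normalSpace (M : Set E) (p : E) : Submodule ℝ E :=
  (Submodule.span ℝ (tangentVectors M p))ᗮ

/-- The Hessian of `f` at `p` as a bilinear map. -/
noncomputable def hess (f : E → ℝ) (p : E) : E →L[ℝ] E →L[ℝ] ℝ :=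
  fderiv ℝ (fderiv ℝ f) p

/-- The smooth function `f` is Morse–Bott at `M`: `M` is a nonempty submanifold consisting of
critical points of `f`, the Hessian of `f` is non-degenerate on each normal space of `M`, and on
some neighbourhood of `M` there are no critical points of `f` outside `M`. -/
structure IsMorseBottAt (f : E → ℝ) (M : Set E) : Prop where
  smooth : ContDiff ℝ ∞ f
  nonempty : M.Nonempty
  submanifold : ∃ k, IsSubmanifold M k
  critical : ∀ p ∈ M, fderiv ℝ f p = 0
  nondegenerate : ∀ p ∈ M, ∀ u ∈ normalSpace M p,
    (∀ v ∈ normalSpace M p, hess f p u v = 0) → u = 0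
  isolated : ∃ W : Set E, IsOpen W ∧ M ⊆ W ∧ W ∩ {p | fderiv ℝ f p = 0} = M

end MorseBott

/-! ## Two-layer networks -/

/-- A good activation: real analytic, with power series `∑ cⱼ xʲ` at `0` such that `c₀ ≠ 0` and
infinitely many odd and infinitely many even coefficients are nonzero. -/
def IsGoodActivation (σ : ℝ → ℝ) : Prop :=
  AnalyticOnNhd ℝ σ Set.univ ∧
  ∃ (c : ℕ → ℝ) (ρ : ℝ), 0 < ρ ∧ (∀ x : ℝ, |x| < ρ → HasSum (fun j => c j * x ^ j) (σ x)) ∧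
    c 0 ≠ 0 ∧ ∀ N : ℕ, (∃ j, N < j ∧ Odd j ∧ c j ≠ 0) ∧ (∃ j, N < j ∧ Even j ∧ c j ≠ 0)

/-- Input (and inner weight) space `ℝᵈ`. -/
abbrev Input (d : ℕ) : Type := EuclideanSpace ℝ (Fin d)

/-- Parameter space `ℝ^((d+1)m)`; the coordinates with first index `k` are those of `(aₖ, wₖ)`. -/
abbrev Param (d m : ℕ) : Type := EuclideanSpace ℝ (Fin m × Fin (d + 1))

/-- The outer weight `aₖ`. -/
def outer {d m : ℕ} (θ : Param d m) (k : Fin m) : ℝ := θ (k, 0)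

/-- The inner weight `wₖ`. -/
def weight {d m : ℕ} (θ : Param d m) (k : Fin m) : Input d :=
  WithLp.toLp 2 fun j => θ (k, j.succ)

/-- The network `∑ₖ aₖ σ(wₖ · x)` with given weights. -/
noncomputable def network {d m : ℕ} (σ : ℝ → ℝ) (a : Fin m → ℝ) (w : Fin m → Input d)
    (x : Input d) : ℝ :=
  ∑ k, a k * σ (inner ℝ (w k) x)

/-- The model `g(θ, x)`. -/
noncomputable def model {d m : ℕ} (σ : ℝ → ℝ) (θ : Param d m) (x : Input d) : ℝ :=
  network σ (outer θ) (weight θ) x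

/-- The empirical loss `R(θ) = ∑ᵢ |g(θ, xᵢ) - f(xᵢ)|²` for the samples `x` and target `f`. -/
noncomputable def loss {d n : ℕ} (m : ℕ) (σ : ℝ → ℝ) (f : Input d → ℝ) (x : Fin n → Input d)
    (θ : Param d m) : ℝ :=
  ∑ i, |model σ θ (x i) - f (x i)| ^ 2

/-- The zero set of the loss. -/
def lossZero {d n : ℕ} (m : ℕ) (σ : ℝ → ℝ) (f : Input d → ℝ) (x : Fin n → Input d) :
    Set (Param d m) :=
  {θ | loss m σ f x θ = 0}

/-- `Q*`: the parameters that represent the target exactly. -/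
def Qstar {d : ℕ} (m : ℕ) (σ : ℝ → ℝ) (f : Input d → ℝ) : Set (Param d m) :=
  {θ | ∀ x, model σ θ x = f x}

/-! ## Separating samples -/

/-- Type-I separating samples for the distinct weights `w₁, …, w_s`: some `s` of the samples give
a full-rank matrix `(σ(wₖ · xᵢⱼ))`. -/
def IsTypeI {d s n : ℕ} (σ : ℝ → ℝ) (w : Fin s → Input d) (x : Fin n → Input d) : Prop :=
  Function.Injective w ∧ ∃ i : Fin s → Fin n,
    (Matrix.of fun (j k : Fin s) => σ (inner ℝ (w k) (x (i j)))).rank = s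

/-- The matrix with rows `(σ(w₁·xᵢ), …, σ(w_s·xᵢ), σ'(w₁·xᵢ)xᵢᵀ, …, σ'(w_s·xᵢ)xᵢᵀ)`. -/
noncomputable def sampleMatrix {d s n : ℕ} (σ : ℝ → ℝ) (w : Fin s → Input d)
    (x : Fin n → Input d) : Matrix (Fin n) (Fin s ⊕ Fin s × Fin d) ℝ :=
  Matrix.of fun i c => match c with
    | Sum.inl k => σ (inner ℝ (w k) (x i))
    | Sum.inr (k, j) => deriv σ (inner ℝ (w k) (x i)) * x i j

/-- Type-II separating samples for the distinct weights `w₁, …, w_s`: they are type-I separating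
and the `n × (d+1)s` matrix above has full rank. -/
def IsTypeII {d s n : ℕ} (σ : ℝ → ℝ) (w : Fin s → Input d) (x : Fin n → Input d) : Prop :=
  IsTypeI σ w x ∧ (sampleMatrix σ w x).rank = min n ((d + 1) * s)

/-! ## Partitions and branches -/

/-- A partition `0 = q₀ < q₁ < ⋯ < q_r = m`. -/
structure Partition (m r : ℕ) where
  q : Fin (r + 1) → ℕ
  strictMono : StrictMono q
  zero : q 0 = 0
  last : q (Fin.last r) = m

/-- The (zero-based) index `k` lies in the (zero-based) block `t`. -/
def Partition.InBlock {m r : ℕ} (P : Partition m r) (t : Fin r) (k : Fin m) : Prop :=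
  P.q t.castSucc ≤ k ∧ (k : ℕ) < P.q t.succ

/-- The deficient number: the number of blocks of size one beyond the first `m₀` blocks. -/
def Partition.deficient {m r : ℕ} (P : Partition m r) (m₀ : ℕ) : ℕ :=
  (Finset.univ.filter fun t : Fin r =>
    m₀ ≤ (t : ℕ) ∧ P.q t.succ = P.q t.castSucc + 1).card

/-- The branch `Q_P^r`: the parameters in `Q*` with exactly `r` distinct inner weights
`u₁, …, u_r`, the weight being `u_t` on the `t`-th block, and `u_t = w̄_t` for `t ≤ m₀`. -/
def branch {d m r m₀ : ℕ} (σ : ℝ → ℝ) (f : Input d → ℝ) (wbar : Fin m₀ → Input d)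
    (P : Partition m r) : Set (Param d m) :=
  {θ ∈ Qstar m σ f | ∃ u : Fin r → Input d, Function.Injective u ∧
    (∀ t k, P.InBlock t k → weight θ k = u t) ∧
    ∀ (t : Fin r) (s : Fin m₀), (t : ℕ) = s → u t = wbar s}

/-- The open set `U` meets the set `Q`, and inside `U` the set `Z` coincides with `Q`. -/
def Separates {E : Type*} [TopologicalSpace E] (U Z Q : Set E) : Prop :=
  IsOpen U ∧ (U ∩ Q).Nonempty ∧ U ∩ Z = U ∩ Q

end TwoLayer

/-! The loss is `‖G‖²` with `G` the vector of residuals. At a zero of `G` its Hessian is `2⟨dG u, dG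
v⟩`, so everything is decided by the rank of `dG` there.

If `dG` is onto, the zero set is a submanifold with tangent space `ker dG`, and a nearby critical
point has `G` orthogonal to the whole space, hence is a zero (`isMorseBottAt_zero_of_surjective`).
For (a), every exact representation has active neurons at all target weights (`exists_active`), and
these alone make `dG` onto. For few samples in (b), nondeficient blocks supply rank `min n
((d+1)(r-l))`, and the free weights of the `l` deficient blocks can be chosen to fill the remaining
dimensions (`exists_completing_neurons`).

On a branch, `dG` factors through the block sums of the variations of `aₖ` and of `aₖ` times the
variations of `wₖ`. The second kind is absent for a deficient block, whose only outer weight is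
zero. So `dG` has rank at most `r + (r-l)d`, while the branch, an open part of an affine space, has
codimension `r + (m+m₀-r)d`. Always `r-l ≤ m+m₀-r`. If the inequality is strict, some nonzero normal
vector is killed by `dG` and Morse–Bott fails (`not_isMorseBottAt_branch`). Equality is the
condition `l = 2r-m-m₀`; then at a suitable point and for suitable samples `dG` is injective on the
normal space, which gives separation and Morse–Bott together (`isMorseBottAt_affine`).

Separation for many samples cannot use `dG`, which may be degenerate. Expanding each neuron about
the weight of its block writes the residual as a combination of independent Taylor features; its
coefficients, the moments, are polynomials in the free outer weights and in as many transversal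
coordinates as the codimension. Each generic sample is a linear form lowering the dimension of the
family of moment directions by one. With more samples than the codimension, no limit direction over
a generic choice of free outer weights is killed by all of them (`exists_generic_forms`). Outer
weights of constant sign in each block let the even moments bound the offsets, so the Taylor
remainder is negligible. Other zeros of the loss accumulating at the branch point would produce a
forbidden limit direction (`notMem_closure_lossZero_diff`). The independence used throughout comes
from exponential polynomials (`independent_derivatives`). -/

namespace TwoLayer

/-! ## Generic points on a family of varieties -/

section Algebra

open MvPolynomial

variable {K B : Type*} [Field K] [CommRing B] [Algebra K B]

/-- Every `k` elements are algebraically dependent modulo the ideal `I`. -/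
def DepMod (K : Type*) {B : Type*} [Field K] [CommRing B] [Algebra K B] (I : Ideal B) (k : ℕ) :
    Prop :=
  ∀ b : Fin k → B, ¬ AlgebraicIndependent K fun i => Ideal.Quotient.mkₐ K I (b i)

/-- A relation modulo an ideal, in terms of membership. -/
theorem not_algebraicIndependent_mk {I : Ideal B} {ι : Type*} {b : ι → B} :
    ¬ AlgebraicIndependent K (fun i => Ideal.Quotient.mkₐ K I (b i)) ↔
      ∃ Q : MvPolynomial ι K, Q ≠ 0 ∧ aeval b Q ∈ I := by
  have key : ∀ Q : MvPolynomial ι K, aeval (fun i => Ideal.Quotient.mkₐ K I (b i)) Q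
      = Ideal.Quotient.mkₐ K I (aeval b Q) := by
    intro Q
    rw [← comp_aeval_apply]
  rw [algebraicIndependent_iff]
  push Not
  refine exists_congr fun Q => ?_
  rw [key, and_comm, Ideal.Quotient.mkₐ_eq_mk, Ideal.Quotient.eq_zero_iff_mem]

/-- Passing to a strictly larger prime lowers the transcendence degree. -/
theorem DepMod.of_lt {p q : Ideal B} [hp : p.IsPrime] (hpq : p < q) {k : ℕ}
    (h : DepMod K p (k + 1)) : DepMod K q k := by
  intro b
  -- Take a relation between `f` and the `b` modulo `p`. As `f ∉ p`, powers of `f` can be divided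
  -- out until the coefficient of `f ^ 0` is a nonzero polynomial; as `f ∈ q`, only that coefficient
  -- survives modulo `q`.
  obtain ⟨f, hfq, hfp⟩ := SetLike.exists_of_lt hpq
  obtain ⟨Q, hQ, hQp⟩ := not_algebraicIndependent_mk.1 (h (Fin.cons f b))
  rw [not_algebraicIndependent_mk]
  set G := finSuccEquiv K k Q with hG
  have hG0 : G ≠ 0 := by
    rw [hG]; exact (map_ne_zero_iff _ (finSuccEquiv K k).injective).2 hQ
  have hGp : Polynomial.eval₂ (aeval b : MvPolynomial (Fin k) K →ₐ[K] B).toRingHom f G ∈ p := by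
    have : ∀ Q, Polynomial.eval₂ (aeval b : MvPolynomial (Fin k) K →ₐ[K] B).toRingHom f
        (finSuccEquiv K k Q) = aeval (Fin.cons f b : Fin (k + 1) → B) Q := by
      intro Q
      induction Q using MvPolynomial.induction_on with
      | C a => simp [finSuccEquiv_apply]
      | add P Q hP hQ' => rw [map_add, Polynomial.eval₂_add, hP, hQ', map_add]
      | mul_X P i hP =>
        rw [map_mul, Polynomial.eval₂_mul, hP, map_mul]
        refine Fin.cases ?_ (fun j => ?_) i
        · rw [finSuccEquiv_X_zero, Polynomial.eval₂_X]; simp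
        · rw [finSuccEquiv_X_succ, Polynomial.eval₂_C]; simp
    rwa [hG, this]
  obtain ⟨n, H, hH⟩ : ∃ n, ∃ H : Polynomial (MvPolynomial (Fin k) K),
      G = Polynomial.X ^ n * H ∧ H.coeff 0 ≠ 0 := by
    obtain ⟨H, h1, h2⟩ := Polynomial.exists_eq_pow_rootMultiplicity_mul_and_not_dvd G hG0 0
    refine ⟨_, H, by simpa using h1, fun h0 => h2 ?_⟩
    simpa using Polynomial.X_dvd_iff.2 h0
  refine ⟨H.coeff 0, hH.2, ?_⟩
  rw [hH.1, Polynomial.eval₂_mul, Polynomial.eval₂_X_pow] at hGp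
  have hHp := (hp.mem_or_mem hGp).resolve_left fun h' => hfp (hp.mem_of_pow_mem _ h')
  have hHq := hpq.le hHp
  have : H = Polynomial.X * H.divX + Polynomial.C (H.coeff 0) := (Polynomial.X_mul_divX_add H).symm
  rw [this, Polynomial.eval₂_add, Polynomial.eval₂_mul, Polynomial.eval₂_X, Polynomial.eval₂_C]
    at hHq
  exact (Ideal.add_mem_iff_right _ (q.mul_mem_right _ hfq)).1 hHq

/-- The linear form with coefficients `φ`, as a polynomial in the second group of variables. -/
noncomputable def linForm {A I : Type*} [Fintype I] (φ : I → ℝ) : MvPolynomial (A ⊕ I) ℝ :=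
  ∑ i, C (φ i) * X (Sum.inr i)

/-- Adding generic linear forms one at a time lowers the dimension of a finite family of
varieties (of which each contains only points with nonzero second component). -/
theorem exists_generic_primes {A I Y : Type*} [Finite A] [Fintype I] [TopologicalSpace Y]
    [BaireSpace Y]
    (Φ : Y → I → ℝ)
    (hΦ : ∀ y : I → ℝ, y ≠ 0 → IsOpen {x | ∑ i, Φ x i * y i ≠ 0} ∧
      Dense {x | ∑ i, Φ x i * y i ≠ 0})
    (k n : ℕ) (S : Set (Ideal (MvPolynomial (A ⊕ I) ℝ))) (hS : S.Finite)
    (hprime : ∀ p ∈ S, p.IsPrime) (hdep : ∀ p ∈ S, DepMod ℝ p (k + n))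
    (hne : ∀ p ∈ S, ∀ (a : A → ℝ) (y : I → ℝ),
      (∀ g ∈ p, eval (Sum.elim a y) g = 0) → y ≠ 0)
    (O : Fin n → Set Y) (hO : ∀ i, IsOpen (O i)) (hO' : ∀ i, (O i).Nonempty) :
    ∃ x : Fin n → Y, (∀ i, x i ∈ O i) ∧
      ∃ S' : Set (Ideal (MvPolynomial (A ⊕ I) ℝ)), S'.Finite ∧ (∀ p ∈ S', DepMod ℝ p k) ∧
        ∀ (a : A → ℝ) (y : I → ℝ), (∃ p ∈ S, ∀ g ∈ p, eval (Sum.elim a y) g = 0) →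
          (∀ i, ∑ j, Φ (x i) j * y j = 0) → ∃ p ∈ S', ∀ g ∈ p, eval (Sum.elim a y) g = 0 := by
  induction n generalizing S with
  | zero =>
    exact ⟨Fin.elim0, fun i => i.elim0, S, hS, hdep, fun a y h _ => h⟩
  | succ n ih =>
    classical
    -- the primes with a real point
    set S₁ := {p ∈ S | ∃ (a : A → ℝ) (y : I → ℝ), ∀ g ∈ p, eval (Sum.elim a y) g = 0} with hS₁
    have hS₁f : S₁.Finite := hS.subset fun p hp => hp.1
    choose! pa py hpy using fun (p : Ideal (MvPolynomial (A ⊕ I) ℝ)) (hp : p ∈ S₁) => hp.2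
    obtain ⟨x₀, hx₀O, hx₀⟩ : ∃ x₀ ∈ O 0, ∀ p ∈ S₁, ∑ i, Φ x₀ i * py p i ≠ 0 := by
      have h1 : Dense (⋂ p ∈ S₁, {x | ∑ i, Φ x i * py p i ≠ 0}) :=
        dense_biInter_of_isOpen (fun p hp => (hΦ _ (hne p hp.1 _ _ (hpy p hp))).1) hS₁f.countable
          fun p hp => (hΦ _ (hne p hp.1 _ _ (hpy p hp))).2
      obtain ⟨x₀, h2, h3⟩ := h1.inter_open_nonempty _ (hO 0) (hO' 0)
      exact ⟨x₀, h2, by simpa using h3⟩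
    set J : Ideal (MvPolynomial (A ⊕ I) ℝ) → Ideal (MvPolynomial (A ⊕ I) ℝ) :=
      fun p => p ⊔ Ideal.span {linForm (Φ x₀)} with hJ
    have heval : ∀ (a : A → ℝ) (y : I → ℝ), eval (Sum.elim a y) (linForm (Φ x₀))
        = ∑ j, Φ x₀ j * y j := by
      intro a y; simp [linForm]
    -- The form is nonzero at a real point of `p`, so it is not in `p`, and every prime above both
    -- is strictly larger. Primes without real points escape this argument, but no zeros are lost
    -- with them.
    have hlt : ∀ p ∈ S₁, ∀ q ∈ (J p).minimalPrimes, p < q := by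
      intro p hp q hq
      have hle : J p ≤ q := hq.1.2
      refine lt_of_le_of_ne (le_sup_left.trans hle) ?_
      rintro rfl
      have : linForm (Φ x₀) ∈ p := hle (Ideal.mem_sup_right (Ideal.mem_span_singleton_self _))
      exact hx₀ p hp ((heval _ _).symm.trans (hpy p hp _ this))
    obtain ⟨x, hxO, S', hS', hS'dep, hS'z⟩ := ih (⋃ p ∈ S₁, (J p).minimalPrimes)
      (hS₁f.biUnion fun p _ => Ideal.finite_minimalPrimes_of_isNoetherianRing _ _)
      (by
        intro q hq
        obtain ⟨p, hp, hq⟩ := Set.mem_iUnion₂.1 hq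
        exact hq.1.1)
      (by
        intro q hq
        obtain ⟨p, hp, hq⟩ := Set.mem_iUnion₂.1 hq
        have := hprime p hp.1
        exact (hdep p hp.1).of_lt (hlt p hp q hq))
      (by
        intro q hq a y hz
        obtain ⟨p, hp, hq⟩ := Set.mem_iUnion₂.1 hq
        exact hne p hp.1 a y fun g hg => hz g ((hlt p hp q hq).le hg))
      (fun i => O i.succ) (fun i => hO _) (fun i => hO' _)
    refine ⟨Fin.cons x₀ x, fun i => ?_, S', hS', hS'dep, ?_⟩
    · refine Fin.cases ?_ (fun j => ?_) i
      · simpa using hx₀O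
      · simpa using hxO j
    · rintro a y ⟨p, hp, hz⟩ hx
      refine hS'z a y ?_ fun i => by simpa using hx i.succ
      have hp₁ : p ∈ S₁ := ⟨hp, a, y, hz⟩
      -- the point lies on one of the minimal primes
      set e : MvPolynomial (A ⊕ I) ℝ →+* ℝ := eval (Sum.elim a y)
      have hle : J p ≤ RingHom.ker e := by
        refine sup_le (fun g hg => hz g hg) ?_
        rw [Ideal.span_singleton_le_iff_mem, RingHom.mem_ker, heval]
        simpa using hx 0
      have : (RingHom.ker e).IsPrime := RingHom.ker_isPrime e
      obtain ⟨q, hq, hqe⟩ := Ideal.exists_minimalPrimes_le hle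
      exact ⟨q, Set.mem_iUnion₂.2 ⟨p, hp₁, hq⟩, fun g hg => hqe hg⟩

/-- The family `(a, h) ↦ (a, τ (a, h) / τᵢ (a, h))` on polynomial functions. -/
noncomputable def chartHom {A H I : Type*} (τ : I → MvPolynomial (A ⊕ H) ℝ) (i : I) :
    MvPolynomial (A ⊕ I) ℝ →ₐ[ℝ] Localization.Away (τ i) :=
  aeval (Sum.elim (fun k => algebraMap (MvPolynomial (A ⊕ H) ℝ) _ (X (Sum.inl k)))
    fun j => IsLocalization.mk' _ (τ j) (⟨τ i, Submonoid.mem_powers _⟩ : Submonoid.powers (τ i)))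

/-- Evaluation at `(a, h)` extends to the localization when `τ i` does not vanish there, and its
composite with `chartHom` is evaluation at the image point. -/
theorem eval_eq_zero_of_chartHom {A H I : Type*} {τ : I → MvPolynomial (A ⊕ H) ℝ} {i : I}
    {g : MvPolynomial (A ⊕ I) ℝ} (hg : chartHom τ i g = 0) (a : A → ℝ) (h : H → ℝ)
    (hi : eval (Sum.elim a h) (τ i) ≠ 0) :
    eval (Sum.elim a fun j => eval (Sum.elim a h) (τ j) / eval (Sum.elim a h) (τ i)) g = 0 := by
  set φ : Localization.Away (τ i) →+* ℝ :=
    IsLocalization.Away.lift (τ i) (g := eval (Sum.elim a h)) (isUnit_iff_ne_zero.2 hi) with hφ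
  have hφm : ∀ f, φ (algebraMap _ _ f) = eval (Sum.elim a h) f :=
    fun f => IsLocalization.Away.lift_eq _ _ _
  have key : φ.comp (chartHom τ i).toRingHom = eval (Sum.elim a fun j =>
      eval (Sum.elim a h) (τ j) / eval (Sum.elim a h) (τ i)) := by
    refine MvPolynomial.ringHom_ext (fun c => ?_) fun k => ?_
    · have : (chartHom τ i) (C c) = algebraMap _ _ (C c : MvPolynomial (A ⊕ H) ℝ) := by
        rw [chartHom, aeval_C]; rfl
      simp [this, hφm]
    · rcases k with k | j
      · simp [chartHom, hφm]
      · have : φ (IsLocalization.mk' _ (τ j)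
            (⟨τ i, Submonoid.mem_powers _⟩ : Submonoid.powers (τ i)))
            * eval (Sum.elim a h) (τ i) = eval (Sum.elim a h) (τ j) := by
          rw [← hφm, ← map_mul, IsLocalization.mk'_spec (Localization.Away (τ i)) (τ j)
            (⟨τ i, Submonoid.mem_powers _⟩ : Submonoid.powers (τ i)), hφm]
        simp only [chartHom, AlgHom.toRingHom_eq_coe, RingHom.coe_comp, RingHom.coe_coe,
          Function.comp_apply, aeval_X, Sum.elim_inr, eval_X]
        rw [eq_div_iff hi, this]
  rw [← key]
  simp [hg]

/-- The quotient by the kernel embeds in the localization, which is algebraic over the polynomial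
ring and so has transcendence degree the number of variables. -/
theorem depMod_ker_chartHom {A H I : Type*} [Fintype A] [Fintype H]
    (τ : I → MvPolynomial (A ⊕ H) ℝ) (i : I) (hi : τ i ≠ 0) {k : ℕ}
    (hk : Fintype.card A + Fintype.card H < k) :
    DepMod ℝ (RingHom.ker (chartHom τ i)) k := by
  intro b hb
  have h1 : AlgebraicIndependent ℝ (fun j => chartHom τ i (b j)) := by
    have := hb.map' (f := Ideal.kerLiftAlg (chartHom τ i)) (Ideal.kerLiftAlg_injective _)
    exact this
  have hle : Submonoid.powers (τ i) ≤ nonZeroDivisors (MvPolynomial (A ⊕ H) ℝ) :=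
    powers_le_nonZeroDivisors_of_noZeroDivisors hi
  have : IsDomain (Localization.Away (τ i)) := IsLocalization.isDomain_localization hle
  have : FaithfulSMul (MvPolynomial (A ⊕ H) ℝ) (Localization.Away (τ i)) :=
    (faithfulSMul_iff_algebraMap_injective _ _).2 (IsLocalization.injective _ hle)
  have halg : Algebra.IsAlgebraic (MvPolynomial (A ⊕ H) ℝ) (Localization.Away (τ i)) :=
    IsLocalization.isAlgebraic _ (Submonoid.powers (τ i))
  have h2 := h1.lift_cardinalMk_le_trdeg
  have h3 := lift_trdeg_add_eq ℝ (MvPolynomial (A ⊕ H) ℝ) (Localization.Away (τ i))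
  rw [MvPolynomial.trdeg_of_isDomain, trdeg_eq_zero] at h3
  have h4 : (k : Cardinal) ≤ (Fintype.card A + Fintype.card H : ℕ) := by
    simp only [Cardinal.lift_id, Cardinal.lift_id',
      add_zero] at h3
    simpa [← h3] using h2
  exact absurd (by exact_mod_cast h4) (not_le.2 hk)

/-- Generic linear forms do not vanish on the limit directions, over a generic base point, of a
polynomial family with fewer parameters than there are linear forms. -/
theorem exists_generic_forms {A H I Y : Type*} [Fintype A] [Fintype H] [Fintype I]
    [TopologicalSpace Y] [BaireSpace Y] (τ : I → MvPolynomial (A ⊕ H) ℝ) (Φ : Y → I → ℝ)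
    (hΦ : ∀ y : I → ℝ, y ≠ 0 → IsOpen {x | ∑ i, Φ x i * y i ≠ 0} ∧
      Dense {x | ∑ i, Φ x i * y i ≠ 0})
    {n : ℕ} (hn : Fintype.card H < n)
    (O : Fin n → Set Y) (hO : ∀ i, IsOpen (O i)) (hO' : ∀ i, (O i).Nonempty) :
    ∃ x : Fin n → Y, (∀ i, x i ∈ O i) ∧ ∃ Q : MvPolynomial A ℝ, Q ≠ 0 ∧
      ∀ a : A → ℝ, eval a Q ≠ 0 → ∀ y : I → ℝ, y ≠ 0 →
        (a, y) ∈ closure {z : (A → ℝ) × (I → ℝ) | ∃ (h : H → ℝ) (c : ℝ),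
          z.2 = fun i => c * eval (Sum.elim z.1 h) (τ i)} →
        ∃ i, ∑ j, Φ (x i) j * y j ≠ 0 := by
  classical
  -- The charts have dimension at most `card A + card H`; after `n > card H` cuts the dimension is
  -- below `card A`, so what remains cannot dominate the base.
  obtain ⟨x, hxO, S, hS, hdep, hz⟩ := exists_generic_primes Φ hΦ (Fintype.card A) n
    ((fun i => RingHom.ker (chartHom τ i)) '' {i | τ i ≠ 0}) (Set.toFinite _)
    (by
      rintro _ ⟨i, hi, rfl⟩
      have : IsDomain (Localization.Away (τ i)) := IsLocalization.isDomain_localization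
        (powers_le_nonZeroDivisors_of_noZeroDivisors hi)
      exact RingHom.ker_isPrime _)
    (by
      rintro _ ⟨i, hi, rfl⟩
      exact depMod_ker_chartHom τ i hi (by omega))
    (by
      rintro _ ⟨i, hi, rfl⟩ a y hy rfl
      -- In the chart `yᵢ = 1`, so no real point has zero second component.
      have : (X (Sum.inr i) - 1 : MvPolynomial (A ⊕ I) ℝ) ∈ RingHom.ker (chartHom τ i) := by
        rw [RingHom.mem_ker, map_sub, map_one, sub_eq_zero]
        simp [chartHom]
      simpa using hy _ this)
    O hO hO'
  refine ⟨x, hxO, ?_⟩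
  -- the relation on the base on each of the remaining varieties
  have hQ : ∀ p ∈ S, ∃ Q : MvPolynomial A ℝ, Q ≠ 0 ∧ rename Sum.inl Q ∈ p := by
    intro p hp
    obtain ⟨Q, hQ, hQp⟩ := not_algebraicIndependent_mk.1
      (hdep p hp fun i => X (Sum.inl ((Fintype.equivFin A).symm i)))
    refine ⟨rename (Fintype.equivFin A).symm Q,
      (map_ne_zero_iff _ (rename_injective _ (Equiv.injective _))).2 hQ, ?_⟩
    rw [rename_rename]
    rw [rename_eq_aeval]; exact hQp
  choose! Q hQ0 hQp using hQ
  refine ⟨∏ p ∈ hS.toFinset, Q p, Finset.prod_ne_zero_iff.2 fun p hp => hQ0 p (by simpa using hp),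
    fun a ha y hy hcl => ?_⟩
  by_contra! hzero
  obtain ⟨i, hi⟩ : ∃ i, y i ≠ 0 := by
    by_contra! h; exact hy (funext h)
  -- the chart `yᵢ = 1`
  have hτ : τ i ≠ 0 := by
    intro h0
    have : (a, y) ∈ {z : (A → ℝ) × (I → ℝ) | z.2 i = 0} := by
      refine closure_minimal ?_ (isClosed_eq (by fun_prop) continuous_const) hcl
      rintro z ⟨h, c, hz⟩
      simp [hz, h0]
    exact hi this
  -- The scalar `c` cancels in the quotients `yⱼ / yᵢ`, which are continuous where `yᵢ ≠ 0`; so the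
  -- relations of the chart pass to limit points.
  have hmem : ∀ g ∈ RingHom.ker (chartHom τ i),
      eval (Sum.elim a fun j => y j / y i) g = 0 := by
    intro g hg
    by_contra hne
    have hcont : ContinuousAt (fun z : (A → ℝ) × (I → ℝ) =>
        eval (Sum.elim z.1 fun j => z.2 j / z.2 i) g) (a, y) := by
      refine (MvPolynomial.continuous_eval g).continuousAt.comp ?_
      refine continuousAt_pi.2 fun k => ?_
      rcases k with k | j
      · simp only [Sum.elim_inl]; fun_prop
      · simp only [Sum.elim_inr]
        exact ContinuousAt.div (by fun_prop) (by fun_prop) hi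
    have hi' : ∀ᶠ z : (A → ℝ) × (I → ℝ) in nhds (a, y), z.2 i ≠ 0 :=
      ContinuousAt.eventually_ne (by fun_prop) hi
    obtain ⟨z, ⟨hz1, hz2⟩, h, c, hzc⟩ := mem_closure_iff_nhds.1 hcl _
      ((hcont.eventually_ne hne).and hi')
    have hc : c ≠ 0 := by rintro rfl; simp [hzc] at hz2
    have hτi : eval (Sum.elim z.1 h) (τ i) ≠ 0 := by
      intro h0; simp [hzc, h0] at hz2
    apply hz1
    rw [← eval_eq_zero_of_chartHom (RingHom.mem_ker.1 hg) z.1 h hτi]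
    congr 3
    funext j
    simp only [hzc]
    field_simp
  obtain ⟨p, hp, hpz⟩ := hz a (fun j => y j / y i) ⟨_, ⟨i, hτ, rfl⟩, hmem⟩ (fun k => by
    have := hzero k
    simp only [← mul_div_assoc, ← Finset.sum_div, this, zero_div])
  apply ha
  rw [map_prod]
  refine Finset.prod_eq_zero (i := p) (by simpa using hp) ?_
  have := hpz _ (hQp p hp)
  rw [eval_rename] at this
  simpa using this

end Algebra

/-! ## Linear independence of neurons and their derivatives -/

section Independence

open Filter Topology Polynomial

/-! ### Exponential polynomials in an integer variable -/

theorem eq_zero_of_tendsto_eval {Q : ℝ[X]} {S : Set ℕ} (hS : S.Infinite)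
    (h : Tendsto (fun i : ℕ => Q.eval (i : ℝ)) (atTop ⊓ 𝓟 S) (𝓝 0)) : Q = 0 := by
  have : (atTop ⊓ 𝓟 S).NeBot := by
    rw [← Nat.cofinite_eq_atTop]; exact hS.cofinite_inf_principal_neBot
  have h1 : Tendsto (fun i : ℕ => (i : ℝ)) (atTop ⊓ 𝓟 S) atTop :=
    tendsto_natCast_atTop_atTop.mono_left inf_le_left
  by_contra hQ
  rcases lt_or_ge 0 Q.degree with hd | hd
  · exact not_tendsto_nhds_of_tendsto_atTop ((Q.abs_tendsto_atTop hd).comp h1) _ h.abs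
  · rw [Polynomial.eq_C_of_degree_le_zero hd] at h hQ
    simp only [eval_C] at h
    exact hQ (by rw [tendsto_nhds_unique tendsto_const_nhds h, C_0])

theorem tendsto_eval_mul_pow (Q : ℝ[X]) {β : ℝ} (h0 : 0 ≤ β) (h1 : β < 1) :
    Tendsto (fun i : ℕ => Q.eval (i : ℝ) * β ^ i) atTop (𝓝 0) := by
  have : (fun i : ℕ => Q.eval (i : ℝ) * β ^ i) =
      fun i : ℕ => ∑ j ∈ Finset.range (Q.natDegree + 1), Q.coeff j * ((i : ℝ) ^ j * β ^ i) := by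
    funext i
    rw [eval_eq_sum_range, Finset.sum_mul]
    exact Finset.sum_congr rfl fun j _ => by ring
  rw [this]
  have h2 : ∀ j, Tendsto (fun i : ℕ => Q.coeff j * ((i : ℝ) ^ j * β ^ i)) atTop (𝓝 0) := by
    intro j
    simpa using (tendsto_pow_const_mul_const_pow_of_lt_one j h0 h1).const_mul (Q.coeff j)
  simpa using tendsto_finsetSum (Finset.range (Q.natDegree + 1)) fun j _ => h2 j

/-- Exponential polynomials with positive bases vanish if they vanish infinitely often. -/
theorem expPoly_eq_zero_of_pos (s : Finset ℝ) (hs : ∀ β ∈ s, 0 < β) (Q : ℝ → ℝ[X]) {S : Set ℕ}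
    (hS : S.Infinite) (h : ∀ i ∈ S, ∑ β ∈ s, (Q β).eval (i : ℝ) * β ^ i = 0) :
    ∀ β ∈ s, Q β = 0 := by
  induction s using Finset.induction_on_max with
  | empty => simp
  | insert b s hb ih =>
    have hbs : b ∉ s := fun h => lt_irrefl _ (hb b h)
    have hb0 : 0 < b := hs b (Finset.mem_insert_self _ _)
    -- Divided by the power of the largest base, all other terms tend to zero; hence its polynomial
    -- tends to zero along `S`, which forces it to vanish.
    have hQb : Q b = 0 := by
      refine eq_zero_of_tendsto_eval hS ?_
      have h1 : Tendsto (fun i : ℕ => -∑ β ∈ s, (Q β).eval (i : ℝ) * (β / b) ^ i)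
          (atTop ⊓ 𝓟 S) (𝓝 0) := by
        have := tendsto_finsetSum (f := fun β (i : ℕ) => (Q β).eval (i : ℝ) * (β / b) ^ i)
          (x := atTop) (a := fun _ => (0 : ℝ)) s fun β hβ =>
          tendsto_eval_mul_pow (Q β)
            (div_nonneg (hs β (Finset.mem_insert_of_mem hβ)).le hb0.le)
            ((div_lt_one hb0).2 (hb β hβ))
        simpa using (this.neg).mono_left (inf_le_left (b := 𝓟 S))
      refine h1.congr' ?_
      filter_upwards [mem_inf_of_right (mem_principal_self S)] with i hi
      have h2 := h i hi
      rw [Finset.sum_insert hbs] at h2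
      have h3 : ∑ β ∈ s, (Q β).eval (i : ℝ) * (β / b) ^ i
          = (∑ β ∈ s, (Q β).eval (i : ℝ) * β ^ i) / b ^ i := by
        rw [Finset.sum_div]
        exact Finset.sum_congr rfl fun β _ => by rw [div_pow]; ring
      rw [h3]
      have h4 : b ^ i ≠ 0 := (pow_pos hb0 i).ne'
      field_simp
      linarith
    intro β hβ
    rcases Finset.mem_insert.1 hβ with rfl | hβ
    · exact hQb
    · refine ih (fun β hβ => hs β (Finset.mem_insert_of_mem hβ)) (fun i hi => ?_) β hβ
      have := h i hi
      rwa [Finset.sum_insert hbs, hQb, eval_zero, zero_mul, zero_add] at this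

/-- Exponential polynomials vanish if they vanish at infinitely many even and infinitely many odd
integers. -/
theorem expPoly_eq_zero {ι : Type*} (s : Finset ι) (α : ι → ℝ) (hα : Set.InjOn α s)
    (h0 : ∀ t ∈ s, α t ≠ 0) (Q : ι → ℝ[X]) {S : Set ℕ} (hSo : (S ∩ {i | Odd i}).Infinite)
    (hSe : (S ∩ {i | Even i}).Infinite)
    (h : ∀ i ∈ S, ∑ t ∈ s, (Q t).eval (i : ℝ) * α t ^ i = 0) :
    ∀ t ∈ s, Q t = 0 := by
  classical
  have hpos : ∀ β ∈ s.image fun t => |α t|, 0 < β := by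
    intro β hβ
    obtain ⟨t, ht, rfl⟩ := Finset.mem_image.1 hβ
    exact abs_pos.2 (h0 t ht)
  -- Bases `α` and `-α` share a modulus. Even integers show that their two polynomials have sum
  -- zero, odd integers that the difference is zero; together both vanish.
  have hE := expPoly_eq_zero_of_pos (s.image fun t => |α t|) hpos
    (fun β => ∑ t ∈ s with |α t| = β, Q t) hSe (by
      rintro i ⟨hi, he⟩
      rw [← h i hi, ← Finset.sum_fiberwise_of_maps_to
        (fun t ht => Finset.mem_image_of_mem (fun t => |α t|) ht)]
      refine Finset.sum_congr rfl fun β _ => ?_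
      rw [eval_finsetSum, Finset.sum_mul]
      refine Finset.sum_congr rfl fun t ht => ?_
      rw [← (Finset.mem_filter.1 ht).2, Even.pow_abs he])
  have hO := expPoly_eq_zero_of_pos (s.image fun t => |α t|) hpos
    (fun β => ∑ t ∈ s with |α t| = β, C (SignType.sign (α t) : ℝ) * Q t) hSo (by
      rintro i ⟨hi, he⟩
      rw [← h i hi, ← Finset.sum_fiberwise_of_maps_to
        (fun t ht => Finset.mem_image_of_mem (fun t => |α t|) ht)]
      refine Finset.sum_congr rfl fun β _ => ?_
      rw [eval_finsetSum, Finset.sum_mul]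
      refine Finset.sum_congr rfl fun t ht => ?_
      rw [← (Finset.mem_filter.1 ht).2, eval_mul, eval_C]
      rcases lt_or_gt_of_ne (h0 t (Finset.mem_filter.1 ht).1) with hn | hp
      · rw [sign_neg hn, abs_of_neg hn, he.neg_pow]; simp
      · rw [sign_pos hp, abs_of_pos hp]; simp)
  intro t₀ ht₀
  have h1 := hE |α t₀| (Finset.mem_image_of_mem _ ht₀)
  have h2 := hO |α t₀| (Finset.mem_image_of_mem _ ht₀)
  have h3 : ∑ t ∈ s with |α t| = |α t₀|,
      (Q t + C (SignType.sign (α t₀) : ℝ) * (C (SignType.sign (α t) : ℝ) * Q t)) = 0 := by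
    rw [Finset.sum_add_distrib, ← Finset.mul_sum, h1, h2]; simp
  rw [Finset.sum_eq_single t₀] at h3
  · have h4 : C (SignType.sign (α t₀) : ℝ) * (C (SignType.sign (α t₀) : ℝ) * Q t₀) = Q t₀ := by
      rcases lt_or_gt_of_ne (h0 t₀ ht₀) with hn | hp
      · rw [sign_neg hn]; simp
      · rw [sign_pos hp]; simp
    rw [h4, ← two_mul] at h3
    simpa using h3
  · intro t ht hne
    obtain ⟨hts, hta⟩ := Finset.mem_filter.1 ht
    rcases abs_eq_abs.1 hta with h5 | h5
    · exact absurd (hα hts ht₀ h5) hne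
    · rw [h5]
      rcases lt_or_gt_of_ne (h0 t₀ ht₀) with hn | hp
      · rw [sign_neg hn, sign_pos (neg_pos.2 hn)]; simp
      · rw [sign_pos hp, sign_neg (neg_neg_of_pos hp)]; simp
  · intro h5
    exact absurd (Finset.mem_filter.2 ⟨ht₀, rfl⟩ : t₀ ∈ s.filter fun t => |α t| = |α t₀|) h5

/-! ### Power series of neurons along a line -/

theorem coeff_eq_zero_of_hasSum {b : ℕ → ℝ}
    (h : ∀ᶠ z in 𝓝 (0 : ℝ), HasSum (fun n => b n * z ^ n) 0) (n : ℕ) : b n = 0 := by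
  have h1 : HasFPowerSeriesAt (fun _ : ℝ => (0 : ℝ)) (FormalMultilinearSeries.ofScalars ℝ b) 0 := by
    rw [hasFPowerSeriesAt_iff]
    filter_upwards [h] with z hz
    simpa [FormalMultilinearSeries.coeff_ofScalars, mul_comm] using hz
  have h2 : (FormalMultilinearSeries.ofScalars ℝ b).coeff n = 0 := by
    rw [h1.eq_zero]; rfl
  simpa [FormalMultilinearSeries.coeff_ofScalars] using h2

theorem iteratedDeriv_iteratedDeriv (f : ℝ → ℝ) (n j : ℕ) :
    iteratedDeriv n (iteratedDeriv j f) = iteratedDeriv (n + j) f := by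
  simp only [iteratedDeriv_eq_iterate, Function.iterate_add_apply]

theorem analyticOnNhd_iteratedDeriv {σ : ℝ → ℝ} (hσ : AnalyticOnNhd ℝ σ Set.univ) (j : ℕ) :
    AnalyticOnNhd ℝ (iteratedDeriv j σ) Set.univ := by
  rw [iteratedDeriv_eq_iterate]
  exact hσ.iterated_deriv j

/-- The factor `s ^ j` restores the degree lost by differentiation, so for every `j` the coefficient
of `s ^ i` carries the same factor `σ⁽ⁱ⁾(0) / i!`. For `i < j` the falling factorial is zero, which
makes the truncated `i - j` harmless. -/
theorem hasSum_pow_mul_iteratedDeriv {σ : ℝ → ℝ} (hσ : AnalyticOnNhd ℝ σ Set.univ) (j : ℕ)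
    (α : ℝ) : ∀ᶠ s in 𝓝 (0 : ℝ),
      HasSum (fun i : ℕ => iteratedDeriv i σ 0 / i.factorial * (i.descFactorial j) * α ^ (i - j)
        * s ^ i) (s ^ j * iteratedDeriv j σ (α * s)) := by
  have h1 := hasFPowerSeriesAt_iff.1
    (analyticOnNhd_iteratedDeriv hσ j 0 (Set.mem_univ _)).hasFPowerSeriesAt
  have h2 : Tendsto (fun s : ℝ => α * s) (𝓝 0) (𝓝 0) := by
    have : Continuous fun s : ℝ => α * s := by fun_prop
    simpa using this.tendsto 0
  filter_upwards [h2.eventually h1] with s hs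
  have h0 : ∑ i ∈ Finset.range j,
      iteratedDeriv i σ 0 / i.factorial * (i.descFactorial j) * α ^ (i - j) * s ^ i = 0 := by
    refine Finset.sum_eq_zero fun i hi => ?_
    rw [Nat.descFactorial_eq_zero_iff_lt.2 (Finset.mem_range.1 hi)]; simp
  have key := (hasSum_nat_add_iff (f := fun i : ℕ => iteratedDeriv i σ 0 / i.factorial *
    (i.descFactorial j) * α ^ (i - j) * s ^ i) (g := s ^ j * iteratedDeriv j σ (α * s)) j).1 ?_
  · rwa [h0, add_zero] at key
  · rw [zero_add] at hs
    convert! hs.mul_left (s ^ j) using 2 with n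
    rw [FormalMultilinearSeries.coeff_ofScalars, iteratedDeriv_iteratedDeriv]
    have h3 := Nat.factorial_mul_descFactorial (Nat.le_add_left j n)
    rw [Nat.add_sub_cancel] at h3 ⊢
    have h4 : ((n + j).factorial : ℝ) = n.factorial * (n + j).descFactorial j := by
      exact_mod_cast h3.symm
    have h5 : ((n + j).factorial : ℝ) ≠ 0 := by positivity
    have h6 : (n.factorial : ℝ) ≠ 0 := by positivity
    rw [smul_eq_mul, mul_pow, pow_add]
    field_simp
    rw [h4]; ring

theorem IsGoodActivation.zero_ne {σ : ℝ → ℝ} (h : IsGoodActivation σ) : σ 0 ≠ 0 := by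
  obtain ⟨-, c, ρ, hρ, hc, h0, -⟩ := h
  have h1 := hc 0 (by simpa using hρ)
  have h2 : HasSum (fun j => c j * (0 : ℝ) ^ j) (c 0) := by
    simpa using hasSum_single (f := fun j => c j * (0 : ℝ) ^ j) 0
      (fun j hj => by simp [hj])
  rwa [h1.unique h2]

theorem IsGoodActivation.exists_iteratedDeriv_ne {σ : ℝ → ℝ} (h : IsGoodActivation σ) (N : ℕ) :
    (∃ j, N < j ∧ Odd j ∧ iteratedDeriv j σ 0 ≠ 0) ∧
      ∃ j, N < j ∧ Even j ∧ iteratedDeriv j σ 0 ≠ 0 := by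
  obtain ⟨hσ, c, ρ, hρ, hc, -, hinf⟩ := h
  have h1 : HasFPowerSeriesAt σ (FormalMultilinearSeries.ofScalars ℝ c) 0 := by
    rw [hasFPowerSeriesAt_iff]
    filter_upwards [Metric.ball_mem_nhds (0 : ℝ) hρ] with z hz
    rw [zero_add]
    simpa [FormalMultilinearSeries.coeff_ofScalars, mul_comm] using
      hc z (by simpa using hz)
  have h2 := h1.eq_formalMultilinearSeries (hσ 0 (Set.mem_univ _)).hasFPowerSeriesAt
  have h3 : ∀ j, c j ≠ 0 → iteratedDeriv j σ 0 ≠ 0 := by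
    intro j hj h0
    have := congrArg (fun p => FormalMultilinearSeries.coeff p j) h2
    simp [FormalMultilinearSeries.coeff_ofScalars, h0] at this
    exact hj this
  obtain ⟨⟨i, hi, hio, hi0⟩, j, hj, hjo, hj0⟩ := hinf N
  exact ⟨⟨i, hi, hio, h3 i hi0⟩, j, hj, hjo, h3 j hj0⟩

/-- Comparing coefficients of `s ^ i` and cancelling `σ⁽ⁱ⁾(0) / i!` where it is nonzero leaves an
exponential polynomial in `i` with bases `α t`, which vanishes for infinitely many even and odd `i`.
A zero base contributes to the coefficient of `s ^ j` only through the `j`-th derivative, whence the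
alternative in `htj`. -/
theorem independent_on_line {σ : ℝ → ℝ} (hσ : IsGoodActivation σ) {ι : Type*} [Fintype ι]
    (α : ι → ℝ) (hα : Function.Injective α) (e : ℕ) (p : ι → ℕ → ℝ)
    (h : ∀ s : ℝ, ∑ t, ∑ j ∈ Finset.range (e + 1), p t j * (s ^ j * iteratedDeriv j σ (α t * s))
      = 0) (t : ι) (j : ℕ) (hj : j ≤ e) (htj : α t ≠ 0 ∨ iteratedDeriv j σ 0 ≠ 0) :
    p t j = 0 := by
  classical
  have hcoef : ∀ i : ℕ, iteratedDeriv i σ 0 ≠ 0 →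
      ∑ t, ∑ j ∈ Finset.range (e + 1), p t j * (i.descFactorial j * α t ^ (i - j)) = 0 := by
    have h1 : ∀ᶠ s in 𝓝 (0 : ℝ), HasSum (fun i : ℕ => (∑ t, ∑ j ∈ Finset.range (e + 1),
        p t j * (iteratedDeriv i σ 0 / i.factorial * (i.descFactorial j) * α t ^ (i - j)))
          * s ^ i) 0 := by
      have h2 : ∀ᶠ s in 𝓝 (0 : ℝ), ∀ t, ∀ j ∈ Finset.range (e + 1), HasSum (fun i : ℕ =>
          iteratedDeriv i σ 0 / i.factorial * (i.descFactorial j) * α t ^ (i - j) * s ^ i)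
          (s ^ j * iteratedDeriv j σ (α t * s)) := by
        rw [eventually_all]
        intro t
        rw [Filter.eventually_all_finset]
        exact fun j _ => hasSum_pow_mul_iteratedDeriv hσ.1 j (α t)
      filter_upwards [h2] with s hs
      have := hasSum_sum (s := Finset.univ) fun t _ => hasSum_sum (s := Finset.range (e + 1))
        fun j hj => (hs t j hj).mul_left (p t j)
      rw [h s] at this
      convert! this using 2 with i
      rw [Finset.sum_mul]
      refine Finset.sum_congr rfl fun t _ => ?_
      rw [Finset.sum_mul]
      exact Finset.sum_congr rfl fun j _ => by ring
    intro i hi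
    have h3 := coeff_eq_zero_of_hasSum h1 i
    have h4 : iteratedDeriv i σ 0 / i.factorial ≠ 0 := div_ne_zero hi (by positivity)
    have h5 : (∑ t, ∑ j ∈ Finset.range (e + 1),
        p t j * (iteratedDeriv i σ 0 / i.factorial * (i.descFactorial j) * α t ^ (i - j)))
        = iteratedDeriv i σ 0 / i.factorial *
          ∑ t, ∑ j ∈ Finset.range (e + 1), p t j * (i.descFactorial j * α t ^ (i - j)) := by
      rw [Finset.mul_sum]
      refine Finset.sum_congr rfl fun t _ => ?_
      rw [Finset.mul_sum]
      exact Finset.sum_congr rfl fun j _ => by ring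
    rw [h5] at h3
    exact (mul_eq_zero.1 h3).resolve_left h4
  -- the nonzero frequencies
  have hnz : ∀ t, α t ≠ 0 → ∀ j ≤ e, p t j = 0 := by
    -- For `i > e` and nonzero `α`, `α ^ (i - j)` is `α ^ i` times a constant, and the falling
    -- factorials make the coefficient of `α ^ i` a polynomial in `i`.
    set Q : ι → ℝ[X] := fun t => ∑ j ∈ Finset.range (e + 1),
      C (p t j * (α t ^ j)⁻¹) * descPochhammer ℝ j with hQ
    have hQeval : ∀ t (i : ℕ), (Q t).eval (i : ℝ) =
        ∑ j ∈ Finset.range (e + 1), p t j * (α t ^ j)⁻¹ * i.descFactorial j := by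
      intro t i
      simp [hQ, eval_finsetSum, descPochhammer_eval_eq_descFactorial]
    have hinf : ∀ q : ℕ → Prop, (∀ N, ∃ j, N < j ∧ q j ∧ iteratedDeriv j σ 0 ≠ 0) →
        ({i | e < i ∧ iteratedDeriv i σ 0 ≠ 0} ∩ {i | q i}).Infinite := by
      intro q hq
      rw [Set.infinite_iff_exists_gt]
      intro N
      obtain ⟨j, hj, hqj, hj0⟩ := hq (max N e)
      exact ⟨j, ⟨⟨(le_max_right _ _).trans_lt hj, hj0⟩, hqj⟩, (le_max_left _ _).trans_lt hj⟩
    have hQ0 := expPoly_eq_zero (Finset.univ.filter fun t => α t ≠ 0) α hα.injOn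
      (fun t ht => (Finset.mem_filter.1 ht).2) Q (hinf _ fun N => (hσ.exists_iteratedDeriv_ne N).1)
      (hinf _ fun N => (hσ.exists_iteratedDeriv_ne N).2) (by
        rintro i ⟨hie, hi⟩
        refine Eq.trans ?_ (hcoef i hi)
        rw [Finset.sum_filter]
        refine Finset.sum_congr rfl fun t _ => ?_
        split_ifs with ht
        · rw [hQeval, Finset.sum_mul]
          refine Finset.sum_congr rfl fun j hj => ?_
          rw [pow_sub₀ _ ht (by have := Finset.mem_range.1 hj; omega)]
          ring
        · rw [not_not] at ht
          symm
          refine Finset.sum_eq_zero fun j hj => ?_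
          rw [ht, zero_pow (by have := Finset.mem_range.1 hj; omega)]
          ring)
    -- Evaluation at `i = j` is triangular: falling factorials of larger order vanish there, and
    -- coefficients of smaller order are zero by induction.
    intro t ht j
    induction j using Nat.strong_induction_on with
    | _ j ih =>
      intro hj
      have h1 := hQeval t j
      rw [hQ0 t (by simpa using ht), eval_zero, Finset.sum_eq_single j] at h1
      · rw [Nat.descFactorial_self] at h1
        have h2 : ((j.factorial : ℕ) : ℝ) ≠ 0 := by positivity
        have h3 : (α t ^ j)⁻¹ ≠ 0 := inv_ne_zero (pow_ne_zero _ ht)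
        simpa [h2, h3, ht] using h1.symm
      · intro j' hj' hne
        rcases lt_or_gt_of_ne hne with hlt | hgt
        · rw [ih j' hlt (by omega)]; simp
        · rw [Nat.descFactorial_eq_zero_iff_lt.2 hgt]; simp
      · intro h'; exact absurd (Finset.mem_range.2 (by omega)) h'
  by_cases ht : α t = 0
  · have hj0 := htj.resolve_left (not_not.2 ht)
    have h1 := hcoef j hj0
    rw [Finset.sum_eq_single t, Finset.sum_eq_single j] at h1
    · have h2 : ((j.factorial : ℕ) : ℝ) ≠ 0 := by positivity
      simpa [Nat.descFactorial_self, h2] using h1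
    · intro j' hj' hne
      rcases lt_or_gt_of_ne hne with hlt | hgt
      · rw [ht, zero_pow (by omega)]; simp
      · rw [Nat.descFactorial_eq_zero_iff_lt.2 hgt]; simp
    · intro h'; exact absurd (Finset.mem_range.2 (by omega)) h'
    · intro t' _ hne
      refine Finset.sum_eq_zero fun j' hj' => ?_
      rw [hnz t' (fun h0 => hne (hα (h0.trans ht.symm))) j' (by
        have := Finset.mem_range.1 hj'; omega), zero_mul]
    · simp
  · exact hnz t ht j hj

/-- Neurons with distinct weights and their derivatives are linearly independent; the
coefficients are homogeneous polynomials. -/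
theorem independent_derivatives {σ : ℝ → ℝ} (hσ : IsGoodActivation σ) {d : ℕ} {ι : Type*}
    [Fintype ι] (u : ι → Input d) (hu : Function.Injective u) (e : ℕ)
    (p : ι → ℕ → MvPolynomial (Fin d) ℝ) (hp : ∀ t j, (p t j).IsHomogeneous j)
    (h : ∀ x : Input d, ∑ t, ∑ j ∈ Finset.range (e + 1),
      MvPolynomial.eval (fun i => x i) (p t j) * iteratedDeriv j σ (inner ℝ (u t) x) = 0)
    (t : ι) (j : ℕ) (hj : j ≤ e) (htj : u t ≠ 0 ∨ iteratedDeriv j σ 0 ≠ 0) : p t j = 0 := by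
  classical
  by_contra hne
  -- a direction that separates the weights
  set lin : Input d → MvPolynomial (Fin d) ℝ := fun w => ∑ i, MvPolynomial.C (w i) *
    MvPolynomial.X i with hlin
  have hlin_eval : ∀ w v : Input d, MvPolynomial.eval (fun i => v i) (lin w) = inner ℝ w v := by
    intro w v
    simp [hlin, PiLp.inner_apply, mul_comm]
  have hlin_ne : ∀ w : Input d, w ≠ 0 → lin w ≠ 0 := by
    intro w hw h0
    have := hlin_eval w w
    rw [h0, map_zero] at this
    exact hw (inner_self_eq_zero.1 this.symm)
  -- One product polynomial encodes all demands on the direction: `p t j` stays nonzero, distinct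
  -- weights keep distinct frequencies, and nonzero weights keep nonzero ones.
  obtain ⟨v, hv⟩ : ∃ v : Fin d → ℝ, MvPolynomial.eval v (p t j *
      ((∏ a : ι × ι, if u a.1 = u a.2 then 1 else lin (u a.1 - u a.2)) *
        ∏ a : ι, if u a = 0 then 1 else lin (u a))) ≠ 0 := by
    by_contra! hall
    have h0 := MvPolynomial.funext (q := 0) fun v => (hall v).trans (map_zero _).symm
    refine mul_ne_zero hne (mul_ne_zero (Finset.prod_ne_zero_iff.2 fun a _ => ?_)
      (Finset.prod_ne_zero_iff.2 fun a _ => ?_)) h0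
    · split_ifs with h1
      · exact one_ne_zero
      · exact hlin_ne _ (sub_ne_zero.2 h1)
    · split_ifs with h1
      · exact one_ne_zero
      · exact hlin_ne _ h1
  rw [map_mul, map_mul, map_prod, map_prod] at hv
  obtain ⟨hv1, hv2, hv3⟩ : _ ∧ _ ∧ _ :=
    ⟨left_ne_zero_of_mul hv, left_ne_zero_of_mul (right_ne_zero_of_mul hv),
      right_ne_zero_of_mul (right_ne_zero_of_mul hv)⟩
  rw [Finset.prod_ne_zero_iff] at hv2 hv3
  set V : Input d := WithLp.toLp 2 v with hV
  have hinj : Function.Injective fun t => inner ℝ (u t) V := by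
    intro a b hab
    by_contra hne'
    have h1 := hv2 (a, b) (Finset.mem_univ _)
    rw [if_neg (fun h => hne' (hu h))] at h1
    apply h1
    rw [show v = fun i => V i from rfl, hlin_eval, inner_sub_left, sub_eq_zero]
    exact hab
  refine hv1 (independent_on_line hσ (fun t => inner ℝ (u t) V) hinj e
    (fun t j => MvPolynomial.eval v (p t j)) (fun s => ?_) t j hj ?_)
  · rw [← h (s • V)]
    refine Finset.sum_congr rfl fun t _ => Finset.sum_congr rfl fun j _ => ?_
    rw [inner_smul_right, mul_comm s]
    have : MvPolynomial.eval (fun i => (s • V) i) (p t j) = s ^ j * MvPolynomial.eval v (p t j) := by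
      rw [MvPolynomial.eval_eq, MvPolynomial.eval_eq, Finset.mul_sum]
      refine Finset.sum_congr rfl fun m hm => ?_
      have hdeg : ∑ i ∈ m.support, m i = j := by
        have := hp t j (MvPolynomial.mem_support_iff.1 hm)
        rw [Finsupp.weight_apply, Finsupp.sum] at this
        simpa using this
      simp only [PiLp.smul_apply, smul_eq_mul, mul_pow, Finset.prod_mul_distrib,
        Finset.prod_pow_eq_pow_sum, hdeg, hV]
      ring
    rw [this]; ring
  · refine htj.imp_left fun hut h0 => ?_
    have h1 := hv3 t (Finset.mem_univ _)
    rw [if_neg hut, show v = fun i => V i from rfl, hlin_eval] at h1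
    exact h1 h0

/-- Neurons with distinct weights are linearly independent. -/
theorem linearIndependent_neurons {σ : ℝ → ℝ} (hσ : IsGoodActivation σ) {d : ℕ} :
    LinearIndependent ℝ fun (w : Input d) (x : Input d) => σ (inner ℝ w x) := by
  rw [linearIndependent_iff']
  intro s g hg w hw
  have := independent_derivatives hσ (fun t : s => (t : Input d)) Subtype.val_injective 0
    (fun t j => if j = 0 then MvPolynomial.C (g t) else 0) (fun t j => by
      split_ifs with h
      · rw [h]; exact MvPolynomial.isHomogeneous_C _ _
      · exact MvPolynomial.isHomogeneous_zero _ _ _) (fun x => by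
      have := congrFun hg x
      simp only [Finset.sum_apply, Pi.smul_apply, smul_eq_mul, Pi.zero_apply] at this
      rw [← Finset.sum_coe_sort] at this
      simpa using this) ⟨w, hw⟩ 0 le_rfl (Or.inr (by simpa using hσ.zero_ne))
  simpa using this

end Independence

/-! ## Sums of squares that are Morse–Bott -/

section SumOfSquares

open Filter Topology

variable {E F : Type*} [NormedAddCommGroup E] [InnerProductSpace ℝ E] [NormedAddCommGroup F]
  [InnerProductSpace ℝ F]

theorem fderiv_normSq_apply {G : E → F} (hG : ContDiff ℝ ∞ G) (q v : E) :
    fderiv ℝ (fun θ => ‖G θ‖ ^ 2) q v = 2 * inner ℝ (G q) (fderiv ℝ G q v) := by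
  have h := ((hG.differentiable (by simp)) q).hasFDerivAt.norm_sq
  rw [h.fderiv]
  simp

theorem hess_normSq_apply {G : E → F} (hG : ContDiff ℝ ∞ G) {q : E} (hq : G q = 0) (u v : E) :
    hess (fun θ => ‖G θ‖ ^ 2) q u v = 2 * inner ℝ (fderiv ℝ G q u) (fderiv ℝ G q v) := by
  have hR : ContDiff ℝ ∞ fun θ => ‖G θ‖ ^ 2 := hG.norm_sq ℝ
  have h1 : HasFDerivAt (fderiv ℝ fun θ => ‖G θ‖ ^ 2) (hess (fun θ => ‖G θ‖ ^ 2) q) q :=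
    ((hR.fderiv_right (m := ∞) (by simp)).differentiable (by simp) q).hasFDerivAt
  have h2 := h1.clm_apply (hasFDerivAt_const v q)
  have h3 : HasFDerivAt (fderiv ℝ G) (fderiv ℝ (fderiv ℝ G) q) q :=
    ((hG.fderiv_right (m := ∞) (by simp)).differentiable (by simp) q).hasFDerivAt
  have h4 := ((((hG.differentiable (by simp)) q).hasFDerivAt.inner ℝ
    (h3.clm_apply (hasFDerivAt_const v q)))).const_mul 2
  have h5 : (fun y => fderiv ℝ (fun θ => ‖G θ‖ ^ 2) y v) =
      fun y => 2 * inner ℝ (G y) (fderiv ℝ G y v) := funext fun y => fderiv_normSq_apply hG y v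
  rw [h5] at h2
  have h6 := congrArg (fun L : E →L[ℝ] ℝ => L u) (h2.unique h4)
  simpa [hq] using h6

/-- At a nearby critical point `G` is orthogonal to the range of its differential, which is
everything, so `G = 0`. On the zero set the Hessian degenerates only along `ker dG`, which the
implicit function theorem identifies as tangent. -/
theorem isMorseBottAt_zero_of_surjective [CompleteSpace E] {n : ℕ}
    {G : E → EuclideanSpace ℝ (Fin n)}
    (hG : ContDiff ℝ ∞ G) {p : E} (hp : G p = 0) (hs : Function.Surjective (fderiv ℝ G p)) :
    ∃ U : Set E, IsOpen U ∧ p ∈ U ∧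
      IsMorseBottAt (fun θ => ‖G θ‖ ^ 2) (U ∩ {θ | ‖G θ‖ ^ 2 = 0}) := by
  have hcd : Continuous (fderiv ℝ G) := hG.continuous_fderiv (by simp)
  obtain ⟨Rinv, hRinv⟩ := LinearMap.exists_rightInverse_of_surjective
    (fderiv ℝ G p : E →ₗ[ℝ] EuclideanSpace ℝ (Fin n)) (LinearMap.range_eq_top.2 hs)
  set Rc := LinearMap.toContinuousLinearMap Rinv with hRc
  -- A right inverse fixed at `p` turns surjectivity into an open condition: the composite with it
  -- remains a unit nearby.
  set U : Set E := {q | IsUnit ((fderiv ℝ G q).comp Rc)} with hU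
  have hUo : IsOpen U := by
    have : Continuous fun q => (fderiv ℝ G q).comp Rc := hcd.clm_comp continuous_const
    exact Units.isOpen.preimage this
  have hpU : p ∈ U := by
    have : (fderiv ℝ G p).comp Rc = 1 := by
      ext1 v
      exact LinearMap.congr_fun hRinv v
    simp [hU, this]
  have hsurj : ∀ q ∈ U, Function.Surjective (fderiv ℝ G q) := by
    intro q hq v
    obtain ⟨u, hu⟩ := (ContinuousLinearMap.isUnit_iff_bijective.1 hq).2 v
    exact ⟨Rc u, hu⟩
  have hz : ∀ q, ‖G q‖ ^ 2 = 0 ↔ G q = 0 := fun q => by simp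
  refine ⟨U, hUo, hpU, hG.norm_sq ℝ, ⟨p, hpU, by simp [hp]⟩, ⟨n, ?_⟩, ?_, ?_, U, hUo,
    Set.inter_subset_left, ?_⟩
  · rintro q ⟨hqU, hq⟩
    refine ⟨U, hUo, hqU, G, hG.contDiffOn, hsurj q hqU, ?_⟩
    ext x; simp [hz]; tauto
  · rintro q ⟨hqU, hq⟩
    ext v
    rw [fderiv_normSq_apply hG, (hz q).1 hq]; simp
  · rintro q ⟨hqU, hq⟩ u hu hess0
    have hq0 := (hz q).1 hq
    have h1 := hess0 u hu
    rw [hess_normSq_apply hG hq0, real_inner_self_eq_norm_sq] at h1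
    have h2 : fderiv ℝ G q u = 0 := by simpa using h1
    -- The implicit function along the line through `u` gives a curve of zeros with velocity `u`;
    -- being both tangent and normal, `u` is zero.
    have h3 : u ∈ tangentVectors (U ∩ {θ | ‖G θ‖ ^ 2 = 0}) q := by
      have hf : HasStrictFDerivAt G (fderiv ℝ G q) q :=
        (hG.contDiffAt).hasStrictFDerivAt (by simp)
      have hr : (fderiv ℝ G q).range = ⊤ := LinearMap.range_eq_top.2 (hsurj q hqU)
      let k : (fderiv ℝ G q).ker := ⟨u, h2⟩
      have ht : Tendsto (fun t : ℝ => t • k) (𝓝 0) (𝓝 0) := by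
        have : Continuous fun t : ℝ => t • k := by fun_prop
        simpa using this.tendsto 0
      refine ⟨fun t => hf.implicitFunction G _ hr (G q) (t • k), by simp, ?_, ?_⟩
      · have h4 := (tendsto_const_nhds (x := G q)).prodMk_nhds ht |>.eventually
          (hf.map_implicitFunction_eq hr)
        have h5 := (hf.tendsto_implicitFunction hr tendsto_const_nhds ht).eventually
          (hUo.mem_nhds hqU)
        filter_upwards [h4, h5] with t h6 h7
        exact ⟨h7, (hz _).2 (h6.trans hq0)⟩
      · have h4 := (hf.to_implicitFunction hr).hasFDerivAt
        have h5 : HasDerivAt (fun t : ℝ => t • k) k 0 := by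
          simpa using (hasDerivAt_id (0 : ℝ)).smul_const k
        have h6 := HasFDerivAt.comp_hasDerivAt (x := (0 : ℝ)) (f := fun t : ℝ => t • k)
          (l := hf.implicitFunction G _ hr (G q)) (l' := (fderiv ℝ G q).ker.subtypeL)
          (by simpa using h4) h5
        exact h6
    have h7 := (Submodule.mem_orthogonal _ _).1 hu u (Submodule.subset_span h3)
    exact inner_self_eq_zero.1 h7
  · ext q
    simp only [Set.mem_inter_iff, Set.mem_ofPred_eq, hz]
    refine and_congr_right fun hqU => ⟨fun h => ?_, fun h => ?_⟩
    · obtain ⟨v, hv⟩ := hsurj q hqU (G q)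
      have := fderiv_normSq_apply hG q v
      rw [h, hv, real_inner_self_eq_norm_sq] at this
      simpa using this.symm
    · ext v
      rw [fderiv_normSq_apply hG, h]; simp

/-- Let `v` be the displacement of `q` from its projection to the affine space. Near `p` both `G q`
and `dG_q v` are within a quarter of `A = dG_p v`, so their inner product, half the derivative of
`‖G‖²` along `v`, is positive unless `A = 0`, that is unless `v = 0`. Surjectivity of `dG` plays no
part, so there may be more samples than the codimension. -/
theorem isMorseBottAt_affine [FiniteDimensional ℝ E] {G : E → F} (hG : ContDiff ℝ ∞ G)
    (W : Submodule ℝ E) (M V : Set E) (hV : IsOpen V) {p : E} (hpV : p ∈ V)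
    (hM : ∀ q ∈ V, q ∈ M ↔ q - p ∈ W) (hG0 : ∀ q ∈ M, G q = 0)
    (hker : ∀ v ∈ Wᗮ, fderiv ℝ G p v = 0 → v = 0) :
    ∃ U : Set E, IsOpen U ∧ p ∈ U ∧ U ∩ {θ | ‖G θ‖ ^ 2 = 0} = U ∩ M ∧
      IsMorseBottAt (fun θ => ‖G θ‖ ^ 2) (U ∩ M) := by
  have hcd : Continuous (fderiv ℝ G) := hG.continuous_fderiv (by simp)
  obtain ⟨c, hc, hcle⟩ : ∃ c : ℝ, 0 < c ∧ ∀ v ∈ Wᗮ, c * ‖v‖ ≤ ‖fderiv ℝ G p v‖ := by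
    obtain ⟨K, hK, hK'⟩ := LinearMap.exists_antilipschitzWith
      ((fderiv ℝ G p : E →ₗ[ℝ] F) ∘ₗ Wᗮ.subtype) (by
        rw [LinearMap.ker_eq_bot']
        intro v hv
        exact Subtype.ext (hker v v.2 hv))
    refine ⟨(K : ℝ)⁻¹, by positivity, fun v hv => ?_⟩
    have := hK'.le_mul_dist ⟨v, hv⟩ 0
    rw [dist_zero_right, map_zero, dist_zero_right] at this
    rw [inv_mul_le_iff₀ (by positivity)]
    exact this
  have hstrict : HasStrictFDerivAt G (fderiv ℝ G p) p :=
    (hG.contDiffAt).hasStrictFDerivAt (by simp)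
  have h1 : ∀ᶠ z : E × E in 𝓝 (p, p), ‖G z.1 - G z.2 - fderiv ℝ G p (z.1 - z.2)‖
      ≤ c / 4 * ‖z.1 - z.2‖ := hstrict.isLittleO.bound (by positivity)
  have h2 : ∀ᶠ q in 𝓝 p, ‖fderiv ℝ G q - fderiv ℝ G p‖ < c / 4 := by
    have : ContinuousAt (fun q => ‖fderiv ℝ G q - fderiv ℝ G p‖) p :=
      ((hcd.sub continuous_const).norm).continuousAt
    refine this.eventually (gt_mem_nhds ?_)
    simpa using by positivity
  rw [nhds_prod_eq] at h1
  obtain ⟨T, hT, hTG⟩ := Filter.mem_prod_self_iff.1 h1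
  obtain ⟨δ, hδ, hδs⟩ := Metric.mem_nhds_iff.1 (inter_mem (inter_mem hT h2) (hV.mem_nhds hpV))
  set U := Metric.ball p δ with hU
  have hUV : U ⊆ V := fun q hq => (hδs hq).2
  -- the nearest point of the affine space
  have hproj : ∀ q ∈ U, ∃ q' ∈ U, q' ∈ M ∧ q - q' ∈ Wᗮ := by
    intro q hq
    have hq' : p + W.starProjection (q - p) ∈ U := by
      rw [hU, mem_ball_iff_norm, add_sub_cancel_left]
      refine lt_of_le_of_lt ?_ (mem_ball_iff_norm.1 hq)
      exact W.norm_starProjection_apply_le _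
    refine ⟨_, hq', (hM _ (hUV hq')).2 ?_, ?_⟩
    · rw [add_sub_cancel_left]; exact Submodule.starProjection_apply_mem _ _
    · rw [← sub_sub]; exact Submodule.sub_starProjection_mem_orthogonal _
  have hinj : ∀ q ∈ U, ∀ v ∈ Wᗮ, ‖fderiv ℝ G q v - fderiv ℝ G p v‖ ≤ ‖fderiv ℝ G p v‖ / 4 := by
    intro q hq v hv
    have h3 := (fderiv ℝ G q - fderiv ℝ G p).le_opNorm v
    have h4 : ‖fderiv ℝ G q - fderiv ℝ G p‖ < c / 4 := (hδs hq).1.2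
    have := hcle v hv
    have h5 : ‖fderiv ℝ G q - fderiv ℝ G p‖ * ‖v‖ ≤ c / 4 * ‖v‖ := by gcongr
    rw [sub_apply] at h3
    linarith
  have hcrit : ∀ q ∈ U, fderiv ℝ (fun θ => ‖G θ‖ ^ 2) q = 0 → q ∈ M := by
    intro q hq h0
    obtain ⟨q', hq', hq'M, hperp⟩ := hproj q hq
    set v := q - q' with hv
    have h3 : ‖G q - fderiv ℝ G p v‖ ≤ ‖fderiv ℝ G p v‖ / 4 := by
      have h4 : ‖G q - G q' - fderiv ℝ G p (q - q')‖ ≤ c / 4 * ‖q - q'‖ := hTG (Set.mk_mem_prod (hδs hq).1.1 (hδs hq').1.1)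
      rw [hG0 q' hq'M, sub_zero, ← hv] at h4
      have := hcle v hperp
      linarith
    have h4 := hinj q hq v hperp
    have h5 : inner ℝ (G q) (fderiv ℝ G q v) = 0 := by
      have := fderiv_normSq_apply hG q v
      rw [h0] at this
      simpa using this.symm
    set A := fderiv ℝ G p v with hA
    -- The three error terms cost at most `1/4 + 1/4 + 1/16 = 9/16` of `‖A‖²`.
    have h6 : ‖A‖ ^ 2 ≤ ‖A‖ ^ 2 * (9 / 16) := by
      have e1 : inner ℝ (G q) (fderiv ℝ G q v) = ‖A‖ ^ 2 + inner ℝ A (fderiv ℝ G q v - A)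
          + inner ℝ (G q - A) A + inner ℝ (G q - A) (fderiv ℝ G q v - A) := by
        rw [← real_inner_self_eq_norm_sq]
        simp only [inner_sub_left, inner_sub_right]; ring
      have e2 := abs_le.1 (abs_real_inner_le_norm A (fderiv ℝ G q v - A))
      have e3 := abs_le.1 (abs_real_inner_le_norm (G q - A) A)
      have e4 := abs_le.1 (abs_real_inner_le_norm (G q - A) (fderiv ℝ G q v - A))
      have f2 : ‖A‖ * ‖fderiv ℝ G q v - A‖ ≤ ‖A‖ * (‖A‖ / 4) := by gcongr
      have f3 : ‖G q - A‖ * ‖A‖ ≤ ‖A‖ / 4 * ‖A‖ := by gcongr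
      have f4 : ‖G q - A‖ * ‖fderiv ℝ G q v - A‖ ≤ ‖A‖ / 4 * (‖A‖ / 4) := by gcongr
      nlinarith [e2.1, e3.1, e4.1]
    have h7 : A = 0 := by
      have : ‖A‖ ^ 2 = 0 := by nlinarith [sq_nonneg ‖A‖]
      simpa using this
    have h8 : v = 0 := hker v hperp h7
    rw [sub_eq_zero.1 h8]; exact hq'M
  have hzcrit : ∀ q, G q = 0 → fderiv ℝ (fun θ => ‖G θ‖ ^ 2) q = 0 := by
    intro q hq
    ext v
    rw [fderiv_normSq_apply hG, hq]; simp
  have hpM : p ∈ M := (hM p hpV).2 (by simp)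
  have hpU : p ∈ U := Metric.mem_ball_self hδ
  refine ⟨U, Metric.isOpen_ball, hpU, ?_, hG.norm_sq ℝ, ⟨p, hpU, hpM⟩,
    ⟨Module.finrank ℝ Wᗮ, ?_⟩, fun q hq => hzcrit q (hG0 q hq.2), ?_, U, Metric.isOpen_ball,
    Set.inter_subset_left, ?_⟩
  · ext q
    refine and_congr_right fun hq => ⟨fun h => hcrit q hq (hzcrit q ?_), fun h => ?_⟩
    · simpa using h
    · simp [hG0 q h]
  · rintro q ⟨hqU, hqM⟩
    set L : E →L[ℝ] EuclideanSpace ℝ (Fin (Module.finrank ℝ Wᗮ)) :=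
      ((stdOrthonormalBasis ℝ Wᗮ).repr.toContinuousLinearEquiv :
        Wᗮ →L[ℝ] EuclideanSpace ℝ (Fin (Module.finrank ℝ Wᗮ))).comp
        Wᗮ.orthogonalProjectionOnto with hL
    have hLs : Function.Surjective L := by
      intro y
      refine ⟨((stdOrthonormalBasis ℝ Wᗮ).repr.symm y : Wᗮ), ?_⟩
      simp [hL]
    have hL0 : ∀ v, L v = 0 ↔ v ∈ W := by
      intro v
      simp only [hL, ContinuousLinearMap.comp_apply, ContinuousLinearEquiv.coe_coe,
        map_eq_zero_iff _ (ContinuousLinearEquiv.injective _)]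
      rw [Submodule.orthogonalProjectionOnto_eq_zero_iff, Submodule.orthogonal_orthogonal]
    have hd : ∀ q, HasFDerivAt (fun x => L (x - p)) L q := fun q =>
      L.hasFDerivAt.comp q ((hasFDerivAt_id q).sub_const p)
    refine ⟨U, Metric.isOpen_ball, hqU, fun x => L (x - p), ?_, ?_, ?_⟩
    · exact (L.contDiff.comp (contDiff_id.sub contDiff_const)).contDiffOn
    · rw [(hd q).fderiv]; exact hLs
    · ext x
      simp only [Set.mem_inter_iff, Set.mem_ofPred_eq, hL0]
      constructor
      · rintro ⟨⟨h3, h4⟩, -⟩; exact ⟨h3, (hM x (hUV h3)).1 h4⟩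
      · rintro ⟨h3, h4⟩; exact ⟨⟨h3, (hM x (hUV h3)).2 h4⟩, h3⟩
  · rintro q ⟨hqU, hqM⟩ u hu hess0
    have huW : u ∈ Wᗮ := by
      refine (Submodule.mem_orthogonal _ _).2 fun w hw =>
        (Submodule.mem_orthogonal _ _).1 hu w (Submodule.subset_span ?_)
      have hcont : ContinuousAt (fun t : ℝ => q + t • w) 0 := by fun_prop
      refine ⟨fun t => q + t • w, by simp, ?_, ?_⟩
      · have : ∀ᶠ t in 𝓝 (0 : ℝ), q + t • w ∈ U :=
          hcont.eventually (by simpa using Metric.isOpen_ball.mem_nhds hqU)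
        filter_upwards [this] with t ht
        refine ⟨ht, (hM _ (hUV ht)).2 ?_⟩
        rw [add_sub_right_comm]
        exact W.add_mem ((hM _ (hUV hqU)).1 hqM) (W.smul_mem _ hw)
      · simpa using ((hasDerivAt_id (0 : ℝ)).smul_const w).const_add q
    have h1 := hess0 u hu
    rw [hess_normSq_apply hG (hG0 q hqM), real_inner_self_eq_norm_sq] at h1
    have h2 : fderiv ℝ G q u = 0 := by simpa using h1
    have h3 := hinj q hqU u huW
    rw [h2, zero_sub, norm_neg] at h3
    refine hker u huW (norm_le_zero_iff.1 ?_)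
    linarith [norm_nonneg (fderiv ℝ G p u)]
  · ext q
    refine and_congr_right fun hq => ⟨fun h => hcrit q hq h, fun h => hzcrit q (hG0 q h)⟩

/-- A vector orthogonal to `W` is orthogonal to all tangent vectors, hence normal; killed by `dG`,
it lies in the radical of the Hessian. -/
theorem not_isMorseBottAt {G : E → F} (hG : ContDiff ℝ ∞ G) {M : Set E} {p : E} (hpM : p ∈ M)
    (hp : G p = 0) (W : Submodule ℝ E) (hW : tangentVectors M p ⊆ W) {u : E} (huW : u ∈ Wᗮ)
    (hu : u ≠ 0) (hu0 : fderiv ℝ G p u = 0) : ¬ IsMorseBottAt (fun θ => ‖G θ‖ ^ 2) M := by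
  intro h
  refine hu (h.nondegenerate p hpM u
    (Submodule.orthogonal_le (Submodule.span_le.2 hW) huW) fun v _ => ?_)
  rw [hess_normSq_apply hG hp, hu0]; simp

end SumOfSquares

/-! ## Selecting rows of a matrix -/

section Selection

open Matrix

variable {ι C : Type*} [Fintype C]

theorem rank_eq_card_col_iff (A : Matrix ι C ℝ) :
    A.rank = Fintype.card C ↔ ∀ v, A *ᵥ v = 0 → v = 0 := by
  have h := LinearMap.finrank_range_add_finrank_ker A.mulVecLin
  rw [Module.finrank_fintype_fun_eq_card] at h
  change A.rank + _ = _ at h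
  have h2 : (∀ v, A *ᵥ v = 0 → v = 0) ↔ LinearMap.ker A.mulVecLin = ⊥ :=
    (LinearMap.ker_eq_bot' (f := A.mulVecLin)).symm
  rw [h2, ← Submodule.finrank_eq_zero (R := ℝ)]
  omega

theorem rank_eq_card_iff_linearIndependent_col (A : Matrix ι C ℝ) :
    A.rank = Fintype.card C ↔ LinearIndependent ℝ A.col := by
  rw [rank_eq_card_col_iff, ← Matrix.mulVec_injective_iff]
  exact (injective_iff_map_eq_zero A.mulVecLin).symm

theorem rank_submatrix_col {C' : Type*} [Fintype C'] (A : Matrix ι C ℝ)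
    (hA : A.rank = Fintype.card C) {γ : C' → C} (hγ : Function.Injective γ) :
    (A.submatrix id γ).rank = Fintype.card C' :=
  (rank_eq_card_iff_linearIndependent_col _).2
    (((rank_eq_card_iff_linearIndependent_col A).1 hA).comp γ hγ)

variable [Fintype ι]

theorem mulVec_surjective_of_rank (A : Matrix ι C ℝ) (h : A.rank = Fintype.card ι) :
    Function.Surjective A.mulVec := by
  have : LinearMap.range A.mulVecLin = ⊤ := by
    apply Submodule.eq_top_of_finrank_eq
    rw [Module.finrank_fintype_fun_eq_card]; exact h
  exact LinearMap.range_eq_top.1 this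

/-- The prescribed rows extend to a basis of the row space. The selection is nested between them and
that basis for small `n`, and contains the basis for large `n`. -/
theorem exists_row_selection (A : Matrix ι C ℝ) (hA : A.rank = Fintype.card C) (I₁ : Finset ι)
    (hI₁ : LinearIndepOn ℝ A.row I₁) {n : ℕ} (h₁ : I₁.card ≤ n) (h₂ : n ≤ Fintype.card ι) :
    ∃ e : Fin n ↪ ι, (∀ i ∈ I₁, ∃ j, e j = i) ∧
      (A.submatrix e id).rank = min n (Fintype.card C) := by
  classical
  have hspan : Submodule.span ℝ (Set.range A.row) = ⊤ := by
    apply Submodule.eq_top_of_finrank_eq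
    rw [Module.finrank_fintype_fun_eq_card, ← hA, A.rank_eq_finrank_span_row]
  obtain ⟨b, -, hb₁, hb₂, hb₃⟩ := exists_linearIndepOn_extension hI₁ (Set.subset_univ _)
  set I₂ := b.toFinset with hI₂
  have hbI : (I₂ : Set ι) = b := by simp [hI₂]
  rw [← hbI] at hb₁ hb₂ hb₃
  have hI₂top : Submodule.span ℝ (A.row '' I₂) = ⊤ := by
    rw [eq_top_iff, ← hspan, ← Set.image_univ]
    exact Submodule.span_le.2 hb₂
  have hfr : ∀ I : Finset ι, LinearIndepOn ℝ A.row I →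
      Module.finrank ℝ (Submodule.span ℝ (A.row '' I)) = I.card := by
    intro I hI
    have := finrank_span_eq_card (LinearIndepOn.linearIndependent hI)
    rw [Set.image_eq_range]
    simpa using this
  have hcard : I₂.card = Fintype.card C := by
    rw [← hfr I₂ hb₃, hI₂top, finrank_top, Module.finrank_fintype_fun_eq_card]
  have key : ∃ I : Finset ι, I₁ ⊆ I ∧ I.card = n ∧
      Module.finrank ℝ (Submodule.span ℝ (A.row '' I)) = min n (Fintype.card C) := by
    rcases le_total n I₂.card with hn | hn
    · obtain ⟨I, h3, h4, h5⟩ := Finset.exists_subsuperset_card_eq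
        (Finset.coe_subset.1 hb₁) h₁ hn
      refine ⟨I, h3, h5, ?_⟩
      rw [hfr I (hb₃.mono (Finset.coe_subset.2 h4)), h5, ← hcard, min_eq_left hn]
    · obtain ⟨I, h3, h4, h5⟩ := Finset.exists_subsuperset_card_eq
        (Finset.subset_univ I₂) hn (by simpa using h₂)
      refine ⟨I, (Finset.coe_subset.1 hb₁).trans h3, h5, ?_⟩
      have : Submodule.span ℝ (A.row '' I) = ⊤ := by
        rw [eq_top_iff, ← hI₂top]
        exact Submodule.span_mono (Set.image_mono (Finset.coe_subset.2 h3))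
      rw [this, finrank_top, Module.finrank_fintype_fun_eq_card, ← hcard, min_eq_right hn]
  obtain ⟨I, h3, h4, h5⟩ := key
  let e : Fin n ≃ I := (Fintype.equivFinOfCardEq (by simpa using h4)).symm
  refine ⟨e.toEmbedding.trans (Function.Embedding.subtype _), fun i hi => ?_, ?_⟩
  · exact ⟨e.symm ⟨i, h3 hi⟩, by simp⟩
  · have hrange : Set.range (A.submatrix
        (e.toEmbedding.trans (Function.Embedding.subtype _)) id).row = A.row '' I := by
      ext v
      constructor
      · rintro ⟨j, rfl⟩; exact ⟨e j, (e j).2, rfl⟩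
      · rintro ⟨i, hi, rfl⟩; exact ⟨e.symm ⟨i, hi⟩, by ext; simp [row]⟩
    rw [← h5, rank_eq_finrank_span_row, hrange]

end Selection

/-! ## Separating samples -/

section Separating

open Matrix

variable {d s n N : ℕ} {σ : ℝ → ℝ}

theorem sampleMatrix_mulVec (w : Fin s → Input d) (x : Fin n → Input d) (p : Fin s → ℝ)
    (q : Fin s → Input d) (i : Fin n) :
    (sampleMatrix σ w x *ᵥ Sum.elim p fun kj => q kj.1 kj.2) i =
      ∑ k, (p k * σ (inner ℝ (w k) (x i)) +
        deriv σ (inner ℝ (w k) (x i)) * inner ℝ (q k) (x i)) := by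
  simp only [mulVec, dotProduct, Fintype.sum_sum_type, Fintype.sum_prod_type, sampleMatrix, of_apply,
    Sum.elim_inl, Sum.elim_inr, Finset.sum_add_distrib]
  congr 1
  · exact Finset.sum_congr rfl fun k _ => mul_comm _ _
  · refine Finset.sum_congr rfl fun k _ => ?_
    rw [PiLp.inner_apply (q k), Finset.mul_sum]
    refine Finset.sum_congr rfl fun j _ => ?_
    simp; ring

theorem card_columns : Fintype.card (Fin s ⊕ Fin s × Fin d) = (d + 1) * s := by
  simp; ring

/-- If no nontrivial combination of the columns vanishes, the samples may be thinned out to type-II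
separating samples. -/
theorem exists_isTypeII (w : Fin s → Input d) (hw : Function.Injective w) (x : Fin N → Input d)
    (hx : (sampleMatrix σ w x).rank = (d + 1) * s) (hsn : s ≤ n) (hnN : n ≤ N) :
    ∃ e : Fin n ↪ Fin N, IsTypeII σ w (x ∘ e) := by
  classical
  set B : Matrix (Fin N) (Fin s) ℝ := Matrix.of fun i k => σ (inner ℝ (w k) (x i)) with hB
  set A := sampleMatrix σ w x with hA
  have hAinj := (rank_eq_card_col_iff A).1 (hx.trans card_columns.symm)
  have hBrank : B.rank = s := by
    have := (rank_eq_card_col_iff B).2 fun v hv => by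
      have h1 := hAinj (Sum.elim v fun kj => (0 : Fin s → Input d) kj.1 kj.2) (by
        funext i
        rw [hA, sampleMatrix_mulVec]
        have := congrFun hv i
        simp only [mulVec, dotProduct, hB, of_apply] at this
        simpa [mul_comm] using this)
      funext k
      simpa using congrFun h1 (Sum.inl k)
    simpa using this
  -- Type I needs `s` rows independent already on the neuron columns. These are independent as full
  -- rows too, so the type-II selection can be made to contain them.
  obtain ⟨e₁, -, he₁⟩ := exists_row_selection B (by simpa using hBrank) ∅ (by simp)
    (n := s) (by simp) (by simpa using hsn.trans hnN)
  rw [Fintype.card_fin, min_self] at he₁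
  have hli : LinearIndependent ℝ (B.submatrix e₁ id).row := by
    have h2 := (B.submatrix e₁ id).rank_eq_finrank_span_row
    rw [he₁] at h2
    exact linearIndependent_of_top_le_span_of_card_eq_finrank (by
      rw [top_le_iff]
      apply Submodule.eq_top_of_finrank_eq
      rw [← h2]; simp) (by simp)
  set I₁ : Finset (Fin N) := Finset.univ.map e₁ with hI₁
  have hI₁A : LinearIndepOn ℝ A.row I₁ := by
    have h2 : LinearIndependent ℝ (A.row ∘ e₁) := by
      refine LinearIndependent.of_comp (LinearMap.funLeft ℝ ℝ (Sum.inl : Fin s → _)) ?_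
      exact hli
    have h3 : (I₁ : Set (Fin N)) = Set.range e₁ := by simp [hI₁]
    rw [h3, LinearIndepOn]
    exact (linearIndepOn_range_iff e₁.injective _).2 h2
  obtain ⟨e, he, herank⟩ := exists_row_selection A (hx.trans card_columns.symm) I₁ hI₁A (n := n)
    (by simpa [hI₁] using hsn) (by simpa using hnN)
  refine ⟨e, ⟨hw, ?_⟩, ?_⟩
  · choose f hf using fun k => he (e₁ k) (by simp [hI₁])
    refine ⟨f, ?_⟩
    refine Eq.trans (congrArg Matrix.rank ?_) he₁
    ext j k
    simp [hB, hf]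
  · rw [← card_columns, ← herank]; rfl

/-- A full set of type-II separating samples also determines the coefficients of a subfamily. -/
theorem sampleMatrix_rank_comp (w : Fin s → Input d) (x : Fin n → Input d)
    (hx : (sampleMatrix σ w x).rank = (d + 1) * s) {s' : ℕ} (g : Fin s' ↪ Fin s) :
    (sampleMatrix σ (w ∘ g) x).rank = (d + 1) * s' := by
  have h := rank_submatrix_col _ (hx.trans card_columns.symm)
    (γ := Sum.map g (Prod.map g (id : Fin d → Fin d)))
    (g.injective.sumMap (g.injective.prodMap Function.injective_id))
  rw [card_columns] at h
  rw [← h]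
  congr 1
  ext i (k | k) <;> rfl

theorem injective_of_rank (w : Fin s → Input d) (x : Fin n → Input d)
    (hx : (sampleMatrix σ w x).rank = n) : Function.Injective x := by
  intro i j hij
  by_contra hne
  obtain ⟨v, hv⟩ := mulVec_surjective_of_rank _ (hx.trans (Fintype.card_fin n).symm)
    (Pi.single i 1)
  have h1 : (sampleMatrix σ w x *ᵥ v) i = (sampleMatrix σ w x *ᵥ v) j := by
    simp only [mulVec, dotProduct, sampleMatrix, of_apply, hij]
  simp [hv, Ne.symm hne] at h1

end Separating

/-! ## The model as a function of its parameters -/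

section Model

variable {d m n : ℕ}

/-- The parameter with given outer and inner weights. -/
def mkParam (a : Fin m → ℝ) (w : Fin m → Input d) : Param d m :=
  WithLp.toLp 2 fun c => Fin.cases (a c.1) (fun j => w c.1 j) c.2

@[simp] theorem outer_mkParam (a : Fin m → ℝ) (w : Fin m → Input d) (k : Fin m) :
    outer (mkParam a w) k = a k := rfl

@[simp] theorem weight_mkParam (a : Fin m → ℝ) (w : Fin m → Input d) (k : Fin m) :
    weight (mkParam a w) k = w k := rfl

/-- The outer weight as a continuous linear map. -/
noncomputable def outerL (d : ℕ) {m : ℕ} (k : Fin m) : Param d m →L[ℝ] ℝ :=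
  EuclideanSpace.proj (k, 0)

/-- The inner weight as a continuous linear map. -/
noncomputable def weightL (d : ℕ) {m : ℕ} (k : Fin m) : Param d m →L[ℝ] Input d :=
  LinearMap.toContinuousLinearMap
    { toFun := fun θ => weight θ k
      map_add' := fun _ _ => rfl
      map_smul' := fun _ _ => rfl }

@[simp] theorem outerL_apply (k : Fin m) (θ : Param d m) : outerL d k θ = outer θ k := rfl

@[simp] theorem weightL_apply (k : Fin m) (θ : Param d m) : weightL d k θ = weight θ k := rfl

@[simp] theorem outer_add (θ θ' : Param d m) (k : Fin m) :
    outer (θ + θ') k = outer θ k + outer θ' k := rfl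

@[simp] theorem outer_sub (θ θ' : Param d m) (k : Fin m) :
    outer (θ - θ') k = outer θ k - outer θ' k := rfl

@[simp] theorem weight_sub (θ θ' : Param d m) (k : Fin m) :
    weight (θ - θ') k = weight θ k - weight θ' k := rfl

@[simp] theorem weight_add (θ θ' : Param d m) (k : Fin m) :
    weight (θ + θ') k = weight θ k + weight θ' k := rfl

@[simp] theorem outer_smul (c : ℝ) (θ : Param d m) (k : Fin m) :
    outer (c • θ) k = c * outer θ k := rfl

@[simp] theorem weight_smul (c : ℝ) (θ : Param d m) (k : Fin m) :
    weight (c • θ) k = c • weight θ k := rfl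

/-- The vector of residuals. -/
noncomputable def residual (m : ℕ) (σ : ℝ → ℝ) (f : Input d → ℝ) (x : Fin n → Input d)
    (θ : Param d m) : EuclideanSpace ℝ (Fin n) :=
  WithLp.toLp 2 fun i => model σ θ (x i) - f (x i)

theorem loss_eq (σ : ℝ → ℝ) (f : Input d → ℝ) (x : Fin n → Input d) :
    loss m σ f x = fun θ => ‖residual m σ f x θ‖ ^ 2 := by
  funext θ
  rw [EuclideanSpace.norm_sq_eq]
  rfl

theorem lossZero_eq (σ : ℝ → ℝ) (f : Input d → ℝ) (x : Fin n → Input d) :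
    lossZero m σ f x = {θ | ‖residual m σ f x θ‖ ^ 2 = 0} := by
  rw [lossZero, loss_eq]

theorem mem_lossZero {σ : ℝ → ℝ} {f : Input d → ℝ} {x : Fin n → Input d} {θ : Param d m} :
    θ ∈ lossZero m σ f x ↔ ∀ i, model σ θ (x i) = f (x i) := by
  rw [lossZero_eq]
  simp only [Set.mem_ofPred_eq, ne_eq, OfNat.ofNat_ne_zero, not_false_eq_true, pow_eq_zero_iff,
    norm_eq_zero]
  constructor
  · intro h i
    have : residual m σ f x θ i = 0 := by rw [h]; rfl
    exact sub_eq_zero.1 this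
  · intro h
    ext i
    exact sub_eq_zero.2 (h i)

theorem residual_eq_zero {σ : ℝ → ℝ} {f : Input d → ℝ} (x : Fin n → Input d) {θ : Param d m}
    (h : θ ∈ Qstar m σ f) : residual m σ f x θ = 0 := by
  ext i
  exact sub_eq_zero.2 (h (x i))

theorem Qstar_subset_lossZero {σ : ℝ → ℝ} {f : Input d → ℝ} (x : Fin n → Input d) :
    Qstar m σ f ⊆ lossZero m σ f x := fun _ h => mem_lossZero.2 fun i => h (x i)

theorem contDiff_residual {σ : ℝ → ℝ} (hσ : AnalyticOnNhd ℝ σ Set.univ) (f : Input d → ℝ)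
    (x : Fin n → Input d) : ContDiff ℝ ∞ (residual m σ f x) := by
  have hσ' : ContDiff ℝ ∞ σ := contDiff_iff_contDiffAt.2 fun t => (hσ t trivial).contDiffAt
  rw [contDiff_euclidean]
  intro i
  change ContDiff ℝ ∞ fun θ : Param d m =>
    (∑ k, outerL d k θ * σ (inner ℝ (weightL d k θ) (x i))) - f (x i)
  refine ContDiff.sub (ContDiff.sum fun k _ => ContDiff.mul (outerL d k).contDiff ?_)
    contDiff_const
  exact hσ'.comp (((weightL d k).contDiff).inner ℝ contDiff_const)

theorem fderiv_residual {σ : ℝ → ℝ} (hσ : AnalyticOnNhd ℝ σ Set.univ) (f : Input d → ℝ)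
    (x : Fin n → Input d) (θ v : Param d m) (i : Fin n) :
    fderiv ℝ (residual m σ f x) θ v i = ∑ k, (outer v k * σ (inner ℝ (weight θ k) (x i)) +
      outer θ k * deriv σ (inner ℝ (weight θ k) (x i)) * inner ℝ (weight v k) (x i)) := by
  have h1 : HasFDerivAt (residual m σ f x) (fderiv ℝ (residual m σ f x) θ) θ :=
    ((contDiff_residual hσ f x).differentiable (by simp) θ).hasFDerivAt
  have h2 : HasFDerivAt (fun θ => residual m σ f x θ i)
      ((EuclideanSpace.proj i).comp (fderiv ℝ (residual m σ f x) θ)) θ :=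
    (EuclideanSpace.proj (𝕜 := ℝ) i).hasFDerivAt.comp θ h1
  have h3 : ∀ k, HasFDerivAt (fun θ : Param d m => outer θ k * σ (inner ℝ (weight θ k) (x i)))
      _ θ := fun k => by
    have e1 : HasFDerivAt (fun θ : Param d m => inner ℝ (weight θ k) (x i)) _ θ :=
      (weightL d k).hasFDerivAt.inner ℝ (hasFDerivAt_const (x i) θ)
    have e2 : HasDerivAt σ (deriv σ (inner ℝ (weight θ k) (x i))) (inner ℝ (weight θ k) (x i)) :=
      (hσ _ trivial).differentiableAt.hasDerivAt
    have e3 := e2.hasFDerivAt.comp θ e1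
    exact (outerL d k).hasFDerivAt.mul e3
  have h4 := (HasFDerivAt.fun_sum (u := Finset.univ) fun k _ => h3 k).sub_const (f (x i))
  have h5 := congrArg (fun L : Param d m →L[ℝ] ℝ => L v) (h2.unique h4)
  simp only [ContinuousLinearMap.comp_apply] at h5
  refine Eq.trans h5 ?_
  rw [sum_apply]
  refine Finset.sum_congr rfl fun k _ => ?_
  simp
  ring

end Model

/-! ## Blocks of neurons -/

/-- A map to blocks, with a distinguished element of each block. -/
structure BlockMap (m r : ℕ) where
  blk : Fin m → Fin r
  fst : Fin r → Fin m
  blk_fst : ∀ t, blk (fst t) = t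

section Blocks

variable {d m r m₀ n : ℕ}

/-- The block is a singleton beyond the first `m₀` blocks. -/
def BlockMap.Deficient (B : BlockMap m r) (m₀ : ℕ) (t : Fin r) : Prop :=
  m₀ ≤ (t : ℕ) ∧ ∀ k, B.blk k = t → k = B.fst t

/-- The weight of the neuron is the free weight of its block. -/
def BlockMap.Base (B : BlockMap m r) (m₀ : ℕ) (k : Fin m) : Prop :=
  m₀ ≤ (B.blk k : ℕ) ∧ k = B.fst (B.blk k)

open Classical in
theorem Partition.exists_blockMap (P : Partition m r) :
    ∃ B : BlockMap m r, (∀ t k, P.InBlock t k ↔ B.blk k = t) ∧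
      ∀ m₀, P.deficient m₀ = (Finset.univ.filter fun t => B.Deficient m₀ t).card := by
  have hex : ∀ k : Fin m, ∃ t, P.InBlock t k := by
    intro k
    set T : Finset (Fin (r + 1)) := Finset.univ.filter fun t => P.q t ≤ k with hT
    have hTne : T.Nonempty := ⟨0, by simp [hT, P.zero]⟩
    have hmem := T.max'_mem hTne
    have hlt : T.max' hTne ≠ Fin.last r := by
      intro h
      rw [h] at hmem
      have := (Finset.mem_filter.1 hmem).2
      rw [P.last] at this
      omega
    obtain ⟨t, ht⟩ := Fin.exists_castSucc_eq.2 hlt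
    refine ⟨t, ?_, ?_⟩
    · rw [ht]; exact (Finset.mem_filter.1 hmem).2
    · by_contra! hcon
      have h1 := T.le_max' t.succ (Finset.mem_filter.2 ⟨Finset.mem_univ _, hcon⟩)
      rw [← ht] at h1
      exact absurd h1 (not_le.2 (Fin.castSucc_lt_succ))
  have huniq : ∀ (t s : Fin r) (k : Fin m), P.InBlock t k → P.InBlock s k → t ≤ s := by
    intro t s k ht hs
    by_contra! hlt
    have h1 : P.q s.succ ≤ P.q t.castSucc := P.strictMono.monotone (by
      rw [Fin.le_def]; simp; omega)
    have h2 := hs.2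
    have h3 := ht.1
    omega
  choose blk hblk using hex
  have hiff : ∀ t k, P.InBlock t k ↔ blk k = t := fun t k =>
    ⟨fun h => le_antisymm (huniq _ _ k (hblk k) h) (huniq _ _ k h (hblk k)), fun h => h ▸ hblk k⟩
  have hq : ∀ t : Fin r, P.q t.castSucc < P.q t.succ := fun t =>
    P.strictMono Fin.castSucc_lt_succ
  have hqm : ∀ t : Fin r, P.q t.succ ≤ m := fun t => by
    exact (P.strictMono.monotone (Fin.le_last _)).trans P.last.le
  refine ⟨⟨blk, fun t => ⟨P.q t.castSucc, (hq t).trans_le (hqm t)⟩, fun t =>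
    (hiff t _).1 ⟨le_rfl, hq t⟩⟩, hiff, fun m₀ => ?_⟩
  rw [Partition.deficient]
  refine congrArg Finset.card (Finset.filter_congr fun t _ => ?_)
  refine and_congr_right fun _ => ⟨fun h k hk => ?_, fun h => ?_⟩
  · have := (hiff t k).2 hk
    apply Fin.ext
    have h1 := this.1
    have h2 := this.2
    change (k : ℕ) = P.q t.castSucc
    omega
  · by_contra hne
    have h1 := hq t
    have h2 := hqm t
    have h3 := h ⟨P.q t.castSucc + 1, by omega⟩ ((hiff t _).1 ⟨by simp, by simp; omega⟩)
    simpa using congrArg Fin.val h3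

/-- The sum of the outer weights over a block that represents the target. -/
def blockSum (abar : Fin m₀ → ℝ) (r : ℕ) (t : Fin r) : ℝ :=
  if h : (t : ℕ) < m₀ then abar ⟨t, h⟩ else 0

theorem sum_blocks (B : BlockMap m r) (g : Fin m → ℝ) (h : Fin r → ℝ) :
    ∑ k, g k * h (B.blk k) = ∑ t, (∑ k with B.blk k = t, g k) * h t := by
  classical
  rw [← Finset.sum_fiberwise (s := Finset.univ) (g := B.blk)]
  refine Finset.sum_congr rfl fun t _ => ?_
  rw [Finset.sum_mul]
  exact Finset.sum_congr rfl fun k hk => by rw [(Finset.mem_filter.1 hk).2]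

theorem network_eq_sum (hr : m₀ ≤ r) (σ : ℝ → ℝ) (abar : Fin m₀ → ℝ) (wb : Fin m₀ → Input d)
    (u : Fin r → Input d) (hu : ∀ (t : Fin r) (s : Fin m₀), (t : ℕ) = s → u t = wb s)
    (x : Input d) :
    network σ abar wb x = ∑ t, blockSum abar r t * σ (inner ℝ (u t) x) := by
  rw [network]
  refine Finset.sum_of_injOn (Fin.castLE hr) (Fin.castLE_injective hr).injOn (by simp)
    (fun t _ ht => ?_) fun s _ => ?_
  · have : ¬ (t : ℕ) < m₀ := fun h => ht ⟨⟨t, h⟩, by simp, rfl⟩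
    simp [blockSum, this]
  · rw [hu (Fin.castLE hr s) s rfl]
    simp [blockSum]

/-- Independence of neurons with distinct weights turns equality with the target into equality of
block sums. Apart from the open injectivity condition, the description is by affine equations, so
the branch is open in an affine space. -/
theorem mem_branch_iff {σ : ℝ → ℝ} (hσ : IsGoodActivation σ) (hr : m₀ ≤ r) (abar : Fin m₀ → ℝ)
    (wb : Fin m₀ → Input d) (P : Partition m r) (B : BlockMap m r)
    (hB : ∀ t k, P.InBlock t k ↔ B.blk k = t) (θ : Param d m) :
    θ ∈ branch σ (network σ abar wb) wb P ↔
      Function.Injective (fun t => weight θ (B.fst t)) ∧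
      (∀ k, weight θ k = weight θ (B.fst (B.blk k))) ∧
      (∀ (t : Fin r) (s : Fin m₀), (t : ℕ) = s → weight θ (B.fst t) = wb s) ∧
      ∀ t, ∑ k with B.blk k = t, outer θ k = blockSum abar r t := by
  have hmodel : ∀ u : Fin r → Input d, (∀ k, weight θ k = u (B.blk k)) → ∀ x,
      model σ θ x = ∑ t, (∑ k with B.blk k = t, outer θ k) * σ (inner ℝ (u t) x) := by
    intro u hu x
    rw [← sum_blocks B _ fun t => σ (inner ℝ (u t) x)]
    rw [model, network]
    exact Finset.sum_congr rfl fun k _ => by rw [hu k]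
  constructor
  · rintro ⟨hQ, u, hui, huw, hut⟩
    have hu : ∀ k, weight θ k = u (B.blk k) := fun k => huw _ k ((hB _ _).2 rfl)
    have hfst : ∀ t, weight θ (B.fst t) = u t := fun t => by rw [hu, B.blk_fst]
    refine ⟨by simpa only [hfst] using hui, fun k => by rw [hu, hfst], fun t s h => by
      rw [hfst, hut t s h], ?_⟩
    have hli := (linearIndependent_neurons hσ (d := d)).comp u hui
    rw [Fintype.linearIndependent_iff] at hli
    intro t
    refine sub_eq_zero.1 (hli (fun t => (∑ k with B.blk k = t, outer θ k) - blockSum abar r t)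
      ?_ t)
    funext x
    have h1 := hQ x
    rw [hmodel u hu, network_eq_sum hr σ abar wb u hut, ← sub_eq_zero, ← Finset.sum_sub_distrib]
      at h1
    simp only [Finset.sum_apply, Pi.smul_apply, smul_eq_mul, Function.comp_apply, sub_mul]
    exact h1
  · rintro ⟨hi, hw, hwb, hs⟩
    refine ⟨fun x => ?_, fun t => weight θ (B.fst t), hi, fun t k h => ?_, hwb⟩
    · rw [hmodel (fun t => weight θ (B.fst t)) hw, network_eq_sum hr σ abar wb _ hwb]
      simp only [hs]
    · rw [← (hB _ _).1 h]; exact hw k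

/-! ### The tangent space of a branch -/

/-- The deviation of a parameter from the direction of a branch. -/
noncomputable def deviation (d : ℕ) (B : BlockMap m r) (m₀ : ℕ) :
    Param d m →ₗ[ℝ] (Fin r → ℝ) × ({k // ¬ B.Base m₀ k} → Input d) where
  toFun v := (fun t => ∑ k with B.blk k = t, outer v k,
    fun k => weight v k - if (B.blk k : ℕ) < m₀ then 0 else weight v (B.fst (B.blk k)))
  map_add' v v' := by
    refine Prod.ext (funext fun t => ?_) (funext fun k => ?_)
    · simp [Finset.sum_add_distrib]
    · simp only [weight_add, Prod.snd_add, Pi.add_apply]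
      split_ifs <;> abel
  map_smul' c v := by
    refine Prod.ext (funext fun t => ?_) (funext fun k => ?_)
    · simp [Finset.mul_sum]
    · simp only [weight_smul, Prod.smul_snd, Pi.smul_apply, RingHom.id_apply, smul_sub]
      split_ifs <;> simp

/-- The direction of a branch. -/
noncomputable def branchDir (d : ℕ) (B : BlockMap m r) (m₀ : ℕ) : Submodule ℝ (Param d m) :=
  LinearMap.ker (deviation d B m₀)

theorem mem_branchDir {B : BlockMap m r} {v : Param d m} :
    v ∈ branchDir d B m₀ ↔ (∀ t, ∑ k with B.blk k = t, outer v k = 0) ∧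
      ∀ k, weight v k = if (B.blk k : ℕ) < m₀ then 0 else weight v (B.fst (B.blk k)) := by
  rw [branchDir, LinearMap.mem_ker, Prod.ext_iff, funext_iff, funext_iff]
  refine and_congr Iff.rfl ⟨fun h k => ?_, fun h k => sub_eq_zero.2 (h k)⟩
  by_cases hk : B.Base m₀ k
  · rw [if_neg (not_lt.2 hk.1), ← hk.2]
  · exact sub_eq_zero.1 (h ⟨k, hk⟩)

theorem deviation_surjective (B : BlockMap m r) (m₀ : ℕ) :
    Function.Surjective (deviation d B m₀) := by
  classical
  rintro ⟨p, η⟩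
  refine ⟨mkParam (fun k => if k = B.fst (B.blk k) then p (B.blk k) else 0)
    (fun k => if h : ¬ B.Base m₀ k then η ⟨k, h⟩ else 0), ?_⟩
  refine Prod.ext (funext fun t => ?_) (funext fun k => ?_)
  · change ∑ k with B.blk k = t, (if k = B.fst (B.blk k) then p (B.blk k) else 0) = p t
    rw [Finset.sum_eq_single (B.fst t)]
    · simp [B.blk_fst]
    · intro k hk hne
      rw [if_neg]
      rw [(Finset.mem_filter.1 hk).2]; exact hne
    · intro h; simp [B.blk_fst] at h
  · change (if h : ¬ B.Base m₀ (k : Fin m) then η ⟨k, h⟩ else 0) -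
      (if (B.blk k : ℕ) < m₀ then 0 else
        if h : ¬ B.Base m₀ (B.fst (B.blk k)) then η ⟨_, h⟩ else 0) = η k
    rw [dif_pos k.2]
    split_ifs with h1 h2
    · simp
    · simp
    · exact absurd h2 (not_not.2 ⟨by rw [B.blk_fst]; exact not_lt.1 h1, by rw [B.blk_fst]⟩)

-- Base neurons, whose weights are the free ones on the branch, correspond to the `r - m₀` blocks
-- beyond the target blocks.
open Classical in
theorem card_not_base (B : BlockMap m r) (hr : m₀ ≤ r) :
    Fintype.card {k // ¬ B.Base m₀ k} + r = m + m₀ := by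
  have h1 : Fintype.card {k // B.Base m₀ k} = Fintype.card {t : Fin r // m₀ ≤ (t : ℕ)} :=
    Fintype.card_congr
      { toFun := fun k => ⟨B.blk k, k.2.1⟩
        invFun := fun t => ⟨B.fst t, by rw [BlockMap.Base, B.blk_fst]; exact ⟨t.2, rfl⟩⟩
        left_inv := fun k => Subtype.ext k.2.2.symm
        right_inv := fun t => Subtype.ext (B.blk_fst _) }
  have h2 : Fintype.card {t : Fin r // m₀ ≤ (t : ℕ)} + m₀ = r := by
    have h3 := Fintype.card_subtype_compl (fun t : Fin r => (t : ℕ) < m₀)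
    have h4 : Fintype.card {t : Fin r // (t : ℕ) < m₀} = m₀ := by
      rw [Fintype.card_congr (α := {t : Fin r // (t : ℕ) < m₀}) (β := Fin m₀)
        { toFun := fun t => ⟨t.1, t.2⟩
          invFun := fun s => ⟨Fin.castLE hr s, s.2⟩
          left_inv := fun t => rfl
          right_inv := fun s => rfl }]
      simp
    simp only [not_lt, Fintype.card_fin, h4] at h3
    omega
  have h3 := Fintype.card_subtype_compl (fun k : Fin m => B.Base m₀ k)
  have h4 := Fintype.card_subtype_le (fun k : Fin m => B.Base m₀ k)
  simp only [Fintype.card_fin] at h3 h4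
  omega

theorem finrank_param : Module.finrank ℝ (Param d m) = m * (d + 1) := by simp

/-- The codimension counts one equation per block sum and `d` per neuron whose weight is tied to a
target weight or to the base neuron of its block. -/
theorem finrank_branchDir (B : BlockMap m r) (hr : m₀ ≤ r) :
    Module.finrank ℝ (branchDir d B m₀) + (r + (m + m₀ - r) * d) = m * (d + 1) := by
  classical
  have h1 := LinearMap.finrank_range_add_finrank_ker (deviation d B m₀)
  rw [LinearMap.range_eq_top.2 (deviation_surjective B m₀), finrank_top, Module.finrank_prod,
    Module.finrank_pi, Module.finrank_pi_fintype, finrank_param] at h1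
  simp only [finrank_euclideanSpace, Fintype.card_fin, Finset.sum_const, Finset.card_univ,
    smul_eq_mul] at h1
  have h2 := card_not_base B hr
  have h3 : m + m₀ - r = Fintype.card {k // ¬ B.Base m₀ k} := by omega
  rw [h3, branchDir]
  omega

/-! ### The differential on a branch -/

/-- The linear map through which the differential of the residual factors on a branch. -/
noncomputable def blockDiff (B : BlockMap m r) (m₀ : ℕ) (θ : Param d m) :
    Param d m →ₗ[ℝ] (Fin r → ℝ) × ({t // ¬ B.Deficient m₀ t} → Input d) where
  toFun v := (fun t => ∑ k with B.blk k = t, outer v k,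
    fun t => ∑ k with B.blk k = t, outer θ k • weight v k)
  map_add' v v' := by
    refine Prod.ext (funext fun t => ?_) (funext fun t => ?_)
    · simp [Finset.sum_add_distrib]
    · simp [Finset.sum_add_distrib]
  map_smul' c v := by
    refine Prod.ext (funext fun t => ?_) (funext fun t => ?_)
    · simp [Finset.mul_sum]
    · simp [Finset.smul_sum, smul_comm c]

open Classical in
theorem finrank_ker_blockDiff (B : BlockMap m r) (m₀ : ℕ) (θ : Param d m) :
    m * (d + 1) ≤ Module.finrank ℝ (LinearMap.ker (blockDiff B m₀ θ)) +
      (r + Fintype.card {t // ¬ B.Deficient m₀ t} * d) := by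
  have h1 := LinearMap.finrank_range_add_finrank_ker (blockDiff B m₀ θ)
  have h2 := Submodule.finrank_le (LinearMap.range (blockDiff B m₀ θ))
  rw [Module.finrank_prod, Module.finrank_pi, Module.finrank_pi_fintype] at h2
  rw [finrank_param] at h1
  simp only [finrank_euclideanSpace, Fintype.card_fin, Finset.sum_const, Finset.card_univ,
    smul_eq_mul] at h2
  omega

theorem blockDiff_surjective (B : BlockMap m r) (m₀ : ℕ) (θ : Param d m)
    (hθ : ∀ t, ¬ B.Deficient m₀ t → ∃ k, B.blk k = t ∧ outer θ k ≠ 0) :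
    Function.Surjective (blockDiff B m₀ θ) := by
  classical
  rintro ⟨p, q⟩
  choose κ hκ hκ0 using hθ
  refine ⟨mkParam (fun k => if k = B.fst (B.blk k) then p (B.blk k) else 0)
    (fun k => if h : ¬ B.Deficient m₀ (B.blk k) then
      if k = κ (B.blk k) h then (outer θ k)⁻¹ • q ⟨B.blk k, h⟩ else 0 else 0), ?_⟩
  refine Prod.ext (funext fun t => ?_) (funext fun t => ?_)
  · change ∑ k with B.blk k = t, (if k = B.fst (B.blk k) then p (B.blk k) else 0) = p t
    rw [Finset.sum_eq_single (B.fst t)]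
    · simp [B.blk_fst]
    · intro k hk hne
      rw [if_neg]
      rw [(Finset.mem_filter.1 hk).2]; exact hne
    · intro h; simp [B.blk_fst] at h
  · change ∑ k with B.blk k = t, outer θ k • (if h : ¬ B.Deficient m₀ (B.blk k) then
      if k = κ (B.blk k) h then (outer θ k)⁻¹ • q ⟨B.blk k, h⟩ else 0 else 0) = q t
    obtain ⟨t, ht⟩ := t
    simp only
    rw [Finset.sum_eq_single (κ t ht)]
    · have h1 := hκ t ht
      have h2 : ¬ B.Deficient m₀ (B.blk (κ t ht)) := by rwa [h1]
      rw [dif_pos h2, if_pos (by simp only [h1]), smul_inv_smul₀ (hκ0 t ht)]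
      congr 1
      exact Subtype.ext h1
    · intro k hk hne
      have h1 := (Finset.mem_filter.1 hk).2
      rw [dif_pos (by rwa [h1]), if_neg (by simpa only [h1] using hne), smul_zero]
    · intro h
      exact absurd (hκ t ht) (by simpa using h)

theorem fderiv_residual_blocks {σ : ℝ → ℝ} (hσ : AnalyticOnNhd ℝ σ Set.univ) (f : Input d → ℝ)
    (x : Fin n → Input d) (B : BlockMap m r) (θ : Param d m)
    (hθ : ∀ k, weight θ k = weight θ (B.fst (B.blk k))) (v : Param d m) (i : Fin n) :
    fderiv ℝ (residual m σ f x) θ v i =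
      ∑ t, ((∑ k with B.blk k = t, outer v k) * σ (inner ℝ (weight θ (B.fst t)) (x i)) +
        deriv σ (inner ℝ (weight θ (B.fst t)) (x i)) *
          inner ℝ (∑ k with B.blk k = t, outer θ k • weight v k) (x i)) := by
  classical
  rw [fderiv_residual hσ, ← Finset.sum_fiberwise (s := Finset.univ) (g := B.blk)]
  refine Finset.sum_congr rfl fun t _ => ?_
  rw [Finset.sum_mul, sum_inner, Finset.mul_sum, ← Finset.sum_add_distrib]
  refine Finset.sum_congr rfl fun k hk => ?_
  rw [hθ k, (Finset.mem_filter.1 hk).2, real_inner_smul_left]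
  ring

end Blocks

/-! ## Surjectivity of the differential -/

section Surjective

open Matrix

variable {d m r m₀ n s : ℕ} {σ : ℝ → ℝ}

/-- The range of the differential of the residual contains the columns of the sample matrix of
the weights of active neurons. -/
theorem mulVec_mem_range_fderiv (hσ : AnalyticOnNhd ℝ σ Set.univ) (f : Input d → ℝ)
    (x : Fin n → Input d) {θ : Param d m} {w : Fin s → Input d} {κ : Fin s → Fin m}
    (hκi : Function.Injective κ) (hκ : ∀ t, weight θ (κ t) = w t) (hκ0 : ∀ t, outer θ (κ t) ≠ 0)
    (v : Fin s ⊕ Fin s × Fin d → ℝ) :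
    ∃ u, ∀ i, fderiv ℝ (residual m σ f x) θ u i = (sampleMatrix σ w x *ᵥ v) i := by
  set q : Fin s → Input d := fun k => WithLp.toLp 2 fun j => v (Sum.inr (k, j)) with hq
  have hv : v = Sum.elim (fun k => v (Sum.inl k)) fun kj : Fin s × Fin d => q kj.1 kj.2 := by
    ext (k | k) <;> rfl
  -- Dividing by the outer weight undoes the factor with which the variation of an inner weight
  -- enters the differential.
  refine ⟨mkParam (Function.extend κ (fun k => v (Sum.inl k)) 0)
    (Function.extend κ (fun k => (outer θ (κ k))⁻¹ • q k) 0), fun i => ?_⟩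
  rw [fderiv_residual hσ, hv, sampleMatrix_mulVec]
  symm
  refine Finset.sum_of_injOn κ hκi.injOn (by simp) (fun k _ hk => ?_) fun k _ => ?_
  · have : ¬ ∃ a, κ a = k := by simpa using hk
    rw [outer_mkParam, weight_mkParam, Function.extend_apply' _ _ _ this,
      Function.extend_apply' _ _ _ this]
    simp
  · rw [outer_mkParam, weight_mkParam, hκi.extend_apply, hκi.extend_apply, hκ,
      real_inner_smul_left]
    have := hκ0 k
    field_simp
    simp [mul_comm]

theorem neuron_mem_range_fderiv (hσ : AnalyticOnNhd ℝ σ Set.univ) (f : Input d → ℝ)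
    (x : Fin n → Input d) (θ : Param d m) (k : Fin m) :
    ∃ u, ∀ i, fderiv ℝ (residual m σ f x) θ u i = σ (inner ℝ (weight θ k) (x i)) := by
  classical
  refine ⟨mkParam (Pi.single k 1) 0, fun i => ?_⟩
  rw [fderiv_residual hσ, Finset.sum_eq_single k]
  · simp
  · intro b _ hb; simp [hb]
  · simp

/-- An exact representation of the target contains each of its weights in an active neuron. -/
theorem exists_active (hσ : IsGoodActivation σ) (abar : Fin m₀ → ℝ) (habar : ∀ k, abar k ≠ 0)
    (wb : Fin m₀ → Input d) (hwb : Function.Injective wb) {θ : Param d m}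
    (hθ : θ ∈ Qstar m σ (network σ abar wb)) (s : Fin m₀) :
    ∃ k, weight θ k = wb s ∧ outer θ k ≠ 0 := by
  classical
  by_contra! hcon
  set S : Finset (Input d) := Finset.univ.image (weight θ) ∪ Finset.univ.image wb with hS
  -- With both sums grouped by weight, the coefficient at `wb s` is `-abar s` if no active neuron
  -- has that weight.
  have hli := linearIndependent_iff'.1 (linearIndependent_neurons hσ (d := d)) S
    (fun w => (∑ k with weight θ k = w, outer θ k) - ∑ s with wb s = w, abar s) (by
      funext x
      have h1 : ∑ k, outer θ k * σ (inner ℝ (weight θ k) x) =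
          ∑ w ∈ S, (∑ k with weight θ k = w, outer θ k) * σ (inner ℝ w x) := by
        rw [← Finset.sum_fiberwise_of_maps_to (s := Finset.univ) (t := S) (g := weight θ)
          (fun k _ => Finset.mem_union_left _ (Finset.mem_image_of_mem _ (Finset.mem_univ k)))]
        refine Finset.sum_congr rfl fun w _ => ?_
        rw [Finset.sum_mul]
        exact Finset.sum_congr rfl fun k hk => by rw [(Finset.mem_filter.1 hk).2]
      have h2 : ∑ k, abar k * σ (inner ℝ (wb k) x) =
          ∑ w ∈ S, (∑ k with wb k = w, abar k) * σ (inner ℝ w x) := by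
        rw [← Finset.sum_fiberwise_of_maps_to (s := Finset.univ) (t := S) (g := wb)
          (fun k _ => Finset.mem_union_right _ (Finset.mem_image_of_mem _ (Finset.mem_univ k)))]
        refine Finset.sum_congr rfl fun w _ => ?_
        rw [Finset.sum_mul]
        exact Finset.sum_congr rfl fun k hk => by rw [(Finset.mem_filter.1 hk).2]
      have h3 := hθ x
      rw [model, network, network, h1, h2, ← sub_eq_zero, ← Finset.sum_sub_distrib] at h3
      simp only [Finset.sum_apply, Pi.smul_apply, smul_eq_mul, sub_mul]
      exact h3) (wb s) (Finset.mem_union_right _ (Finset.mem_image_of_mem _ (Finset.mem_univ s)))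
  rw [Finset.sum_eq_zero fun k hk => hcon k (Finset.mem_filter.1 hk).2,
    Finset.sum_eq_single_of_mem s (by simp) fun t ht hne =>
      absurd (hwb (Finset.mem_filter.1 ht).2) hne] at hli
  exact habar s (by simpa using hli)

/-- Near an exact representation of the target, the loss for few type-II separating samples is
Morse–Bott at its zero set. -/
theorem exists_isMorseBottAt_lossZero (hσ : IsGoodActivation σ) {f : Input d → ℝ}
    {x : Fin n → Input d} {θ : Param d m} (hθ : θ ∈ Qstar m σ f)
    (hs : Function.Surjective (fderiv ℝ (residual m σ f x) θ)) :
    ∃ U : Set (Param d m), IsOpen U ∧ θ ∈ U ∧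
      IsMorseBottAt (loss m σ f x) (U ∩ lossZero m σ f x) := by
  rw [loss_eq, lossZero_eq]
  exact isMorseBottAt_zero_of_surjective (contDiff_residual hσ.1 f x) (residual_eq_zero x hθ) hs

theorem isMorseBottAt_of_few_samples (hσ : IsGoodActivation σ) (abar : Fin m₀ → ℝ)
    (habar : ∀ k, abar k ≠ 0) (wb : Fin m₀ → Input d) {x : Fin n → Input d}
    (hn : n ≤ (d + 1) * m₀) (hx : IsTypeII σ wb x) {θ : Param d m}
    (hθ : θ ∈ Qstar m σ (network σ abar wb)) :
    ∃ U : Set (Param d m), IsOpen U ∧ θ ∈ U ∧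
      IsMorseBottAt (loss m σ (network σ abar wb) x)
        (U ∩ lossZero m σ (network σ abar wb) x) := by
  choose κ hκ hκ0 using exists_active hσ abar habar wb hx.1.1 hθ
  have hκi : Function.Injective κ := fun s t h => hx.1.1 (by rw [← hκ s, ← hκ t, h])
  refine exists_isMorseBottAt_lossZero hσ hθ fun z => ?_
  obtain ⟨v, hv⟩ := mulVec_surjective_of_rank _ (by rw [hx.2, min_eq_left hn, Fintype.card_fin])
    fun i => z i
  obtain ⟨u, hu⟩ := mulVec_mem_range_fderiv hσ.1 (network σ abar wb) x hκi hκ hκ0 v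
  exact ⟨u, PiLp.ext fun i => (hu i).trans (congrFun hv i)⟩

/-! ### Completing the columns by further neurons -/

/-- Weights and samples exchange roles: as functions of `u` the `σ(u · xᵢ)` are independent for
distinct `xᵢ`, so no proper subspace contains all their value vectors. The admissible `u` form a
nonempty open set, infinite since `d ≥ 1`. -/
theorem infinite_neuron_notMem (hd : 1 ≤ d) (hσ : IsGoodActivation σ) {x : Fin n → Input d}
    (hx : Function.Injective x) {S : Submodule ℝ (Fin n → ℝ)} (hS : S ≠ ⊤) :
    {u : Input d | (fun i => σ (inner ℝ u (x i))) ∉ S}.Infinite := by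
  have : Nonempty (Fin d) := ⟨⟨0, hd⟩⟩
  have hcont : Continuous fun (u : Input d) (i : Fin n) => σ (inner ℝ u (x i)) := by
    refine continuous_pi fun i => ?_
    have : Continuous σ := continuous_iff_continuousAt.2 fun t => (hσ.1 t trivial).continuousAt
    fun_prop
  have hopen : IsOpen {u : Input d | (fun i => σ (inner ℝ u (x i))) ∉ S} :=
    (S.closed_of_finiteDimensional.preimage hcont).isOpen_compl
  have hne : {u : Input d | (fun i => σ (inner ℝ u (x i))) ∉ S}.Nonempty := by
    by_contra! hempty
    have hall : ∀ u : Input d, (fun i => σ (inner ℝ u (x i))) ∈ S := fun u => by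
      by_contra h
      exact (Set.eq_empty_iff_forall_notMem.1 hempty) u h
    obtain ⟨φ, hφ, hφS⟩ := S.exists_le_ker_of_lt_top (lt_top_iff_ne_top.2 hS)
    apply hφ
    have hli := (linearIndependent_neurons hσ (d := d)).comp x hx
    rw [Fintype.linearIndependent_iff] at hli
    have h1 := hli (fun i => φ (Pi.single i 1)) (by
      funext u
      have h2 : φ (fun i => σ (inner ℝ u (x i))) = 0 := hφS (hall u)
      rw [LinearMap.pi_apply_eq_sum_univ] at h2
      simp only [Finset.sum_apply, Pi.smul_apply, smul_eq_mul, Function.comp_apply, Pi.zero_apply]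
      rw [← h2]
      refine Finset.sum_congr rfl fun i _ => ?_
      rw [real_inner_comm, smul_eq_mul, mul_comm]
      congr 2
      ext j
      simp [Pi.single_apply, eq_comm])
    refine LinearMap.pi_ext' fun i => LinearMap.ext_ring ?_
    simpa using h1 i
  obtain ⟨u, hu⟩ := hne
  exact infinite_of_mem_nhds u (hopen.mem_nhds hu)

/-- These become the weights of deficient blocks, which contribute only their neuron vectors to the
differential. Avoiding `T` keeps the weights of all blocks distinct. -/
theorem exists_completing_neurons (hd : 1 ≤ d) (hσ : IsGoodActivation σ) {x : Fin n → Input d}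
    (hx : Function.Injective x) (l : ℕ) (S : Submodule ℝ (Fin n → ℝ))
    (hS : n ≤ Module.finrank ℝ S + l) (T : Finset (Input d)) :
    ∃ u : Fin l → Input d, Function.Injective u ∧ (∀ j, u j ∉ T) ∧
      S ⊔ Submodule.span ℝ (Set.range fun j i => σ (inner ℝ (u j) (x i))) = ⊤ := by
  classical
  have : Nonempty (Fin d) := ⟨⟨0, hd⟩⟩
  induction l generalizing S T with
  | zero =>
    refine ⟨Fin.elim0, fun j => j.elim0, fun j => j.elim0, ?_⟩
    have : S = ⊤ := by
      apply Submodule.eq_top_of_finrank_eq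
      rw [Module.finrank_fintype_fun_eq_card, Fintype.card_fin]
      have := S.finrank_le
      rw [Module.finrank_fintype_fun_eq_card, Fintype.card_fin] at this
      omega
    rw [this, top_sup_eq]
  | succ l ih =>
    obtain ⟨u₀, hu₀T, hu₀⟩ : ∃ u₀ ∉ T, S = ⊤ ∨ (fun i => σ (inner ℝ u₀ (x i))) ∉ S := by
      by_cases h : S = ⊤
      · obtain ⟨u₀, hu₀⟩ := T.exists_notMem
        exact ⟨u₀, hu₀, Or.inl h⟩
      · obtain ⟨u₀, h1, h2⟩ := (infinite_neuron_notMem hd hσ hx h).exists_notMem_finset T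
        exact ⟨u₀, h2, Or.inr h1⟩
    set S' := S ⊔ Submodule.span ℝ {fun i => σ (inner ℝ u₀ (x i))} with hS'
    have hrank : n ≤ Module.finrank ℝ S' + l := by
      rcases hu₀ with h | h
      · rw [hS', h, top_sup_eq, finrank_top, Module.finrank_fintype_fun_eq_card, Fintype.card_fin]
        omega
      · have hlt : S < S' := by
          refine lt_of_le_of_ne le_sup_left fun heq => h ?_
          rw [heq]
          exact Submodule.mem_sup_right (Submodule.mem_span_singleton_self _)
        have := Submodule.finrank_lt_finrank_of_lt hlt
        omega
    obtain ⟨u, hui, huT, hu⟩ := ih S' hrank (insert u₀ T)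
    refine ⟨Fin.cons u₀ u, ?_, ?_, ?_⟩
    · refine Fin.cons_injective_iff.2 ⟨?_, hui⟩
      rintro ⟨j, hj⟩
      exact huT j (by rw [hj]; exact Finset.mem_insert_self _ _)
    · intro j
      refine Fin.cases hu₀T (fun j => ?_) j
      exact fun h => huT j (Finset.mem_insert_of_mem (by simpa using h))
    · rw [← hu, hS', sup_assoc, ← Submodule.span_union]
      congr 2
      ext v
      simp only [Set.mem_range, Set.mem_union, Set.mem_singleton_iff]
      rw [Fin.exists_fin_succ]
      simp [eq_comm]

end Surjective

/-! ## Points and tangent spaces of branches -/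

section Branches

variable {d m r m₀ n : ℕ}

/-! ### Counting blocks -/

theorem BlockMap.Deficient.sum_eq {B : BlockMap m r} {t : Fin r} (ht : B.Deficient m₀ t)
    {X : Type*} [AddCommMonoid X] (g : Fin m → X) :
    ∑ k with B.blk k = t, g k = g (B.fst t) := by
  refine Finset.sum_eq_single_of_mem _ (by simp [B.blk_fst]) fun k hk hne => ?_
  exact absurd (ht.2 k (Finset.mem_filter.1 hk).2) hne

theorem BlockMap.exists_ne_fst (B : BlockMap m r) {t : Fin r} (ht : ¬ B.Deficient m₀ t)
    (h : m₀ ≤ (t : ℕ)) : ∃ k, B.blk k = t ∧ k ≠ B.fst t := by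
  by_contra! hcon
  exact ht ⟨h, hcon⟩

open Classical in
theorem BlockMap.card_not_deficient (B : BlockMap m r) (m₀ : ℕ) :
    Fintype.card {t // ¬ B.Deficient m₀ t} =
      r - (Finset.univ.filter fun t => B.Deficient m₀ t).card := by
  rw [Fintype.card_subtype_compl, Fintype.card_fin, Fintype.card_subtype]

open Classical in
theorem BlockMap.le_card_not_deficient (B : BlockMap m r) (hr : m₀ ≤ r) :
    m₀ ≤ Fintype.card {t // ¬ B.Deficient m₀ t} := by
  have := Fintype.card_le_of_injective
    (fun s : Fin m₀ => (⟨Fin.castLE hr s, fun h => absurd h.1 (not_le.2 s.2)⟩ :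
      {t // ¬ B.Deficient m₀ t}))
    fun s s' h => Fin.castLE_injective hr (congrArg Subtype.val h)
  simpa using this

-- Every nondeficient block contains a neuron that is not a base neuron. This is the inequality `r -
-- l ≤ m + m₀ - r`, whose equality case governs (c).
open Classical in
theorem BlockMap.card_not_deficient_le (B : BlockMap m r) (hr : m₀ ≤ r) :
    Fintype.card {t // ¬ B.Deficient m₀ t} ≤ m + m₀ - r := by
  have h1 : ∀ t : {t // ¬ B.Deficient m₀ t}, ∃ k, B.blk k = t ∧ ¬ B.Base m₀ k := by
    rintro ⟨t, ht⟩
    by_cases h : m₀ ≤ (t : ℕ)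
    · obtain ⟨k, hk, hne⟩ := B.exists_ne_fst ht h
      exact ⟨k, hk, fun hb => hne (by rw [hb.2, hk])⟩
    · exact ⟨B.fst t, B.blk_fst t, fun hb => h (by simpa [B.blk_fst] using hb.1)⟩
  choose κ hκ hκ' using h1
  have h2 := Fintype.card_le_of_injective
    (fun t => (⟨κ t, hκ' t⟩ : {k // ¬ B.Base m₀ k}))
    fun t t' h => Subtype.ext (by
      rw [← hκ t, ← hκ t']; exact congrArg B.blk (congrArg Subtype.val h))
  have h3 := card_not_base B hr
  omega

/-! ### Standard outer weights -/

/-- Outer weights on the branch that vanish only on the deficient blocks. -/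
noncomputable def BlockMap.stdOuter (B : BlockMap m r) (abar : Fin m₀ → ℝ) (k : Fin m) : ℝ :=
  if (B.blk k : ℕ) < m₀ then
    blockSum abar r (B.blk k) / (Finset.univ.filter fun k' => B.blk k' = B.blk k).card
  else if k = B.fst (B.blk k) then
    1 - ((Finset.univ.filter fun k' => B.blk k' = B.blk k).card : ℝ)
  else 1

/-- The sign of the standard outer weights of a block. -/
def blockSign (abar : Fin m₀ → ℝ) (r : ℕ) (t : Fin r) : ℝ :=
  if h : (t : ℕ) < m₀ then abar ⟨t, h⟩ else 1

theorem BlockMap.card_block_pos (B : BlockMap m r) (t : Fin r) :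
    0 < (Finset.univ.filter fun k' => B.blk k' = t).card :=
  Finset.card_pos.2 ⟨B.fst t, by simp [B.blk_fst]⟩

theorem BlockMap.sum_stdOuter (B : BlockMap m r) (abar : Fin m₀ → ℝ) (t : Fin r) :
    ∑ k with B.blk k = t, B.stdOuter abar k = blockSum abar r t := by
  have hc := B.card_block_pos t
  by_cases ht : (t : ℕ) < m₀
  · rw [Finset.sum_congr rfl fun k hk => show B.stdOuter abar k =
      blockSum abar r t / (Finset.univ.filter fun k' => B.blk k' = t).card by
        rw [stdOuter, (Finset.mem_filter.1 hk).2, if_pos ht]]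
    rw [Finset.sum_const, nsmul_eq_mul, mul_div_cancel₀]
    exact_mod_cast hc.ne'
  · have hmem : B.fst t ∈ Finset.univ.filter fun k' => B.blk k' = t := by simp [B.blk_fst]
    rw [← Finset.add_sum_erase _ _ hmem,
      Finset.sum_congr rfl fun k hk => show B.stdOuter abar k = 1 by
        have h1 := (Finset.mem_filter.1 (Finset.mem_of_mem_erase hk)).2
        rw [stdOuter, h1, if_neg ht, if_neg (Finset.ne_of_mem_erase hk)],
      Finset.sum_const, Finset.card_erase_of_mem hmem, stdOuter, B.blk_fst, if_neg ht, if_pos rfl,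
      blockSum, dif_neg ht, nsmul_eq_mul, Nat.cast_sub hc]
    simp

/-- Within a block all outer weights have one sign, except perhaps that of the base neuron, which
brings the sum to zero. Its offset is always zero, so the sign condition on the others suffices to
bound offsets by even moments. -/
theorem BlockMap.stdOuter_mul_pos (B : BlockMap m r) {abar : Fin m₀ → ℝ}
    (habar : ∀ k, abar k ≠ 0) {k : Fin m} (hk : ¬ B.Base m₀ k) :
    0 < B.stdOuter abar k * blockSign abar r (B.blk k) := by
  by_cases ht : (B.blk k : ℕ) < m₀
  · rw [stdOuter, if_pos ht, blockSign, dif_pos ht, blockSum, dif_pos ht, div_mul_eq_mul_div]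
    exact div_pos (mul_self_pos.2 (habar _)) (by exact_mod_cast B.card_block_pos _)
  · rw [stdOuter, if_neg ht, if_neg fun h => hk ⟨not_lt.1 ht, h⟩, blockSign, dif_neg ht]
    norm_num

theorem BlockMap.exists_stdOuter_ne_zero (B : BlockMap m r) {abar : Fin m₀ → ℝ}
    (habar : ∀ k, abar k ≠ 0) (t : Fin r) (ht : ¬ B.Deficient m₀ t) :
    ∃ k, B.blk k = t ∧ B.stdOuter abar k ≠ 0 := by
  by_cases h : m₀ ≤ (t : ℕ)
  · obtain ⟨k, hk, hne⟩ := B.exists_ne_fst ht h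
    exact ⟨k, hk, left_ne_zero_of_mul
      (B.stdOuter_mul_pos habar (k := k) fun hb => hne (by rw [hb.2, hk])).ne'⟩
  · refine ⟨B.fst t, B.blk_fst t, left_ne_zero_of_mul
      (B.stdOuter_mul_pos habar (k := B.fst t) fun hb => h ?_).ne'⟩
    simpa [B.blk_fst] using hb.1

variable {σ : ℝ → ℝ}

theorem mkParam_mem_branch (hσ : IsGoodActivation σ) (hr : m₀ ≤ r) (abar : Fin m₀ → ℝ)
    (wb : Fin m₀ → Input d) (P : Partition m r) (B : BlockMap m r)
    (hB : ∀ t k, P.InBlock t k ↔ B.blk k = t) {u : Fin r → Input d} (hu : Function.Injective u)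
    (huw : ∀ (t : Fin r) (s : Fin m₀), (t : ℕ) = s → u t = wb s) {a : Fin m → ℝ}
    (ha : ∀ t, ∑ k with B.blk k = t, a k = blockSum abar r t) :
    mkParam a (fun k => u (B.blk k)) ∈ branch σ (network σ abar wb) wb P := by
  rw [mem_branch_iff hσ hr abar wb P B hB]
  simp only [weight_mkParam, outer_mkParam, B.blk_fst]
  exact ⟨hu, fun _ => trivial, huw, ha⟩

/-! ### Failure of the Morse–Bott property -/

theorem tangentVectors_subset {E : Type*} [NormedAddCommGroup E] [InnerProductSpace ℝ E]
    [FiniteDimensional ℝ E] {M : Set E} {p : E} (W : Submodule ℝ E)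
    (h : ∀ q ∈ M, q - p ∈ W) : tangentVectors M p ⊆ W := by
  rintro v ⟨γ, hγ0, hγM, hγ⟩
  refine W.closed_of_finiteDimensional.mem_of_tendsto (hasDerivAt_iff_tendsto_slope.1 hγ) ?_
  filter_upwards [hγM.filter_mono nhdsWithin_le_nhds] with t ht
  rw [slope, vsub_eq_sub, hγ0]
  exact W.smul_mem _ (h _ ht)

theorem sub_mem_branchDir (hσ : IsGoodActivation σ) (hr : m₀ ≤ r) (abar : Fin m₀ → ℝ)
    (wb : Fin m₀ → Input d) (P : Partition m r) (B : BlockMap m r)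
    (hB : ∀ t k, P.InBlock t k ↔ B.blk k = t) {θ θ' : Param d m}
    (hθ : θ ∈ branch σ (network σ abar wb) wb P) (hθ' : θ' ∈ branch σ (network σ abar wb) wb P) :
    θ - θ' ∈ branchDir d B m₀ := by
  rw [mem_branch_iff hσ hr abar wb P B hB] at hθ hθ'
  obtain ⟨-, h2, h3, h4⟩ := hθ
  obtain ⟨-, h2', h3', h4'⟩ := hθ'
  refine mem_branchDir.2 ⟨fun t => ?_, fun k => ?_⟩
  · simp only [outer_sub, Finset.sum_sub_distrib, h4, h4', sub_self]
  · rw [weight_sub, h2, h2']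
    split_ifs with h
    · rw [h3 _ ⟨_, h⟩ rfl, h3' _ ⟨_, h⟩ rfl, sub_self]
    · rfl

/-- `blockDiff` omits inner variations in deficient blocks because the only outer weight there
equals the block sum, which is zero. -/
theorem fderiv_residual_eq_zero (hσ : IsGoodActivation σ) (hr : m₀ ≤ r) (abar : Fin m₀ → ℝ)
    (wb : Fin m₀ → Input d) (P : Partition m r) (B : BlockMap m r)
    (hB : ∀ t k, P.InBlock t k ↔ B.blk k = t) (x : Fin n → Input d) {θ : Param d m}
    (hθ : θ ∈ branch σ (network σ abar wb) wb P) {v : Param d m}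
    (hv : blockDiff B m₀ θ v = 0) :
    fderiv ℝ (residual m σ (network σ abar wb) x) θ v = 0 := by
  rw [mem_branch_iff hσ hr abar wb P B hB] at hθ
  have h1 : ∀ t, ∑ k with B.blk k = t, outer v k = 0 := fun t => congrFun (congrArg Prod.fst hv) t
  have h2 : ∀ t, ∑ k with B.blk k = t, outer θ k • weight v k = 0 := fun t => by
    by_cases ht : B.Deficient m₀ t
    · have h3 := hθ.2.2.2 t
      rw [ht.sum_eq, blockSum, dif_neg (not_lt.2 ht.1)] at h3
      rw [ht.sum_eq, h3, zero_smul]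
    · exact congrFun (congrArg Prod.snd hv) ⟨t, ht⟩
  ext i
  rw [fderiv_residual_blocks hσ.1 _ x B θ hθ.2.1]
  simp [h1, h2]

open Classical in
/-- If there are too few nondeficient blocks, the loss is not Morse–Bott at the branch. -/
theorem not_isMorseBottAt_branch (hd : 1 ≤ d) (hσ : IsGoodActivation σ) (hr : m₀ ≤ r)
    (abar : Fin m₀ → ℝ) (wb : Fin m₀ → Input d) (P : Partition m r) (B : BlockMap m r)
    (hB : ∀ t k, P.InBlock t k ↔ B.blk k = t)
    (hcard : Fintype.card {t // ¬ B.Deficient m₀ t} < m + m₀ - r) (x : Fin n → Input d)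
    {U : Set (Param d m)} (hU : (U ∩ branch σ (network σ abar wb) wb P).Nonempty) :
    ¬ IsMorseBottAt (loss m σ (network σ abar wb) x)
      (U ∩ branch σ (network σ abar wb) wb P) := by
  obtain ⟨p, hp⟩ := hU
  -- The kernel of `blockDiff` has codimension at most `r` plus `d` per nondeficient block, which is
  -- less than the dimension `r + (m + m₀ - r) d` of the orthogonal complement of the branch
  -- direction. So the two meet.
  obtain ⟨u, huk, huW, hu0⟩ : ∃ u, blockDiff B m₀ p u = 0 ∧ u ∈ (branchDir d B m₀)ᗮ ∧ u ≠ 0 := by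
    by_contra! hcon
    have h1 : Disjoint (LinearMap.ker (blockDiff B m₀ p)) (branchDir d B m₀)ᗮ :=
      Submodule.disjoint_def.2 fun u h1 h2 => hcon u h1 h2
    have h2 := Submodule.finrank_add_finrank_le_of_disjoint h1
    have h3 := (branchDir d B m₀).finrank_add_finrank_orthogonal
    have h4 := finrank_ker_blockDiff B m₀ p
    have h5 := finrank_branchDir (d := d) B hr
    rw [finrank_param] at h2 h3
    have h6 : Fintype.card {t // ¬ B.Deficient m₀ t} * d < (m + m₀ - r) * d :=
      Nat.mul_lt_mul_of_pos_right hcard hd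
    omega
  rw [loss_eq]
  exact not_isMorseBottAt (contDiff_residual hσ.1 _ x) hp (residual_eq_zero x hp.2.1)
    (branchDir d B m₀) (tangentVectors_subset _ fun q hq =>
      sub_mem_branchDir hσ hr abar wb P B hB hq.2 hp.2) huW hu0
    (fderiv_residual_eq_zero hσ hr abar wb P B hB x hp.2 huk)

end Branches

/-! ## Morse–Bott points of branches -/

section MorseBottBranches

open Matrix

variable {d m r m₀ n s : ℕ} {σ : ℝ → ℝ}

/-- Few samples: near some point of the branch, the loss is Morse–Bott at its zero set. -/
theorem exists_isMorseBottAt_few (hd : 1 ≤ d) (hσ : IsGoodActivation σ) (hr : m₀ ≤ r)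
    {abar : Fin m₀ → ℝ} (wb : Fin m₀ → Input d) (P : Partition m r)
    (B : BlockMap m r) (hB : ∀ t k, P.InBlock t k ↔ B.blk k = t) {x : Fin n → Input d}
    (hxi : Function.Injective x) (w : {t // ¬ B.Deficient m₀ t} → Input d)
    (hw : Function.Injective w)
    (hwb : ∀ t (s : Fin m₀), (t.1 : ℕ) = s → w t = wb s)
    (S : Submodule ℝ (Fin n → ℝ))
    (hS : n ≤ Module.finrank ℝ S + P.deficient m₀)
    (hSr : ∀ θ : Param d m, (∀ k, (h : ¬ B.Deficient m₀ (B.blk k)) → weight θ k = w ⟨_, h⟩) →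
      (∀ k, outer θ k = B.stdOuter abar k) → ∀ z ∈ S,
      ∃ v, ∀ i, fderiv ℝ (residual m σ (network σ abar wb) x) θ v i = z i)
    (hl : ∀ m₀, P.deficient m₀ = Nat.card {t // B.Deficient m₀ t}) :
    ∃ U : Set (Param d m), IsOpen U ∧ (U ∩ branch σ (network σ abar wb) wb P).Nonempty ∧
      IsMorseBottAt (loss m σ (network σ abar wb) x)
        (U ∩ lossZero m σ (network σ abar wb) x) := by
  classical
  rw [hl] at hS
  -- `S` is attained through the nondeficient blocks. The dimensions it may lack number at most the
  -- deficient blocks, whose weights are chosen to supply them.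
  obtain ⟨u', hu'i, hu'T, hu'⟩ := exists_completing_neurons hd hσ hxi _ S hS
    (Finset.univ.image w)
  let φ := (Finite.equivFin {t // B.Deficient m₀ t})
  set u : Fin r → Input d := fun t => if h : B.Deficient m₀ t then u' (φ ⟨t, h⟩) else w ⟨t, h⟩
    with hu
  have hne : ∀ (j) (t), u' j ≠ w t := fun j t h =>
    hu'T j (h ▸ Finset.mem_image_of_mem _ (Finset.mem_univ _))
  have hui : Function.Injective u := by
    intro t t' h
    simp only [hu] at h
    split_ifs at h with h1 h2 h2
    · exact congrArg Subtype.val (φ.injective (hu'i h))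
    · exact absurd h (hne _ _)
    · exact absurd h.symm (hne _ _)
    · exact congrArg Subtype.val (hw h)
  have huw : ∀ (t : Fin r) (s : Fin m₀), (t : ℕ) = s → u t = wb s := by
    intro t s h
    have h1 : ¬ B.Deficient m₀ t := fun h2 => absurd h2.1 (by omega)
    simp only [hu, dif_neg h1]
    exact hwb ⟨t, h1⟩ s h
  set θ : Param d m := mkParam (B.stdOuter abar) fun k => u (B.blk k) with hθ
  have hθb := mkParam_mem_branch hσ hr abar wb P B hB hui huw (B.sum_stdOuter abar)
  have hsurj : Function.Surjective (fderiv ℝ (residual m σ (network σ abar wb) x) θ) := by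
    let L : Param d m →ₗ[ℝ] (Fin n → ℝ) := (WithLp.linearEquiv 2 ℝ (Fin n → ℝ)).toLinearMap ∘ₗ
      (fderiv ℝ (residual m σ (network σ abar wb) x) θ : Param d m →ₗ[ℝ] EuclideanSpace ℝ (Fin n))
    have hL : LinearMap.range L = ⊤ := by
      rw [eq_top_iff, ← hu', sup_le_iff, Submodule.span_le]
      constructor
      · intro z hz
        obtain ⟨v, hv⟩ := hSr θ (fun k h => by simp only [hθ, weight_mkParam, hu, dif_neg h])
          (fun k => rfl) z hz
        exact ⟨v, funext hv⟩
      · rintro _ ⟨j, rfl⟩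
        obtain ⟨v, hv⟩ := neuron_mem_range_fderiv hσ.1 (network σ abar wb) x θ
          (B.fst (φ.symm j).1)
        refine ⟨v, funext fun i => (hv i).trans ?_⟩
        have h1 : u (φ.symm j).1 = u' j := by
          simp only [hu, dif_pos (φ.symm j).2, Subtype.coe_eta, Equiv.apply_symm_apply]
        simp only [hθ, weight_mkParam, B.blk_fst, h1]
    intro z
    obtain ⟨v, hv⟩ := LinearMap.range_eq_top.1 hL fun i => z i
    exact ⟨v, PiLp.ext fun i => congrFun hv i⟩
  obtain ⟨U, hU, hθU, hMB⟩ := exists_isMorseBottAt_lossZero hσ hθb.1 hsurj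
  exact ⟨U, hU, ⟨θ, hθU, hθb⟩, hMB⟩

/-- Few samples that are type-II separating for target weights of the nondeficient blocks. -/
theorem exists_isMorseBottAt_of_isTypeII (hd : 1 ≤ d) (hσ : IsGoodActivation σ) (hr : m₀ ≤ r)
    {abar : Fin m₀ → ℝ} (habar : ∀ k, abar k ≠ 0) (wb : Fin m₀ → Input d) (P : Partition m r)
    {x : Fin n → Input d} (hxi : Function.Injective x) {w : Fin s → Input d}
    (hs : s + P.deficient m₀ = r) (hwb : ∀ (t : Fin s) (s' : Fin m₀), (t : ℕ) = s' → w t = wb s')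
    (hx : IsTypeII σ w x) (hn : n ≤ r + s * d) :
    ∃ U : Set (Param d m), IsOpen U ∧ (U ∩ branch σ (network σ abar wb) wb P).Nonempty ∧
      IsMorseBottAt (loss m σ (network σ abar wb) x)
        (U ∩ lossZero m σ (network σ abar wb) x) := by
  classical
  obtain ⟨B, hB, hl⟩ := P.exists_blockMap
  have hcard : Fintype.card {t // ¬ B.Deficient m₀ t} = s := by
    rw [B.card_not_deficient, ← hl]; omega
  have hms : m₀ ≤ s := hcard ▸ B.le_card_not_deficient hr
  obtain ⟨ψ, hψ⟩ : ∃ ψ : {t // ¬ B.Deficient m₀ t} ≃ Fin s,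
      ∀ t, (t.1 : ℕ) < m₀ → (ψ t : ℕ) = t.1 := by
    obtain ⟨ψ, hψ⟩ := Finset.exists_equiv_extend_of_card_eq
      (t := (Finset.univ : Finset (Fin s))) (by simp [hcard])
      (s := Finset.univ.filter fun t : {t // ¬ B.Deficient m₀ t} => (t.1 : ℕ) < m₀)
      (f := fun t => if h : (t.1 : ℕ) < m₀ then ⟨t.1, h.trans_le hms⟩ else
        ⟨s - 1, by have := Fintype.card_pos_iff.2 ⟨t⟩; omega⟩) (by simp) (by
        intro t ht t' ht' h
        have h1 := (Finset.mem_filter.1 ht).2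
        have h2 := (Finset.mem_filter.1 ht').2
        simp only [dif_pos h1, dif_pos h2, Fin.mk.injEq] at h
        exact Subtype.ext (Fin.ext h))
    refine ⟨ψ.trans (Equiv.subtypeUnivEquiv (by simp)), fun t ht => ?_⟩
    have := hψ t (by simpa using ht)
    rw [dif_pos ht] at this
    exact congrArg Fin.val this
  refine exists_isMorseBottAt_few hd hσ hr wb P B hB hxi (fun t => w (ψ t))
    (hx.1.1.comp ψ.injective) (fun t s' h => hwb _ _ ?_)
    (LinearMap.range (sampleMatrix σ w x).mulVecLin) ?_ ?_ fun m₀ => ?_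
  · rw [hψ t (by omega), h]
  · have h1 : Module.finrank ℝ (LinearMap.range (sampleMatrix σ w x).mulVecLin) =
      min n ((d + 1) * s) := hx.2
    rw [h1]
    have : (d + 1) * s = s * d + s := by ring
    omega
  · rintro θ hθw hθo z ⟨v, rfl⟩
    choose κ hκ hκ0 using fun t => B.exists_stdOuter_ne_zero habar (ψ.symm t).1 (ψ.symm t).2
    refine mulVec_mem_range_fderiv hσ.1 _ x (κ := κ) (fun t t' h => ?_) (fun t => ?_)
      (fun t => by rw [hθo]; exact hκ0 t) v
    · exact ψ.symm.injective (Subtype.ext (by rw [← hκ t, ← hκ t', h]))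
    · have h1 : ¬ B.Deficient m₀ (B.blk (κ t)) := by rw [hκ]; exact (ψ.symm t).2
      rw [hθw _ h1]
      have h2 : (⟨B.blk (κ t), h1⟩ : {t // ¬ B.Deficient m₀ t}) = ψ.symm t := Subtype.ext (hκ t)
      rw [h2, Equiv.apply_symm_apply]
  · rw [hl, Nat.card_eq_fintype_card, Fintype.card_subtype]

theorem isOpen_injective_weight (B : BlockMap m r) :
    IsOpen {θ : Param d m | Function.Injective fun t => weight θ (B.fst t)} := by
  have : {θ : Param d m | Function.Injective fun t => weight θ (B.fst t)} =
      ⋂ (t : Fin r) (t' : Fin r) (_ : t ≠ t'),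
        {θ | weightL d (B.fst t) θ ≠ weightL d (B.fst t') θ} := by
    ext θ
    simp only [Function.Injective, Set.mem_ofPred_eq, Set.mem_iInter, weightL_apply]
    exact ⟨fun h t t' hne heq => hne (h heq), fun h t t' heq => by_contra fun hne => h t t' hne heq⟩
  rw [this]
  refine isOpen_iInter_of_finite fun t => isOpen_iInter_of_finite fun t' =>
    isOpen_iInter_of_finite fun _ => ?_
  exact isOpen_ne_fun (weightL d (B.fst t)).continuous (weightL d (B.fst t')).continuous

open Classical in
/-- If the number of nondeficient blocks is maximal, some selection of the samples separates the
branch and makes the loss Morse–Bott. -/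
theorem exists_isMorseBottAt_branch (hσ : IsGoodActivation σ) (hr : m₀ ≤ r)
    {abar : Fin m₀ → ℝ} (habar : ∀ k, abar k ≠ 0) (wb : Fin m₀ → Input d) (P : Partition m r)
    (B : BlockMap m r) (hB : ∀ t k, P.InBlock t k ↔ B.blk k = t)
    (hcard : Fintype.card {t // ¬ B.Deficient m₀ t} = m + m₀ - r) {N : ℕ} (x : Fin N → Input d)
    {w : Fin r → Input d} (hw : Function.Injective w)
    (hwb : ∀ (t : Fin r) (s' : Fin m₀), (t : ℕ) = s' → w t = wb s')
    (hx : (sampleMatrix σ w x).rank = (d + 1) * r) (hn : r + (m + m₀ - r) * d ≤ n) (hnN : n ≤ N) :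
    ∃ (e : Fin n ↪ Fin N) (U : Set (Param d m)),
      Separates U (lossZero m σ (network σ abar wb) (x ∘ e))
        (branch σ (network σ abar wb) wb P) ∧
      IsMorseBottAt (loss m σ (network σ abar wb) (x ∘ e))
        (U ∩ branch σ (network σ abar wb) wb P) := by
  -- Derivative columns of deficient blocks are dropped, since the differential does not see them.
  -- The columns left number exactly the codimension of the branch, so `n` rows can keep them
  -- independent.
  set γ : Fin r ⊕ {t // ¬ B.Deficient m₀ t} × Fin d → Fin r ⊕ Fin r × Fin d :=
    Sum.map id (Prod.map Subtype.val id) with hγ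
  have hγi : Function.Injective γ := Function.injective_id.sumMap
    (Subtype.val_injective.prodMap Function.injective_id)
  have hA := rank_submatrix_col _ (hx.trans card_columns.symm) hγi
  obtain ⟨e, -, he⟩ := exists_row_selection _ hA ∅ (by simp) (n := n) (by simp) (by simpa using hnN)
  have hc : Fintype.card (Fin r ⊕ {t // ¬ B.Deficient m₀ t} × Fin d) = r + (m + m₀ - r) * d := by
    rw [Fintype.card_sum, Fintype.card_prod, hcard]; simp
  rw [min_eq_right (by omega), rank_eq_card_col_iff] at he
  set θ : Param d m := mkParam (B.stdOuter abar) fun k => w (B.blk k) with hθ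
  have hθb : θ ∈ branch σ (network σ abar wb) wb P :=
    mkParam_mem_branch hσ hr abar wb P B hB hw hwb (B.sum_stdOuter abar)
  have hker : ∀ v, fderiv ℝ (residual m σ (network σ abar wb) (x ∘ e)) θ v = 0 →
      blockDiff B m₀ θ v = 0 := by
    intro v hv
    have h1 := he (Sum.elim (fun t => ∑ k with B.blk k = t, outer v k)
      fun tj => (∑ k with B.blk k = tj.1.1, outer θ k • weight v k) tj.2) (by
      funext i
      have h2 : fderiv ℝ (residual m σ (network σ abar wb) (x ∘ e)) θ v i = 0 := by rw [hv]; rfl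
      rw [fderiv_residual_blocks hσ.1 _ _ B θ (fun k => by simp [hθ, B.blk_fst])] at h2
      rw [Pi.zero_apply, ← h2, Finset.sum_add_distrib]
      simp only [mulVec, dotProduct, Fintype.sum_sum_type, Fintype.sum_prod_type, submatrix_apply,
        sampleMatrix, of_apply, Sum.elim_inl, Sum.elim_inr, hγ, Sum.map_inl, Sum.map_inr, id_eq,
        Prod.map_apply, Function.comp_apply]
      congr 1
      · refine Finset.sum_congr rfl fun t _ => ?_
        simp only [hθ, weight_mkParam, B.blk_fst, mul_comm]
      · refine Finset.sum_of_injOn Subtype.val Subtype.val_injective.injOn (by simp)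
          (fun t _ ht => ?_) fun t _ => ?_
        · have ht : B.Deficient m₀ t := by simpa using ht
          rw [ht.sum_eq]
          have h3 := ((mem_branch_iff hσ hr abar wb P B hB θ).1 hθb).2.2.2 t
          rw [ht.sum_eq, blockSum, dif_neg (not_lt.2 ht.1)] at h3
          simp [h3]
        · rw [PiLp.inner_apply (∑ k with B.blk k = (t : Fin r), outer θ k • weight v k),
            Finset.mul_sum]
          refine Finset.sum_congr rfl fun j _ => ?_
          simp only [hθ, weight_mkParam, B.blk_fst, RCLike.inner_apply, conj_trivial]
          ring)
    refine Prod.ext (funext fun t => ?_) (funext fun t => ?_)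
    · exact congrFun h1 (Sum.inl t)
    · ext j
      exact congrFun h1 (Sum.inr (t, j))
  -- At a branch point the inclusion always holds; equality of dimensions is where `hcard` enters.
  have hWk : branchDir d B m₀ = LinearMap.ker (blockDiff B m₀ θ) := by
    refine Submodule.eq_of_le_of_finrank_eq (fun v hv => ?_) ?_
    · rw [mem_branchDir] at hv
      refine Prod.ext (funext hv.1) (funext fun t => ?_)
      change ∑ k with B.blk k = t, outer θ k • weight v k = 0
      rw [Finset.sum_congr rfl fun k hk => by rw [hv.2 k, (Finset.mem_filter.1 hk).2]]
      split_ifs with h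
      · simp
      · rw [← Finset.sum_smul, ((mem_branch_iff hσ hr abar wb P B hB θ).1 hθb).2.2.2, blockSum,
          dif_neg h, zero_smul]
    · have h1 := LinearMap.finrank_range_add_finrank_ker (blockDiff B m₀ θ)
      rw [LinearMap.range_eq_top.2 (blockDiff_surjective B m₀ θ
        (B.exists_stdOuter_ne_zero habar)), finrank_top, Module.finrank_prod, Module.finrank_pi,
        Module.finrank_pi_fintype, finrank_param] at h1
      simp only [finrank_euclideanSpace, Fintype.card_fin, Finset.sum_const, Finset.card_univ,
        smul_eq_mul, hcard] at h1
      have h2 := finrank_branchDir (d := d) B hr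
      omega
  have hMW : ∀ q ∈ {θ : Param d m | Function.Injective fun t => weight θ (B.fst t)},
      q ∈ branch σ (network σ abar wb) wb P ↔ q - θ ∈ branchDir d B m₀ := by
    refine fun q hq => ⟨fun h => sub_mem_branchDir hσ hr abar wb P B hB h hθb, fun h => ?_⟩
    have h1 := (mem_branch_iff hσ hr abar wb P B hB θ).1 hθb
    rw [mem_branchDir] at h
    have hqw : ∀ k, weight q k = weight θ k +
        if (B.blk k : ℕ) < m₀ then 0 else weight (q - θ) (B.fst (B.blk k)) := fun k => by
      rw [← h.2 k, weight_sub, add_sub_cancel]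
    refine (mem_branch_iff hσ hr abar wb P B hB q).2 ⟨hq, fun k => ?_, fun t s hts => ?_,
      fun t => ?_⟩
    · rw [hqw k, hqw (B.fst (B.blk k)), B.blk_fst, ← h1.2.1 k]
    · rw [hqw, B.blk_fst, if_pos (by omega), add_zero, h1.2.2.1 t s hts]
    · rw [← h1.2.2.2 t, ← sub_eq_zero, ← Finset.sum_sub_distrib]
      exact h.1 t
  obtain ⟨U, hU, hθU, hUM, hMB⟩ := isMorseBottAt_affine
    (contDiff_residual hσ.1 (network σ abar wb) (x ∘ e)) (branchDir d B m₀)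
    (branch σ (network σ abar wb) wb P) _ (isOpen_injective_weight B) (p := θ)
    ((mem_branch_iff hσ hr abar wb P B hB θ).1 hθb).1 hMW
    (fun q hq => residual_eq_zero _ hq.1)
    (fun v hv hv0 => Submodule.disjoint_def.1 (branchDir d B m₀).orthogonal_disjoint v
      (hWk ▸ hker v hv0) hv)
  exact ⟨e, U, ⟨hU, ⟨θ, hθU, hθb⟩, by rw [lossZero_eq]; exact hUM⟩, by rw [loss_eq]; exact hMB⟩

end MorseBottBranches

/-! ## Taylor expansion of the neurons -/

section Features

open Filter Topology Finset

variable {d r : ℕ} {σ : ℝ → ℝ}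

/-- The function multiplying the monomial with exponent `α` in the Taylor expansion of a neuron
in its weight at `v`. -/
noncomputable def taylorFeature (σ : ℝ → ℝ) (v : Input d) (α : Fin d → ℕ) (x : Input d) : ℝ :=
  (Nat.multinomial univ α : ℝ) / (∑ j, α j).factorial * (∏ j, x j ^ α j) *
    iteratedDeriv (∑ j, α j) σ (inner ℝ v x)

theorem sum_taylorFeature (σ : ℝ → ℝ) (v η x : Input d) (e : ℕ) :
    ∑ j ∈ range (e + 1), inner ℝ η x ^ j / j.factorial * iteratedDeriv j σ (inner ℝ v x) =
      ∑ j ∈ range (e + 1), ∑ α ∈ piAntidiag univ j, (∏ i, η i ^ α i) * taylorFeature σ v α x := by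
  refine sum_congr rfl fun j _ => ?_
  rw [PiLp.inner_apply, sum_pow_eq_sum_piAntidiag, sum_div, sum_mul]
  refine sum_congr rfl fun α hα => ?_
  rw [taylorFeature, (mem_piAntidiag.1 hα).1]
  simp only [RCLike.inner_apply, conj_trivial, mul_pow, prod_mul_distrib]
  ring

theorem analyticOnNhd_taylorFeature (hσ : AnalyticOnNhd ℝ σ Set.univ) (v : Input d)
    (α : Fin d → ℕ) : AnalyticOnNhd ℝ (taylorFeature σ v α) Set.univ := by
  intro x _
  have h1 : AnalyticAt ℝ (fun x : Input d => iteratedDeriv (∑ j, α j) σ (inner ℝ v x)) x :=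
    (analyticOnNhd_iteratedDeriv hσ (∑ j, α j) (inner ℝ v x) trivial).comp
      ((innerSL ℝ v).analyticAt x)
  have h2 : AnalyticAt ℝ (fun x : Input d => ∏ j, x j ^ α j) x :=
    Finset.analyticAt_fun_prod _ fun j _ => ((EuclideanSpace.proj (𝕜 := ℝ) j).analyticAt x).pow _
  exact (analyticAt_const.mul h2).mul h1

theorem continuous_taylorFeature (hσ : AnalyticOnNhd ℝ σ Set.univ) (α : Fin d → ℕ) (x : Input d) :
    Continuous fun v => taylorFeature σ v α x := by
  have : Continuous (iteratedDeriv (∑ j, α j) σ) := continuous_iff_continuousAt.2 fun t =>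
    (analyticOnNhd_iteratedDeriv hσ _ t trivial).continuousAt
  unfold taylorFeature
  fun_prop

open Classical in
/-- The indices of the Taylor features up to order `e` that do not vanish identically. -/
noncomputable def featureIndex (σ : ℝ → ℝ) (u : Fin r → Input d) (e : ℕ) :
    Finset (Fin r × (Fin d → ℕ)) :=
  (univ ×ˢ (range (e + 1)).biUnion fun j => piAntidiag univ j).filter fun i =>
    u i.1 ≠ 0 ∨ iteratedDeriv (∑ j, i.2 j) σ 0 ≠ 0

theorem mem_featureIndex {u : Fin r → Input d} {e : ℕ} {i : Fin r × (Fin d → ℕ)} :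
    i ∈ featureIndex σ u e ↔
      ∑ j, i.2 j ≤ e ∧ (u i.1 ≠ 0 ∨ iteratedDeriv (∑ j, i.2 j) σ 0 ≠ 0) := by
  simp [featureIndex]

theorem sum_featureIndex {u : Fin r → Input d} {e : ℕ} (g : Fin r × (Fin d → ℕ) → ℝ)
    (hg : ∀ i, u i.1 = 0 → iteratedDeriv (∑ j, i.2 j) σ 0 = 0 → g i = 0) :
    ∑ i : featureIndex σ u e, g i =
      ∑ t, ∑ j ∈ range (e + 1), ∑ α ∈ piAntidiag univ j, g (t, α) := by
  classical
  rw [Finset.sum_coe_sort (featureIndex σ u e) g, featureIndex, sum_filter_of_ne, sum_product]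
  · refine sum_congr rfl fun t _ => ?_
    rw [sum_biUnion]
    intro j _ j' _ hne
    refine disjoint_left.2 fun α h1 h2 => hne ?_
    rw [← (mem_piAntidiag.1 h1).1, (mem_piAntidiag.1 h2).1]
  · intro i _ hi
    by_contra! hcon
    exact hi (hg i hcon.1 hcon.2)

theorem taylorFeature_eq_zero {v : Input d} {α : Fin d → ℕ} (hv : v = 0)
    (h : iteratedDeriv (∑ j, α j) σ 0 = 0) (x : Input d) : taylorFeature σ v α x = 0 := by
  rw [taylorFeature, hv, inner_zero_left, h, mul_zero]

/-- A nontrivial combination of Taylor features is nonzero on an open dense set. -/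
theorem isOpen_dense_features (hσ : IsGoodActivation σ) {u : Fin r → Input d}
    (hu : Function.Injective u) (e : ℕ) (y : featureIndex σ u e → ℝ) (hy : y ≠ 0) :
    IsOpen {x | ∑ i : featureIndex σ u e, taylorFeature σ (u i.1.1) i.1.2 x * y i ≠ 0} ∧
      Dense {x | ∑ i : featureIndex σ u e, taylorFeature σ (u i.1.1) i.1.2 x * y i ≠ 0} := by
  classical
  have han : AnalyticOnNhd ℝ
      (fun x => ∑ i : featureIndex σ u e, taylorFeature σ (u i.1.1) i.1.2 x * y i) Set.univ :=
    fun x hx => Finset.analyticAt_fun_sum _ fun i _ =>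
      (analyticOnNhd_taylorFeature hσ.1 _ _ x hx).mul analyticAt_const
  refine ⟨isOpen_ne_fun (continuous_iff_continuousAt.2 fun x => (han x trivial).continuousAt)
    continuous_const, ?_⟩
  -- A combination nonzero only on a nondense set vanishes near some point, hence everywhere by
  -- analyticity. Grouped by order, it has homogeneous coefficients, to which
  -- `independent_derivatives` applies.
  by_contra hd
  obtain ⟨x₀, hx₀⟩ : ∃ x₀, x₀ ∉ closure
      {x | ∑ i : featureIndex σ u e, taylorFeature σ (u i.1.1) i.1.2 x * y i ≠ 0} := by
    simpa [Dense] using hd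
  have hev : ∀ᶠ x in 𝓝 x₀,
      ∑ i : featureIndex σ u e, taylorFeature σ (u i.1.1) i.1.2 x * y i = 0 := by
    filter_upwards [isClosed_closure.isOpen_compl.mem_nhds hx₀] with x hx
    by_contra h
    exact hx (subset_closure h)
  have hz := han.eqOn_zero_of_preconnected_of_eventuallyEq_zero isPreconnected_univ trivial hev
  set c : Fin r → (Fin d → ℕ) → ℝ := fun t α =>
    if h : (t, α) ∈ featureIndex σ u e then
      (Nat.multinomial univ α : ℝ) / (∑ j, α j).factorial * y ⟨_, h⟩ else 0 with hc
  set p : Fin r → ℕ → MvPolynomial (Fin d) ℝ := fun t j => ∑ α ∈ piAntidiag univ j,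
    MvPolynomial.monomial (Finsupp.equivFunOnFinite.symm α) (c t α) with hp
  have hp0 := independent_derivatives hσ u hu e p (fun t j => by
    refine MvPolynomial.IsHomogeneous.sum _ _ _ fun α hα => ?_
    refine MvPolynomial.isHomogeneous_monomial _ ?_
    rw [Finsupp.degree_eq_sum]
    exact (mem_piAntidiag.1 hα).1) (fun x => by
    refine Eq.trans ?_ (hz (Set.mem_univ x))
    have h1 : ∀ i : featureIndex σ u e, taylorFeature σ (u i.1.1) i.1.2 x * y i =
        (fun i : Fin r × (Fin d → ℕ) => c i.1 i.2 * (∏ j, x j ^ i.2 j) *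
          iteratedDeriv (∑ j, i.2 j) σ (inner ℝ (u i.1) x)) i := by
      intro i
      simp only [hc, taylorFeature, Prod.mk.eta, i.2, dif_pos, Subtype.coe_eta]
      ring
    simp only [h1]
    rw [sum_featureIndex (fun i : Fin r × (Fin d → ℕ) => c i.1 i.2 * (∏ j, x j ^ i.2 j) *
          iteratedDeriv (∑ j, i.2 j) σ (inner ℝ (u i.1) x))]
    · refine sum_congr rfl fun t _ => sum_congr rfl fun j _ => ?_
      rw [hp, map_sum, sum_mul]
      refine sum_congr rfl fun α hα => ?_
      rw [MvPolynomial.eval_monomial, Finsupp.prod_fintype _ _ (by simp), (mem_piAntidiag.1 hα).1]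
      rfl
    · intro i h1 h2
      rw [h1, inner_zero_left, h2, mul_zero])
  apply hy
  funext ⟨⟨t, α⟩, hi⟩
  obtain ⟨h1, h2⟩ := mem_featureIndex.1 hi
  have h3 := congrArg (MvPolynomial.coeff (Finsupp.equivFunOnFinite.symm α))
    (hp0 t (∑ j, α j) h1 h2)
  rw [hp, MvPolynomial.coeff_sum, MvPolynomial.coeff_zero, Finset.sum_eq_single α] at h3
  · rw [MvPolynomial.coeff_monomial, if_pos rfl, hc] at h3
    simp only [dif_pos hi] at h3
    refine (mul_eq_zero.1 h3).resolve_left (div_ne_zero ?_ ?_)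
    · exact_mod_cast (Nat.multinomial_pos _ _).ne'
    · exact_mod_cast Nat.factorial_ne_zero _
  · intro β _ hne
    rw [MvPolynomial.coeff_monomial, if_neg]
    exact fun h => hne (Finsupp.equivFunOnFinite.symm.injective h)
  · intro h
    exact absurd (mem_piAntidiag.2 ⟨rfl, by simp⟩) h

/-! ### The remainder -/

/-- The remainder of the Taylor expansion of order `e`, divided by the `e`-th power. -/
noncomputable def taylorRatio (σ : ℝ → ℝ) (e : ℕ) (s δ : ℝ) : ℝ :=
  (σ (s + δ) - ∑ j ∈ range (e + 1), δ ^ j / j.factorial * iteratedDeriv j σ s) / δ ^ e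

theorem taylorRatio_mul (σ : ℝ → ℝ) (e : ℕ) (s δ : ℝ) :
    σ (s + δ) = ∑ j ∈ range (e + 1), δ ^ j / j.factorial * iteratedDeriv j σ s +
      taylorRatio σ e s δ * δ ^ e := by
  rcases eq_or_ne δ 0 with rfl | hδ
  · rw [taylorRatio, sum_range_succ', sum_eq_zero fun j _ => by simp]
    simp
  · rw [taylorRatio, div_mul_cancel₀ _ (pow_ne_zero _ hδ)]
    ring

/-- This is Lagrange's remainder of order `e - 1`, with the Taylor term of order `e` then
subtracted. -/
theorem exists_taylorRatio_eq (hσ : AnalyticOnNhd ℝ σ Set.univ) {e : ℕ} (he : 0 < e) (s : ℝ)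
    {δ : ℝ} (hδ : δ ≠ 0) : ∃ ξ, |ξ - s| ≤ |δ| ∧
      taylorRatio σ e s δ = (iteratedDeriv e σ ξ - iteratedDeriv e σ s) / e.factorial := by
  obtain ⟨n, rfl⟩ : ∃ n, e = n + 1 := ⟨e - 1, by omega⟩
  have hσ' : ∀ k : ℕ, ContDiff ℝ k σ := fun k =>
    contDiff_iff_contDiffAt.2 fun t => (hσ t trivial).contDiffAt
  have hne : s ≠ s + δ := by simpa using hδ
  have hiter : ∀ j, ∀ z ∈ Set.uIcc s (s + δ),
      iteratedDerivWithin j σ (Set.uIcc s (s + δ)) z = iteratedDeriv j σ z := fun j z hz =>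
    iteratedDerivWithin_eq_iteratedDeriv (uniqueDiffOn_uIcc hne)
      (hσ' j).contDiffAt hz
  obtain ⟨ξ, hξ, h⟩ := taylor_mean_remainder_lagrange hne
    (hσ' n).contDiffOn (by
      refine DifferentiableOn.congr (f := iteratedDeriv n σ) (fun z _ =>
        (analyticOnNhd_iteratedDeriv hσ n z trivial).differentiableAt.differentiableWithinAt) ?_
      exact fun z hz => hiter n z (Set.uIoo_subset_uIcc_self hz))
  refine ⟨ξ, ?_, ?_⟩
  · have := Set.abs_sub_left_of_mem_uIcc (Set.uIoo_subset_uIcc_self hξ)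
    simpa using this
  · rw [hiter _ _ (Set.uIoo_subset_uIcc_self hξ), taylor_within_apply, sub_eq_iff_eq_add] at h
    rw [taylorRatio, sum_range_succ, h, div_eq_iff (pow_ne_zero _ hδ)]
    rw [Finset.sum_congr rfl fun j _ => by rw [hiter j s Set.left_mem_uIcc]]
    simp only [add_sub_cancel_left, smul_eq_mul]
    rw [Finset.sum_congr rfl fun j (_ : j ∈ range (n + 1)) => show
      (j.factorial : ℝ)⁻¹ * δ ^ j * iteratedDeriv j σ s =
        δ ^ j / j.factorial * iteratedDeriv j σ s by ring]
    ring

/-- The limit is joint in base point and increment because the centres of blocks with free weights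
move along with the parameter. -/
theorem tendsto_taylorRatio (hσ : AnalyticOnNhd ℝ σ Set.univ) {e : ℕ} (he : 0 < e) (s : ℝ) :
    Tendsto (fun p : ℝ × ℝ => taylorRatio σ e p.1 p.2) (𝓝 (s, 0)) (𝓝 0) := by
  rw [Metric.tendsto_nhds]
  intro ε hε
  have hcont : ContinuousAt (iteratedDeriv e σ) s :=
    (analyticOnNhd_iteratedDeriv hσ e s trivial).continuousAt
  obtain ⟨ρ, hρ, hball⟩ := Metric.continuousAt_iff.1 hcont (ε / 2) (by positivity)
  have h1 : ∀ᶠ p : ℝ × ℝ in 𝓝 (s, 0), |p.1 - s| < ρ / 2 :=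
    (continuous_fst.tendsto (s, (0 : ℝ))).eventually (Metric.ball_mem_nhds s (half_pos hρ))
  have h2 : ∀ᶠ p : ℝ × ℝ in 𝓝 (s, 0), |p.2| < ρ / 2 := by
    filter_upwards [(continuous_snd.tendsto (s, (0 : ℝ))).eventually
      (Metric.ball_mem_nhds 0 (half_pos hρ))] with p hp
    simpa using hp
  filter_upwards [h1, h2] with p hp1 hp2
  rcases eq_or_ne p.2 0 with h | h
  · rw [taylorRatio, h, zero_pow he.ne']; simpa using hε
  obtain ⟨ξ, hξ, heq⟩ := exists_taylorRatio_eq hσ he p.1 h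
  have h3 : dist (iteratedDeriv e σ ξ) (iteratedDeriv e σ s) < ε / 2 := hball (by
    rw [Real.dist_eq]
    calc |ξ - s| ≤ |ξ - p.1| + |p.1 - s| := abs_sub_le _ _ _
      _ < ρ := by linarith)
  have h4 : dist (iteratedDeriv e σ p.1) (iteratedDeriv e σ s) < ε / 2 := hball (by
    rw [Real.dist_eq]; linarith)
  rw [Real.dist_eq] at h3 h4
  rw [Real.dist_eq, sub_zero, heq, abs_div, Nat.abs_cast]
  refine (div_le_self (abs_nonneg _) (by exact_mod_cast Nat.factorial_pos e)).trans_lt ?_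
  calc _ ≤ |iteratedDeriv e σ ξ - iteratedDeriv e σ s| + |iteratedDeriv e σ s -
        iteratedDeriv e σ p.1| := abs_sub_le _ _ _
    _ < ε := by rw [abs_sub_comm (iteratedDeriv e σ s)]; linarith

end Features

/-! ## Separation of branches by many samples -/

section Separation

open Filter Topology Finset

variable {d m r m₀ n : ℕ} {σ : ℝ → ℝ}

/-! ### The moments of a parameter over the blocks -/

/-- The weight of the block of which the weights of its neurons are perturbations. -/
def centre (B : BlockMap m r) (wb : Fin m₀ → Input d) (θ : Param d m) (t : Fin r) : Input d :=
  if h : (t : ℕ) < m₀ then wb ⟨t, h⟩ else weight θ (B.fst t)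

/-- The deviation of the weight of a neuron from the weight of its block. -/
def offset (B : BlockMap m r) (wb : Fin m₀ → Input d) (θ : Param d m) (k : Fin m) : Input d :=
  weight θ k - centre B wb θ (B.blk k)

/-- The coefficient of a Taylor feature in the difference of model and target. -/
noncomputable def moment (B : BlockMap m r) (abar : Fin m₀ → ℝ) (wb : Fin m₀ → Input d)
    (θ : Param d m) (i : Fin r × (Fin d → ℕ)) : ℝ :=
  ∑ k with B.blk k = i.1, outer θ k * ∏ j, offset B wb θ k j ^ i.2 j -
    if i.2 = 0 then blockSum abar r i.1 else 0

variable (B : BlockMap m r) (abar : Fin m₀ → ℝ) (wb : Fin m₀ → Input d)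

theorem offset_of_base (θ : Param d m) {k : Fin m} (hk : B.Base m₀ k) : offset B wb θ k = 0 := by
  rw [offset, centre, dif_neg (not_lt.2 hk.1), ← hk.2, sub_self]

theorem moment_zero (θ : Param d m) (t : Fin r) :
    moment B abar wb θ (t, 0) = ∑ k with B.blk k = t, outer θ k - blockSum abar r t := by
  simp [moment]

/-- The expansion of the difference of model and target. -/
theorem model_sub_network (hr : m₀ ≤ r) (θ : Param d m) (e : ℕ) (x : Input d) :
    model σ θ x - network σ abar wb x =
      ∑ t, ∑ j ∈ range (e + 1), ∑ α ∈ piAntidiag univ j,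
        moment B abar wb θ (t, α) * taylorFeature σ (centre B wb θ t) α x +
      ∑ k, outer θ k * (taylorRatio σ e (inner ℝ (centre B wb θ (B.blk k)) x)
        (inner ℝ (offset B wb θ k) x) * inner ℝ (offset B wb θ k) x ^ e) := by
  have hc : ∀ (t : Fin r) (s : Fin m₀), (t : ℕ) = s → centre B wb θ t = wb s := by
    intro t s h
    have : (t : ℕ) < m₀ := by omega
    rw [centre, dif_pos this]
    exact congrArg wb (Fin.ext h)
  have h1 : ∀ k, σ (inner ℝ (weight θ k) x) =
      ∑ j ∈ range (e + 1), ∑ α ∈ piAntidiag univ j,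
        (∏ i, offset B wb θ k i ^ α i) * taylorFeature σ (centre B wb θ (B.blk k)) α x +
      taylorRatio σ e (inner ℝ (centre B wb θ (B.blk k)) x)
        (inner ℝ (offset B wb θ k) x) * inner ℝ (offset B wb θ k) x ^ e := by
    intro k
    rw [← sum_taylorFeature, ← taylorRatio_mul, ← inner_add_left, offset, add_sub_cancel]
  have h2 : ∀ t, blockSum abar r t * σ (inner ℝ (centre B wb θ t) x) =
      ∑ j ∈ range (e + 1), ∑ α ∈ piAntidiag univ j,
        (if α = 0 then blockSum abar r t else 0) * taylorFeature σ (centre B wb θ t) α x := by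
    intro t
    rw [sum_range_succ', sum_eq_zero fun j _ => sum_eq_zero fun α hα => ?_]
    · simp [taylorFeature, Nat.multinomial]
    · rw [if_neg, zero_mul]
      rintro rfl
      simpa using (mem_piAntidiag.1 hα).1
  rw [network_eq_sum hr σ abar wb _ hc, model, network]
  simp only [h1, h2, mul_add, sum_add_distrib]
  rw [add_sub_right_comm]
  congr 1
  rw [← sum_fiberwise (s := univ) (g := B.blk), ← sum_sub_distrib]
  refine sum_congr rfl fun t _ => ?_
  simp only [mul_sum]
  rw [sum_comm, ← sum_sub_distrib]
  refine sum_congr rfl fun j _ => ?_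
  rw [sum_comm, ← sum_sub_distrib]
  refine sum_congr rfl fun α _ => ?_
  rw [moment, sub_mul, sum_mul]
  congr 1
  refine sum_congr rfl fun k hk => ?_
  rw [(mem_filter.1 hk).2]
  ring

/-! ### The moments as polynomials -/

/-- The neurons whose outer weights are free on the branch. -/
abbrev FreeNeuron (B : BlockMap m r) : Type := {k // k ≠ B.fst (B.blk k)}

/-- The indices of the coordinates transversal to the branch. -/
abbrev Transversal (d : ℕ) (B : BlockMap m r) (m₀ : ℕ) : Type :=
  Fin r ⊕ {k // ¬ B.Base m₀ k} × Fin d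

open Classical in
/-- The outer weights in terms of the free ones and the block sums. -/
noncomputable def outerPoly (d : ℕ) (k : Fin m) :
    MvPolynomial (FreeNeuron B ⊕ Transversal d B m₀) ℝ :=
  if h : k ≠ B.fst (B.blk k) then MvPolynomial.X (Sum.inl ⟨k, h⟩)
  else MvPolynomial.C (blockSum abar r (B.blk k)) +
    MvPolynomial.X (Sum.inr (Sum.inl (B.blk k))) -
    ∑ k' ∈ univ.filter fun k' : FreeNeuron B => B.blk k'.1 = B.blk k, MvPolynomial.X (Sum.inl k')

open Classical in
/-- The offsets as coordinates. -/
noncomputable def offsetPoly (m₀ : ℕ) (k : Fin m) (j : Fin d) :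
    MvPolynomial (FreeNeuron B ⊕ Transversal d B m₀) ℝ :=
  if h : ¬ B.Base m₀ k then MvPolynomial.X (Sum.inr (Sum.inr (⟨k, h⟩, j))) else 0

/-- The moments as polynomials. -/
noncomputable def momentPoly (i : Fin r × (Fin d → ℕ)) :
    MvPolynomial (FreeNeuron B ⊕ Transversal d B m₀) ℝ :=
  ∑ k with B.blk k = i.1, outerPoly B abar d k * ∏ j, offsetPoly B m₀ k j ^ i.2 j -
    if i.2 = 0 then MvPolynomial.C (blockSum abar r i.1) else 0

/-- The transversal coordinates of a parameter. -/
noncomputable def transversal (θ : Param d m) : Transversal d B m₀ → ℝ :=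
  Sum.elim (fun t => ∑ k with B.blk k = t, outer θ k - blockSum abar r t)
    fun kj => offset B wb θ kj.1 kj.2

theorem sum_freeNeuron (a : Fin m → ℝ) (t : Fin r) :
    ∑ k' ∈ univ.filter (fun k' : FreeNeuron B => B.blk k'.1 = t), a k'.1 + a (B.fst t) = ∑ k with B.blk k = t, a k := by
  have hmem : B.fst t ∈ univ.filter fun k' => B.blk k' = t := by simp [B.blk_fst]
  rw [← add_sum_erase _ _ hmem, add_comm]
  congr 1
  refine sum_of_injOn Subtype.val Subtype.val_injective.injOn ?_ ?_ (fun _ _ => rfl)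
  · intro k hk
    have h1 : B.blk k = t := by simpa using hk
    have h2 := k.2
    rw [h1] at h2
    simp [h1, h2]
  · intro k hk h
    have h1 := (mem_filter.1 (mem_of_mem_erase hk)).2
    refine absurd ⟨⟨k, ?_⟩, ?_, rfl⟩ h
    · rw [h1]; exact ne_of_mem_erase hk
    · simpa using h1

theorem eval_momentPoly (θ : Param d m) (i : Fin r × (Fin d → ℕ)) :
    MvPolynomial.eval (Sum.elim (fun k : FreeNeuron B => outer θ k) (transversal B abar wb θ))
      (momentPoly B abar i) = moment B abar wb θ i := by
  have h1 : ∀ k, MvPolynomial.eval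
      (Sum.elim (fun k : FreeNeuron B => outer θ k) (transversal B abar wb θ))
      (outerPoly B abar d k) = outer θ k := by
    intro k
    rw [outerPoly]
    split_ifs with h
    · simp
    · have h2 := sum_freeNeuron B (outer θ) (B.blk k)
      rw [not_not] at h
      rw [← h] at h2
      simp only [map_sub, map_add, MvPolynomial.eval_C, MvPolynomial.eval_X, Sum.elim_inr,
        transversal, Sum.elim_inl, map_sum]
      linarith
  have h2 : ∀ k j, MvPolynomial.eval
      (Sum.elim (fun k : FreeNeuron B => outer θ k) (transversal B abar wb θ))
      (offsetPoly B m₀ k j) = offset B wb θ k j := by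
    intro k j
    rw [offsetPoly]
    split_ifs with h
    · rw [offset_of_base B wb θ h]; simp
    · simp [transversal]
  rw [momentPoly, moment, map_sub, map_sum]
  congr 1
  · refine sum_congr rfl fun k _ => ?_
    simp only [map_mul, map_prod, map_pow, h1, h2]
  · split_ifs <;> simp

open Classical in
theorem card_transversal (hr : m₀ ≤ r) :
    Fintype.card (Transversal d B m₀) = r + (m + m₀ - r) * d := by
  have := card_not_base B hr
  rw [Fintype.card_sum, Fintype.card_prod, Fintype.card_fin, Fintype.card_fin]
  congr 2
  omega

/-! ### Points of the branch away from the other zeros of the loss -/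

/-- For even `e` and outer weights of constant sign, the pure moment of order `e` in coordinate `j`
is up to sign a sum of nonnegative terms, so it dominates each. A base neuron of the wrong sign does
no harm, having zero offset. -/
theorem pow_offset_le {e : ℕ} (he : Even e) (he0 : e ≠ 0) {θ : Param d m}
    (hpos : ∀ k, ¬ B.Base m₀ k → 0 ≤ outer θ k * blockSign abar r (B.blk k)) (k : Fin m)
    (j : Fin d) :
    outer θ k * blockSign abar r (B.blk k) * offset B wb θ k j ^ e ≤
      |blockSign abar r (B.blk k)| * |moment B abar wb θ (B.blk k, Pi.single j e)| := by
  classical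
  have h1 : moment B abar wb θ (B.blk k, Pi.single j e) =
      ∑ k' with B.blk k' = B.blk k, outer θ k' * offset B wb θ k' j ^ e := by
    rw [moment, if_neg (by simpa using he0), sub_zero]
    refine sum_congr rfl fun k' _ => ?_
    rw [prod_eq_single j (fun i _ hi => by simp [Pi.single_eq_of_ne hi]) (by simp)]
    simp
  rw [← abs_mul, h1, mul_sum]
  refine le_trans (le_trans ?_ (single_le_sum (s := univ.filter fun k' => B.blk k' = B.blk k)
    (f := fun k' => blockSign abar r (B.blk k) * (outer θ k' * offset B wb θ k' j ^ e))
    (fun k' hk' => ?_) (mem_filter.2 ⟨mem_univ k, rfl⟩))) (le_abs_self _)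
  · exact le_of_eq (by ring)
  · by_cases hb : B.Base m₀ k'
    · rw [offset_of_base B wb θ hb]; simp [he0]
    · have h2 := hpos k' hb
      rw [(mem_filter.1 hk').2] at h2
      have h3 := mul_nonneg h2 (he.pow_nonneg (offset B wb θ k' j))
      linarith

theorem abs_inner_pow_le {e : ℕ} {v x : Input d} {K : ℝ}
    (h : ∀ j, |v j| ^ e ≤ K) (he0 : e ≠ 0) :
    |inner ℝ v x| ^ e ≤ K * (∑ j, |x j|) ^ e := by
  rcases isEmpty_or_nonempty (Fin d) with hd | hd
  · rw [PiLp.inner_apply]; simp [he0]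
  obtain ⟨j, hj⟩ := Finite.exists_max fun j => |v j|
  have h1 : |inner ℝ v x| ≤ |v j| * ∑ j, |x j| := by
    rw [PiLp.inner_apply, mul_sum]
    refine (abs_sum_le_sum_abs _ _).trans (sum_le_sum fun i _ => ?_)
    rw [RCLike.inner_apply, conj_trivial, abs_mul, mul_comm]
    exact mul_le_mul_of_nonneg_right (hj i) (abs_nonneg _)
  calc |inner ℝ v x| ^ e ≤ (|v j| * ∑ j, |x j|) ^ e := pow_le_pow_left₀ (abs_nonneg _) h1 e
    _ ≤ _ := by
      rw [mul_pow]
      exact mul_le_mul_of_nonneg_right (h j) (by positivity)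

theorem continuous_outer (k : Fin m) : Continuous fun θ : Param d m => outer θ k :=
  (outerL d k).continuous

theorem continuous_weight (k : Fin m) : Continuous fun θ : Param d m => weight θ k :=
  (weightL d k).continuous

theorem continuous_centre (t : Fin r) : Continuous fun θ : Param d m => centre B wb θ t := by
  unfold centre
  split_ifs
  · exact continuous_const
  · exact continuous_weight _

theorem continuous_offset (k : Fin m) : Continuous fun θ : Param d m => offset B wb θ k :=
  (continuous_weight k).sub (continuous_centre B wb _)

/-- Sufficiently general points of the branch are isolated from the other zeros of the loss. -/
theorem notMem_closure_lossZero_diff (hσ : IsGoodActivation σ) (hr : m₀ ≤ r)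
    (P : Partition m r) (hB : ∀ t k, P.InBlock t k ↔ B.blk k = t) {u : Fin r → Input d} (hu : Function.Injective u)
    (huw : ∀ (t : Fin r) (s : Fin m₀), (t : ℕ) = s → u t = wb s)
    (hu0 : ∀ t : Fin r, m₀ ≤ (t : ℕ) → u t ≠ 0) {e : ℕ} (he : Even e) (he0 : 0 < e)
    (hσe : iteratedDeriv e σ 0 ≠ 0) {y : Fin n → Input d} {a : Fin m → ℝ}
    (hapos : ∀ k, ¬ B.Base m₀ k → 0 < a k * blockSign abar r (B.blk k))
    (hy : ∀ z : featureIndex σ u e → ℝ, z ≠ 0 →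
      ((fun k : FreeNeuron B => a k), z) ∈ closure
        {z : (FreeNeuron B → ℝ) × (featureIndex σ u e → ℝ) |
          ∃ (h : Transversal d B m₀ → ℝ) (c : ℝ),
            z.2 = fun i => c * MvPolynomial.eval (Sum.elim z.1 h) (momentPoly B abar i.1)} →
      ∃ i, ∑ j : featureIndex σ u e, taylorFeature σ (u j.1.1) j.1.2 (y i) * z j ≠ 0) :
    mkParam a (fun k => u (B.blk k)) ∉ closure
      (lossZero m σ (network σ abar wb) y \ branch σ (network σ abar wb) wb P) := by
  classical
  intro hcl
  -- Along an ultrafilter of other zeros converging to the point, the normalized moments converge by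
  -- compactness of the sphere.
  obtain ⟨𝒰, h𝒰S, h𝒰⟩ := mem_closure_iff_ultrafilter.1 hcl
  set θ₀ : Param d m := mkParam a (fun k => u (B.blk k)) with hθ₀
  have hcentre₀ : ∀ t, centre B wb θ₀ t = u t := by
    intro t
    rw [centre]
    split_ifs with h
    · exact (huw t ⟨t, h⟩ rfl).symm
    · simp [hθ₀, B.blk_fst]
  have hoffset₀ : ∀ k, offset B wb θ₀ k = 0 := by
    intro k
    rw [offset, hcentre₀]
    simp [hθ₀]
  set T : Param d m → featureIndex σ u e → ℝ := fun θ i => moment B abar wb θ i.1 with hT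
  have hmem0 : ∀ t, ((t, 0) : Fin r × (Fin d → ℕ)) ∈ featureIndex σ u e := fun t =>
    mem_featureIndex.2 ⟨by simp, Or.inr (by simpa using hσ.zero_ne)⟩
  -- The choice `σ⁽ᵉ⁾(0) ≠ 0` keeps these pure moments in the list even if the centre of the block
  -- is zero.
  have hmemE : ∀ t j, ((t, Pi.single j e) : Fin r × (Fin d → ℕ)) ∈ featureIndex σ u e :=
    fun t j => mem_featureIndex.2 ⟨by simp, Or.inr (by simpa using hσe)⟩
  have hTle : ∀ θ i (hi : i ∈ featureIndex σ u e), |moment B abar wb θ i| ≤ ‖T θ‖ := fun θ i hi =>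
    norm_le_pi_norm (T θ) ⟨i, hi⟩
  -- the offsets are controlled by the moments
  obtain ⟨K, hKb⟩ : ∃ K : ℝ, ∀ᶠ θ in (𝒰 : Filter (Param d m)), ∀ k j,
      |offset B wb θ k j| ^ e ≤ K * ‖T θ‖ := by
    have h1 : ∀ᶠ θ in (𝒰 : Filter (Param d m)), ∀ k, ¬ B.Base m₀ k →
        a k * blockSign abar r (B.blk k) / 2 < outer θ k * blockSign abar r (B.blk k) := by
      refine h𝒰 (eventually_all.2 fun k => ?_)
      by_cases hk : B.Base m₀ k
      · exact Eventually.of_forall fun θ h => absurd hk h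
      · refine (((continuous_outer k).mul continuous_const).continuousAt.eventually_const_lt
          ?_).mono fun θ h _ => h
        exact half_lt_self (hapos k hk)
    set c : Fin m → ℝ := fun k => |blockSign abar r (B.blk k)| /
      (|a k * blockSign abar r (B.blk k)| / 2) with hc
    have hc0 : ∀ k, 0 ≤ c k := fun k => by positivity
    refine ⟨∑ k, c k, ?_⟩
    filter_upwards [h1] with θ hθ k j
    by_cases hk : B.Base m₀ k
    · rw [offset_of_base B wb θ hk]
      simp only [PiLp.zero_apply, abs_zero, zero_pow he0.ne']
      exact mul_nonneg (sum_nonneg fun k _ => hc0 k) (norm_nonneg _)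
    have h2 := pow_offset_le B abar wb he he0.ne' (θ := θ) (fun k hk =>
      (half_pos (hapos k hk)).le.trans (hθ k hk).le) k j
    have h3 := hTle θ _ (hmemE (B.blk k) j)
    have h4 := hapos k hk
    rw [← he.pow_abs] at h2
    calc |offset B wb θ k j| ^ e ≤ c k * ‖T θ‖ := by
          rw [hc]
          simp only
          rw [abs_of_pos h4, div_mul_eq_mul_div, le_div_iff₀ (half_pos h4), mul_comm]
          refine (mul_le_mul_of_nonneg_right (hθ k hk).le (by positivity)).trans (h2.trans ?_)
          exact mul_le_mul_of_nonneg_left h3 (abs_nonneg _)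
      _ ≤ _ := mul_le_mul_of_nonneg_right (single_le_sum (fun k _ => hc0 k) (mem_univ k))
          (norm_nonneg _)
  have hinj : ∀ᶠ θ in (𝒰 : Filter (Param d m)),
      Function.Injective fun t => weight θ (B.fst t) := by
    refine h𝒰 ((isOpen_injective_weight B).mem_nhds ?_)
    simpa [hθ₀, B.blk_fst] using hu
  have hS : ∀ᶠ θ in (𝒰 : Filter (Param d m)),
      θ ∈ lossZero m σ (network σ abar wb) y \ branch σ (network σ abar wb) wb P := h𝒰S
  -- If all moments vanish, the bound kills the offsets and the moments of order zero give the
  -- correct block sums, so the parameter would lie on the branch.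
  have hne : ∀ᶠ θ in (𝒰 : Filter (Param d m)), T θ ≠ 0 := by
    filter_upwards [hKb, hinj, hS] with θ h1 h2 h3 h4
    refine h3.2 ?_
    have h5 : ∀ k, offset B wb θ k = 0 := by
      intro k
      ext j
      have := h1 k j
      rw [h4, norm_zero, mul_zero] at this
      exact abs_eq_zero.1 ((pow_eq_zero_iff he0.ne').1 (le_antisymm this (by positivity)))
    have h6 : ∀ k, weight θ k = centre B wb θ (B.blk k) := fun k => sub_eq_zero.1 (h5 k)
    refine (mem_branch_iff hσ hr abar wb P B hB θ).2 ⟨h2, fun k => ?_, fun t s h => ?_, fun t => ?_⟩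
    · rw [h6 k, h6 (B.fst _), B.blk_fst]
    · have ht : (t : ℕ) < m₀ := by omega
      rw [h6, B.blk_fst, centre, dif_pos ht]
      exact congrArg wb (Fin.ext h)
    · have h7 := congrFun h4 ⟨_, hmem0 t⟩
      rw [hT] at h7
      simp only [Pi.zero_apply, moment_zero] at h7
      linarith
  -- a limit direction of the moments
  have hsphere : ∀ᶠ θ in (𝒰 : Filter (Param d m)), ‖T θ‖⁻¹ • T θ ∈ Metric.sphere 0 1 := by
    filter_upwards [hne] with θ h
    rw [mem_sphere_zero_iff_norm, norm_smul, norm_inv, norm_norm,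
      inv_mul_cancel₀ (norm_ne_zero_iff.2 h)]
  obtain ⟨z, hz, hlim⟩ := (isCompact_sphere (0 : featureIndex σ u e → ℝ) 1).ultrafilter_le_nhds'
    (𝒰.map fun θ => ‖T θ‖⁻¹ • T θ) hsphere
  have hlim : Tendsto (fun θ => ‖T θ‖⁻¹ • T θ) (𝒰 : Filter (Param d m)) (𝓝 z) := hlim
  have hz0 : z ≠ 0 := by
    rintro rfl
    simp at hz
  obtain ⟨i, hi⟩ := hy z hz0 (mem_closure_of_tendsto
    (f := fun θ : Param d m => ((fun k : FreeNeuron B => outer θ k), ‖T θ‖⁻¹ • T θ))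
    (b := (𝒰 : Filter (Param d m)))
    (Tendsto.prodMk_nhds (tendsto_pi_nhds.2 fun k =>
      (((continuous_outer (d := d) k.1).tendsto θ₀).mono_left h𝒰)) hlim)
    (Eventually.of_forall fun θ => ⟨transversal B abar wb θ, ‖T θ‖⁻¹, by
      funext i
      rw [eval_momentPoly]
      rfl⟩))
  -- As the residual vanishes at a zero, the features paired with the normalized moments equal minus
  -- the normalized remainder: a `taylorRatio` tending to zero times factors bounded by `hKb`. So
  -- the limit direction is killed by every sample.
  refine hi (tendsto_nhds_unique (f := fun θ => ∑ j : featureIndex σ u e,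
    taylorFeature σ (centre B wb θ j.1.1) j.1.2 (y i) * (‖T θ‖⁻¹ • T θ) j)
    (l := (𝒰 : Filter (Param d m))) ?_ ?_)
  · refine tendsto_finsetSum _ fun j _ => Tendsto.mul ?_ (tendsto_pi_nhds.1 hlim j)
    rw [← hcentre₀]
    exact (((continuous_taylorFeature hσ.1 j.1.2 (y i)).comp
      (continuous_centre B wb j.1.1)).tendsto θ₀).mono_left h𝒰
  have hrem : Tendsto (fun θ => -∑ k, outer θ k *
      (taylorRatio σ e (inner ℝ (centre B wb θ (B.blk k)) (y i)) (inner ℝ (offset B wb θ k) (y i)) *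
        (‖T θ‖⁻¹ * inner ℝ (offset B wb θ k) (y i) ^ e))) (𝒰 : Filter (Param d m)) (𝓝 0) := by
    suffices h : ∀ k, Tendsto (fun θ => outer θ k *
        (taylorRatio σ e (inner ℝ (centre B wb θ (B.blk k)) (y i))
          (inner ℝ (offset B wb θ k) (y i)) *
        (‖T θ‖⁻¹ * inner ℝ (offset B wb θ k) (y i) ^ e))) (𝒰 : Filter (Param d m)) (𝓝 0) by
      simpa using (tendsto_finsetSum univ fun k _ => h k).neg
    intro k
    refine (mul_zero (outer θ₀ k)) ▸
      Tendsto.mul (((continuous_outer k).tendsto θ₀).mono_left h𝒰) ?_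
    have h1 : Tendsto (fun θ => taylorRatio σ e (inner ℝ (centre B wb θ (B.blk k)) (y i))
        (inner ℝ (offset B wb θ k) (y i))) (𝒰 : Filter (Param d m)) (𝓝 0) := by
      refine (tendsto_taylorRatio hσ.1 he0 (inner ℝ (centre B wb θ₀ (B.blk k)) (y i))).comp
        (f := fun θ => (inner ℝ (centre B wb θ (B.blk k)) (y i),
          inner ℝ (offset B wb θ k) (y i))) (Tendsto.mono_left ?_ h𝒰)
      have h2 : Continuous fun θ : Param d m => (inner ℝ (centre B wb θ (B.blk k)) (y i),
          inner ℝ (offset B wb θ k) (y i)) :=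
        ((continuous_centre B wb _).inner continuous_const).prodMk
          ((continuous_offset B wb k).inner continuous_const)
      have h3 := h2.tendsto θ₀
      rwa [hoffset₀, inner_zero_left] at h3
    refine h1.zero_mul_isBoundedUnder_le ⟨K * (∑ j, |y i j|) ^ e, ?_⟩
    rw [eventually_map]
    filter_upwards [hKb, hne] with θ h2 h3
    have h4 := norm_pos_iff.2 h3
    have h5 := abs_inner_pow_le (x := y i) (h2 k) he0.ne'
    rw [Function.comp_apply, Real.norm_eq_abs, abs_mul, abs_inv, abs_norm, abs_pow,
      inv_mul_le_iff₀ h4]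
    exact h5.trans (le_of_eq (by ring))
  refine hrem.congr' ?_
  filter_upwards [hS] with θ hθ
  have h1 := model_sub_network (σ := σ) B abar wb hr θ e (y i)
  rw [mem_lossZero.1 hθ.1 i, sub_self, ← sum_featureIndex (u := u)
    (fun j => moment B abar wb θ j * taylorFeature σ (centre B wb θ j.1) j.2 (y i))] at h1
  · rw [neg_eq_iff_add_eq_zero]
    have h2 := congrArg (fun s => ‖T θ‖⁻¹ * s) h1
    simp only [mul_zero, mul_add, mul_sum] at h2
    rw [h2, add_comm]
    congr 1
    · refine sum_congr rfl fun j _ => ?_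
      simp only [hT, Pi.smul_apply, smul_eq_mul]
      ring
    · exact sum_congr rfl fun k _ => by ring
  -- A feature left out because its centre is zero remains zero near the point: by `hu0` such a
  -- centre is a target weight, and those do not move.
  · intro j h2 h3
    have h4 : (j.1 : ℕ) < m₀ := by
      by_contra h
      exact hu0 _ (not_lt.1 h) h2
    rw [taylorFeature_eq_zero _ h3, mul_zero]
    rw [centre, dif_pos h4, ← huw j.1 ⟨_, h4⟩ rfl, h2]

theorem exists_eval_ne_zero {A : Type*} [Fintype A] {Q : MvPolynomial A ℝ} (hQ : Q ≠ 0)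
    {V : Set (A → ℝ)} (hV : IsOpen V) {a : A → ℝ} (ha : a ∈ V) :
    ∃ b ∈ V, MvPolynomial.eval b Q ≠ 0 := by
  by_contra! hcon
  obtain ⟨ε, hε, hball⟩ := Metric.isOpen_iff.1 hV a ha
  refine hQ (MvPolynomial.funext_set (fun i => Metric.ball (a i) ε)
    (fun i => infinite_of_mem_nhds (a i) (Metric.ball_mem_nhds _ hε)) fun b hb => ?_)
  rw [map_zero]
  exact hcon b (hball ((dist_pi_lt_iff hε).2 fun i => hb i trivial))

/-- Free weights are taken nonzero so that the features vanishing identically stay the same for all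
nearby centres. -/
theorem exists_weights (hd : 1 ≤ d) {wb : Fin m₀ → Input d} (hwb : Function.Injective wb)
    (r : ℕ) : ∃ u : Fin r → Input d, Function.Injective u ∧
      (∀ (t : Fin r) (s : Fin m₀), (t : ℕ) = s → u t = wb s) ∧
      ∀ t : Fin r, m₀ ≤ (t : ℕ) → u t ≠ 0 := by
  classical
  have : Nonempty (Fin d) := ⟨⟨0, hd⟩⟩
  have hinf : ((insert 0 (univ.image wb) : Finset (Input d)) : Set (Input d))ᶜ.Infinite :=
    (Finset.finite_toSet _).infinite_compl
  set φ := hinf.natEmbedding with hφ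
  have hφ' : ∀ k, (φ k : Input d) ≠ 0 ∧ ∀ s, (φ k : Input d) ≠ wb s := by
    intro k
    have := (φ k).2
    simp only [coe_insert, coe_image, coe_univ, Set.image_univ, Set.mem_compl_iff,
      Set.mem_insert_iff, Set.mem_range, not_or, not_exists] at this
    exact ⟨this.1, fun s h => this.2 s h.symm⟩
  refine ⟨fun t => if h : (t : ℕ) < m₀ then wb ⟨t, h⟩ else φ t, fun t t' h => ?_, fun t s h => ?_,
    fun t ht => ?_⟩
  · simp only at h
    split_ifs at h with h1 h2 h2
    · exact Fin.ext (congrArg (fun s : Fin m₀ => (s : ℕ)) (hwb h))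
    · exact absurd h.symm ((hφ' _).2 _)
    · exact absurd h ((hφ' _).2 _)
    · exact Fin.ext (φ.injective (Subtype.ext h))
  · have ht : (t : ℕ) < m₀ := by omega
    simp only [dif_pos ht]
    exact congrArg wb (Fin.ext h)
  · simp only [dif_neg (not_lt.2 ht)]
    exact (hφ' _).1

open Classical in
/-- The outer weights with given free ones that sum to the block sums. -/
noncomputable def fillOuter (b : FreeNeuron B → ℝ) (k : Fin m) : ℝ :=
  if h : k ≠ B.fst (B.blk k) then b ⟨k, h⟩
  else blockSum abar r (B.blk k) - ∑ k' ∈ univ.filter fun k' : FreeNeuron B =>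
    B.blk k'.1 = B.blk k, b k'

theorem fillOuter_free (b : FreeNeuron B → ℝ) (k : FreeNeuron B) :
    fillOuter B abar b k = b k := by
  rw [fillOuter, dif_pos k.2]

theorem sum_fillOuter (b : FreeNeuron B → ℝ) (t : Fin r) :
    ∑ k with B.blk k = t, fillOuter B abar b k = blockSum abar r t := by
  rw [← sum_freeNeuron]
  simp only [fillOuter_free]
  rw [fillOuter, dif_neg (by rw [B.blk_fst]; simp), B.blk_fst]
  ring

theorem fillOuter_stdOuter : fillOuter B abar (fun k => B.stdOuter abar k) = B.stdOuter abar := by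
  funext k
  rw [fillOuter]
  split_ifs with h
  · rfl
  · have h1 := sum_freeNeuron B (B.stdOuter abar) (B.blk k)
    rw [B.sum_stdOuter] at h1
    rw [not_not] at h
    rw [← h] at h1
    linarith

theorem continuous_fillOuter (k : Fin m) : Continuous fun b => fillOuter B abar b k := by
  unfold fillOuter
  split_ifs <;> fun_prop

variable {abar wb} in
/-- General samples, more than the codimension of the branch, separate the branch. -/
theorem exists_separates (hd : 1 ≤ d) (hσ : IsGoodActivation σ) (hr : m₀ ≤ r)
    (habar : ∀ k, abar k ≠ 0) (hwb : Function.Injective wb) (P : Partition m r)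
    (hn : r + (m + m₀ - r) * d < n)
    (O : Fin n → Set (Input d)) (hO : ∀ i, IsOpen (O i)) (hO' : ∀ i, (O i).Nonempty) :
    ∃ y : Fin n → Input d, (∀ i, y i ∈ O i) ∧ ∃ U : Set (Param d m),
      Separates U (lossZero m σ (network σ abar wb) y) (branch σ (network σ abar wb) wb P) := by
  classical
  obtain ⟨B, hB, -⟩ := P.exists_blockMap
  obtain ⟨u, hu, huw, hu0⟩ := exists_weights hd hwb r
  obtain ⟨e, he0, he, hσe⟩ := (hσ.exists_iteratedDeriv_ne 0).2
  -- The free outer weights are the base of the polynomial family and the transversal coordinates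
  -- its parameters; their number is the codimension of the branch, less than `n`.
  obtain ⟨y, hyO, Q, hQ, hy⟩ := exists_generic_forms
    (fun i : featureIndex σ u e => momentPoly (d := d) B abar i.1)
    (fun x i => taylorFeature σ (u i.1.1) i.1.2 x) (isOpen_dense_features hσ hu e)
    (by rwa [card_transversal B hr]) O hO hO'
  -- The sign condition is open in the free outer weights and holds at the standard ones, so it is
  -- compatible with avoiding the zeros of `Q`.
  have hV : IsOpen {b : FreeNeuron B → ℝ | ∀ k, ¬ B.Base m₀ k →
      0 < fillOuter B abar b k * blockSign abar r (B.blk k)} := by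
    simp only [Set.ofPred_forall]
    exact isOpen_iInter_of_finite fun k => isOpen_iInter_of_finite fun _ =>
      isOpen_lt continuous_const ((continuous_fillOuter B abar k).mul continuous_const)
  obtain ⟨b, hbV, hbQ⟩ := exists_eval_ne_zero hQ hV (a := fun k => B.stdOuter abar k)
    (fun k hk => by rw [fillOuter_stdOuter]; exact B.stdOuter_mul_pos habar hk)
  have hnot := notMem_closure_lossZero_diff B abar wb hσ hr P hB hu huw hu0 he he0 hσe
    (y := y) (a := fillOuter B abar b) hbV (by
      simp only [fillOuter_free]
      exact hy b hbQ)
  refine ⟨y, hyO, _, isClosed_closure.isOpen_compl, ⟨_, hnot,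
    mkParam_mem_branch hσ hr abar wb P B hB hu huw (sum_fillOuter B abar b)⟩, ?_⟩
  ext θ
  refine and_congr_right fun hθ => ⟨fun h => ?_, fun h => Qstar_subset_lossZero y h.1⟩
  by_contra hcon
  exact hθ (subset_closure ⟨h, hcon⟩)

end Separation

/-! ## Perturbation of the samples -/

section Perturbation

open Matrix

variable {d m r m₀ n N : ℕ} {σ : ℝ → ℝ}

theorem isTypeII_of_rank {w : Fin m → Input d} (hw : Function.Injective w) {x : Fin N → Input d}
    (hx : (sampleMatrix σ w x).rank = (d + 1) * m) (hmN : m ≤ N) : IsTypeII σ w x := by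
  obtain ⟨e, he⟩ := exists_isTypeII w hw x hx hmN le_rfl
  obtain ⟨i, hi⟩ := he.1.2
  refine ⟨⟨hw, e ∘ i, hi⟩, ?_⟩
  have := (sampleMatrix σ w x).rank_le_card_height
  rw [Fintype.card_fin] at this
  rw [hx, min_eq_right (hx ▸ this)]

/-- For `N = (d + 1) m` the matrix is square up to relabelling, and full rank is nonvanishing of a
continuous determinant. -/
theorem isOpen_rank_sampleMatrix (hσ : AnalyticOnNhd ℝ σ Set.univ) (w : Fin m → Input d)
    (hN : N = (d + 1) * m) :
    IsOpen {x : Fin N → Input d | (sampleMatrix σ w x).rank = N} := by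
  classical
  have ε : Fin N ≃ Fin m ⊕ Fin m × Fin d :=
    Fintype.equivOfCardEq (by rw [card_columns, Fintype.card_fin, hN])
  have hrank : ∀ x : Fin N → Input d, (sampleMatrix σ w x).rank = N ↔
      ((sampleMatrix σ w x).submatrix id ε).det ≠ 0 := by
    intro x
    rw [← Matrix.rank_submatrix (sampleMatrix σ w x) (Equiv.refl _) ε, ← isUnit_iff_ne_zero,
      ← Matrix.isUnit_iff_isUnit_det, ← Matrix.linearIndependent_rows_iff_isUnit,
      linearIndependent_iff_card_eq_finrank_span, Set.finrank,
      ← Matrix.rank_eq_finrank_span_row, Fintype.card_fin]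
    exact eq_comm
  simp only [hrank]
  refine isOpen_ne_fun (Continuous.matrix_det (continuous_matrix fun i c => ?_)) continuous_const
  have h0 : Continuous σ := continuous_iff_continuousAt.2 fun t => (hσ t trivial).continuousAt
  have h1 : Continuous (deriv σ) :=
    continuous_iff_continuousAt.2 fun t => (hσ.deriv t trivial).continuousAt
  simp only [submatrix_apply, id_eq]
  rcases ε c with k | ⟨k, j⟩
  · simp only [sampleMatrix, of_apply]
    fun_prop
  · simp only [sampleMatrix, of_apply]
    fun_prop

/-- Many samples: after an arbitrarily small perturbation the samples separate the branch. -/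
theorem exists_perturbation_separates (hd : 1 ≤ d) (hσ : IsGoodActivation σ) (hr : m₀ ≤ r)
    {abar : Fin m₀ → ℝ} (habar : ∀ k, abar k ≠ 0) {wb : Fin m₀ → Input d}
    (hwb : Function.Injective wb) (P : Partition m r) (hn : r + (m + m₀ - r) * d < n)
    {w : Fin m → Input d} {x : Fin ((d + 1) * m) → Input d} (hx : IsTypeII σ w x)
    (e : Fin n ↪ Fin ((d + 1) * m)) {ε : ℝ} (hε : 0 < ε) :
    ∃ x' : Fin ((d + 1) * m) → Input d, (∀ i, ‖x' i - x i‖ < ε) ∧ IsTypeII σ w x' ∧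
      ∃ U : Set (Param d m), Separates U (lossZero m σ (network σ abar wb) (x' ∘ e))
        (branch σ (network σ abar wb) wb P) := by
  have hrank := hx.2
  rw [min_self] at hrank
  obtain ⟨δ, hδ, hball⟩ := Metric.isOpen_iff.1 (isOpen_rank_sampleMatrix hσ.1 w rfl) x hrank
  obtain ⟨y, hy, U, hU⟩ := exists_separates hd hσ hr habar hwb P hn
    (fun i => Metric.ball (x (e i)) (min δ ε)) (fun i => Metric.isOpen_ball)
    fun i => Metric.nonempty_ball.2 (lt_min hδ hε)
  have hx' : ∀ i, dist (Function.extend e y x i) (x i) < min δ ε := by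
    intro i
    by_cases h : ∃ j, e j = i
    · obtain ⟨j, rfl⟩ := h
      rw [e.injective.extend_apply]; exact hy j
    · rw [Function.extend_apply' _ _ _ h, dist_self]; exact lt_min hδ hε
  refine ⟨Function.extend e y x, fun i => ?_, ?_, U, ?_⟩
  · rw [← dist_eq_norm]; exact (hx' i).trans_le (min_le_right _ _)
  · refine isTypeII_of_rank hx.1.1 (hball ?_) (Nat.le_mul_of_pos_left m (Nat.succ_pos d))
    exact (dist_pi_lt_iff hδ).2 fun i => (hx' i).trans_le (min_le_left _ _)
  · rwa [show Function.extend e y x ∘ e = y from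
      funext fun i => e.injective.extend_apply _ _ i]

end Perturbation
end TwoLayer

/-! ### Assembly of the three statements -/

theorem mainTheorem3 {d m m₀ : ℕ} (hd : 1 ≤ d) (hm₀ : 1 ≤ m₀) (hm : m₀ ≤ m)
    (σ : ℝ → ℝ) (hσ : TwoLayer.IsGoodActivation σ)
    (abar : Fin m₀ → ℝ) (habar : ∀ k, abar k ≠ 0)
    -- `w̄₁, …, w̄_{m₀}` are the target weights, `w̄_{m₀+1}, …, w̄_m` an arbitrary completion
    (wbar : Fin m → TwoLayer.Input d) (hwbar : Function.Injective wbar)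
    (f : TwoLayer.Input d → ℝ)
    (hf : f = TwoLayer.network σ abar (wbar ∘ Fin.castLE hm))
    (x : Fin ((d + 1) * m) → TwoLayer.Input d) (hx : TwoLayer.IsTypeII σ wbar x) :
    -- (a)
    (∀ n : ℕ, m₀ ≤ n → n ≤ (d + 1) * m₀ →
      (∃ e : Fin n ↪ Fin ((d + 1) * m),
        TwoLayer.IsTypeII σ (wbar ∘ Fin.castLE hm) (x ∘ e)) ∧
      ∀ e : Fin n ↪ Fin ((d + 1) * m),
        TwoLayer.IsTypeII σ (wbar ∘ Fin.castLE hm) (x ∘ e) →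
        ∀ θ ∈ TwoLayer.Qstar m σ f, ∃ U : Set (TwoLayer.Param d m), IsOpen U ∧ θ ∈ U ∧
          TwoLayer.IsMorseBottAt (TwoLayer.loss m σ f (x ∘ e))
            (U ∩ TwoLayer.lossZero m σ f (x ∘ e))) ∧
    ∀ (r : ℕ) (_ : m₀ ≤ r) (hr : r ≤ m) (n : ℕ) (_ : r ≤ n) (_ : n ≤ (d + 1) * m)
      (P : TwoLayer.Partition m r) (l : ℕ) (_ : P.deficient m₀ = l),
      -- (b), few samples
      (n ≤ r + (r - l) * d →
        (∃ e : Fin n ↪ Fin ((d + 1) * m),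
          TwoLayer.IsTypeII σ (wbar ∘ Fin.castLE ((Nat.sub_le r l).trans hr)) (x ∘ e)) ∧
        ∀ e : Fin n ↪ Fin ((d + 1) * m),
          TwoLayer.IsTypeII σ (wbar ∘ Fin.castLE ((Nat.sub_le r l).trans hr)) (x ∘ e) →
          ∃ U : Set (TwoLayer.Param d m), IsOpen U ∧
            (U ∩ TwoLayer.branch σ f (wbar ∘ Fin.castLE hm) P).Nonempty ∧
            U ∩ TwoLayer.branch σ f (wbar ∘ Fin.castLE hm) P ⊆
              U ∩ TwoLayer.lossZero m σ f (x ∘ e) ∧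
            TwoLayer.IsMorseBottAt (TwoLayer.loss m σ f (x ∘ e))
              (U ∩ TwoLayer.lossZero m σ f (x ∘ e))) ∧
      -- (b), many samples
      (r + (m + m₀ - r) * d < n →
        ∀ (e : Fin n ↪ Fin ((d + 1) * m)) (ε : ℝ), 0 < ε →
          ∃ x' : Fin ((d + 1) * m) → TwoLayer.Input d,
            (∀ i, ‖x' i - x i‖ < ε) ∧ TwoLayer.IsTypeII σ wbar x' ∧
            ∃ U : Set (TwoLayer.Param d m),
              TwoLayer.Separates U (TwoLayer.lossZero m σ f (x' ∘ e))
                (TwoLayer.branch σ f (wbar ∘ Fin.castLE hm) P)) ∧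
      -- (c)
      (r + (m + m₀ - r) * d ≤ n →
        (2 * r < m + m₀ →
          ∀ (y : Fin n → TwoLayer.Input d) (U : Set (TwoLayer.Param d m)),
            TwoLayer.Separates U (TwoLayer.lossZero m σ f y)
              (TwoLayer.branch σ f (wbar ∘ Fin.castLE hm) P) →
            ¬ TwoLayer.IsMorseBottAt (TwoLayer.loss m σ f y)
              (U ∩ TwoLayer.branch σ f (wbar ∘ Fin.castLE hm) P)) ∧
        (m + m₀ ≤ 2 * r →
          (l + m + m₀ = 2 * r →
            ∃ (e : Fin n ↪ Fin ((d + 1) * m)) (U : Set (TwoLayer.Param d m)),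
              TwoLayer.Separates U (TwoLayer.lossZero m σ f (x ∘ e))
                (TwoLayer.branch σ f (wbar ∘ Fin.castLE hm) P) ∧
              TwoLayer.IsMorseBottAt (TwoLayer.loss m σ f (x ∘ e))
                (U ∩ TwoLayer.branch σ f (wbar ∘ Fin.castLE hm) P)) ∧
          (l + m + m₀ ≠ 2 * r →
            ∀ (y : Fin n → TwoLayer.Input d) (U : Set (TwoLayer.Param d m)),
              TwoLayer.Separates U (TwoLayer.lossZero m σ f y)
                (TwoLayer.branch σ f (wbar ∘ Fin.castLE hm) P) →
              ¬ TwoLayer.IsMorseBottAt (TwoLayer.loss m σ f y)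
                (U ∩ TwoLayer.branch σ f (wbar ∘ Fin.castLE hm) P)))) := by
  subst hf
  have hrank : (TwoLayer.sampleMatrix σ wbar x).rank = (d + 1) * m := by
    rw [hx.2, min_self]
  have hxi := TwoLayer.injective_of_rank wbar x hrank
  have hwb : Function.Injective (wbar ∘ Fin.castLE hm) := hwbar.comp (Fin.castLE_injective hm)
  refine ⟨fun n hn hn' => ⟨?_, fun e he θ hθ =>
    TwoLayer.isMorseBottAt_of_few_samples hσ abar habar _ hn' he hθ⟩, ?_⟩
  · exact TwoLayer.exists_isTypeII _ hwb x
      (TwoLayer.sampleMatrix_rank_comp wbar x hrank (Fin.castLEEmb hm)) hn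
      (hn'.trans (Nat.mul_le_mul_left _ hm))
  classical
  intro r hmr hr n hrn hn P l hl
  obtain ⟨B, hB, hBl⟩ := P.exists_blockMap
  -- There are `r - l` nondeficient blocks, and `m₀ ≤ r - l ≤ m + m₀ - r`. As `m₀ ≥ 1`, the lower
  -- bound gives `l < r`, so `r - l` is not truncated. The upper bound is an equality exactly when
  -- `l + m + m₀ = 2 * r`, which settles the cases of (c).
  have hcard := B.card_not_deficient m₀
  rw [← hBl, hl] at hcard
  have hml : m₀ ≤ r - l := hcard ▸ B.le_card_not_deficient hmr
  have hle : r - l ≤ m + m₀ - r := hcard ▸ B.card_not_deficient_le hmr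
  refine ⟨fun hfew => ⟨?_, fun e he => ?_⟩, fun hmany e ε hε =>
    TwoLayer.exists_perturbation_separates hd hσ hmr habar hwb P hmany hx e hε,
    fun hmany => ⟨fun hlt y U hU => ?_, fun hge => ⟨fun heq => ?_, fun hne y U hU => ?_⟩⟩⟩
  · exact TwoLayer.exists_isTypeII _ (hwbar.comp (Fin.castLE_injective _)) x
      (TwoLayer.sampleMatrix_rank_comp wbar x hrank
        (Fin.castLEEmb ((Nat.sub_le r l).trans hr))) ((Nat.sub_le r l).trans hrn)
      hn
  · obtain ⟨U, hU, hUb, hMB⟩ := TwoLayer.exists_isMorseBottAt_of_isTypeII hd hσ hmr habar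
      (wbar ∘ Fin.castLE hm) P (hxi.comp e.injective)
      (w := wbar ∘ Fin.castLE ((Nat.sub_le r l).trans hr)) (by omega) (fun t s h => congrArg wbar (Fin.ext h)) he hfew
    exact ⟨U, hU, hUb, Set.inter_subset_inter_right _ fun θ hθ =>
      TwoLayer.Qstar_subset_lossZero _ hθ.1, hMB⟩
  -- Here `r - l ≤ r < m + m₀ - r` whatever `l` is.
  · exact TwoLayer.not_isMorseBottAt_branch hd hσ hmr abar _ P B hB (by omega) y hU.2.1
  · exact TwoLayer.exists_isMorseBottAt_branch hσ hmr habar _ P B hB (by omega) x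
      (hwbar.comp (Fin.castLE_injective hr)) (fun t s h => congrArg wbar (Fin.ext h))
      (TwoLayer.sampleMatrix_rank_comp wbar x hrank (Fin.castLEEmb hr)) hmany hn
  · exact TwoLayer.not_isMorseBottAt_branch hd hσ hmr abar _ P B hB (by omega) y hU.2.1
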